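/- Digraphs are finite and may have loops and parallel edges; $n=|V(D)|$, and a subdigraph is strongly connected if it is non-empty and has a walk from $u$ to $v$ for all its vertices $u,v$. For a digraph $D$, $T\subseteq V(D)$ and an integer $r\ge 0$, a $(T,r)$-balanced separator is a set $Z\subseteq V(D)$ such that every strong component of $D\setminus Z$ contains at most $r$ vertices of $T$; $T$ is $(q,r)$-linked if every $(T,r)$-balanced separator has at least $q+1$ vertices. A bramble in $D$ is a family of strongly connected subdigraphs of $D$ such that any two members $B,B'$ satisfy $V(B)\cap V(B')\neq\emptyset$ or there are edges of $D$ both from $V(B)$ to $V(B')$ and from $V(B')$ to $V(B)$. A hitting set of a bramble is a set of vertices that meets $V(B)$ for all its members $B$, and the order of a bramble is the minimum size of a hitting set. If $|T|=2q-1$, the $T$-bramble of $D$ is the family $\mathcal B_T$ of all induced, strongly connected subdigraphs $B$ of $D$ with $|V(B)\cap T|\ge q$. A set $A\subseteq V(D)$ is well-linked if for all disjoint $X,Y\subseteq A$ with $|X|=|Y|$ there are $|X|$ pairwise vertex-disjoint directed paths in $D$ from $X$ to $Y$. **Theorem.** For an integer $k\ge 0$ let $g(k)=(k+1)(\lfloor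 k/2\rfloor+1)-1$. There is an algorithm (a single program of a unit-cost random access machine with addition, subtraction and indirect addressing) and there are constants $C,c$ such that the following holds for every integer $k\ge 0$, every digraph $D$ on $n$ vertices and every $(g(k)-1,g(k)-1)$-linked set $T\subseteq V(D)$ with $|T|=2g(k)-1$ (so that $k\ge 1$). The $T$-bramble $\mathcal B_T$ of $D$ is a bramble of order $g(k)$. Given $k$, $T$ and the adjacency matrix of $D$ (with multiplicities), the algorithm halts after at most $C\cdot 2^{c\,k^2\log k}\cdot n^{c}$ steps, that is, in time $2^{\mathcal O(k^2\log k)}\cdot n^{\mathcal O(1)}$, and outputs the bramble $\mathcal B_T$ (presented implicitly by the set $T$), a directed path $P$ in $D$ such that $V(P)$ is a hitting set of $\mathcal B_T$, and a well-linked set $A\subseteq V(P)$ of size exactly $k$. -/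

import Mathlib

/-! ## Digraphs with loops and parallel edges -/

/-- A digraph with vertex set `V`; loops and parallel edges are allowed, and `mult u v` is the
number of edges from `u` to `v`. -/
structure MultiDigraph (V : Type*) where
  mult : V → V → ℕ

namespace MultiDigraph

variable {V : Type*}

/-- There is an edge from `u` to `v`. -/
def Adj (D : MultiDigraph V) (u v : V) : Prop := 0 < D.mult u v

/-- A subdigraph of `D`: a set of vertices, and between its vertices some of the edges of `D`. -/
structure Subgraph (D : MultiDigraph V) where
  verts : Finset V
  mult : V → V → ℕ
  mult_le : ∀ u v, mult u v ≤ D.mult u v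
  tail_mem : ∀ u v, 0 < mult u v → u ∈ verts
  head_mem : ∀ u v, 0 < mult u v → v ∈ verts

/-- The subdigraph contains all the edges of `D` between its vertices. -/
def Subgraph.IsInduced {D : MultiDigraph V} (B : D.Subgraph) : Prop :=
  ∀ u ∈ B.verts, ∀ v ∈ B.verts, B.mult u v = D.mult u v

/-- For all vertices `u`, `v` of the (nonempty) subdigraph `B` there is a walk of `B` from `u`
to `v`; exchanging `u` and `v` gives the walk back. -/
def Subgraph.StronglyConnected {D : MultiDigraph V} (B : D.Subgraph) : Prop :=
  B.verts.Nonempty ∧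
    ∀ u ∈ B.verts, ∀ v ∈ B.verts, Relation.ReflTransGen (fun x y => 0 < B.mult x y) u v

/-- The subdigraph `D[S]` induced by `S`. -/
def induce [DecidableEq V] (D : MultiDigraph V) (S : Finset V) : D.Subgraph where
  verts := S
  mult u v := if u ∈ S ∧ v ∈ S then D.mult u v else 0
  mult_le u v := by split_ifs <;> simp
  tail_mem u v h := by
    by_contra hu
    simp [hu] at h
  head_mem u v h := by
    by_contra hv
    simp [hv] at h

/-- `S` is the vertex set of a strong component of `D ∖ Z`, that is, of a maximal strongly
connected induced subdigraph of `D ∖ Z`. -/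
def IsStrongComponent [DecidableEq V] (D : MultiDigraph V) (Z S : Finset V) : Prop :=
  Maximal (fun S' : Finset V => Disjoint S' Z ∧ (D.induce S').StronglyConnected) S

/-- `Z` is a `(T, r)`-balanced separator: every strong component of `D ∖ Z` contains at most `r`
vertices of `T`. -/
def IsBalancedSeparator [DecidableEq V] (D : MultiDigraph V) (T : Finset V) (r : ℕ)
    (Z : Finset V) : Prop :=
  ∀ S, D.IsStrongComponent Z S → (S ∩ T).card ≤ r

/-- `T` is `(k, r)`-linked: every `(T, r)`-balanced separator has size at least `k + 1`. -/
def IsLinked [DecidableEq V] (D : MultiDigraph V) (T : Finset V) (k r : ℕ) : Prop :=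
  ∀ Z, D.IsBalancedSeparator T r Z → k + 1 ≤ Z.card

/-! ### Brambles -/

/-- A bramble: a family of strongly connected subdigraphs, any two of which share a vertex or are
joined by edges of `D` in both directions. -/
def IsBramble [DecidableEq V] (D : MultiDigraph V) (𝓑 : Set D.Subgraph) : Prop :=
  (∀ B ∈ 𝓑, B.StronglyConnected) ∧
    ∀ B ∈ 𝓑, ∀ B' ∈ 𝓑, (B.verts ∩ B'.verts).Nonempty ∨
      ((∃ u ∈ B.verts, ∃ v ∈ B'.verts, D.Adj u v) ∧ ∃ u ∈ B'.verts, ∃ v ∈ B.verts, D.Adj u v)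

/-- `C` meets every element of `𝓑`. -/
def IsHittingSet [DecidableEq V] {D : MultiDigraph V} (𝓑 : Set D.Subgraph) (C : Finset V) :
    Prop :=
  ∀ B ∈ 𝓑, (C ∩ B.verts).Nonempty

/-- `𝓑` has order `m`: the minimum size of a hitting set of `𝓑` is `m`. -/
def HasOrder [DecidableEq V] {D : MultiDigraph V} (𝓑 : Set D.Subgraph) (m : ℕ) : Prop :=
  IsLeast {j | ∃ C : Finset V, IsHittingSet 𝓑 C ∧ C.card = j} m

/-- The `T`-bramble of `D`, for a set `T` of size `2 * k - 1`: all the induced strongly connected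
subdigraphs that contain at least `k` vertices of `T`. -/
def tBramble [DecidableEq V] (D : MultiDigraph V) (T : Finset V) (k : ℕ) : Set D.Subgraph :=
  {B | B.IsInduced ∧ B.StronglyConnected ∧ k ≤ (B.verts ∩ T).card}

/-! ### Paths and well-linked sets -/

/-- A directed path, as the sequence of its vertices: nonempty, without repetitions, and with an
edge from every vertex to the next one. -/
def IsPath (D : MultiDigraph V) (P : List V) : Prop :=
  P ≠ [] ∧ P.Nodup ∧ P.IsChain D.Adj

/-- A path from (a vertex of) `X` to (a vertex of) `Y`. -/
def IsPathFromTo (D : MultiDigraph V) (X Y : Finset V) (P : List V) : Prop :=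
  D.IsPath P ∧ (∃ x ∈ X, P.head? = some x) ∧ ∃ y ∈ Y, P.getLast? = some y

/-- `A` is well-linked: for all disjoint `X, Y ⊆ A` with `|X| = |Y|` there are `|X|`
vertex-disjoint paths from `X` to `Y`. -/
def IsWellLinked (D : MultiDigraph V) (A : Finset V) : Prop :=
  ∀ X Y : Finset V, X ⊆ A → Y ⊆ A → Disjoint X Y → X.card = Y.card →
    ∃ P : Fin X.card → List V, (∀ i, D.IsPathFromTo X Y (P i)) ∧
      ∀ i j, i ≠ j → (P i).Disjoint (P j)

end MultiDigraph

/-! ## Algorithms: structured programs for a unit-cost random access machine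

The machine works with natural numbers. A program uses finitely many variables and finitely many
one-dimensional arrays, which are named by numbers; the index of an array cell may be computed
(indirect addressing). The arithmetic operations are addition and truncated subtraction only
(a product has to be computed by a loop). -/

namespace Ram

/-- The contents of the memory: `var x` is the value of variable `x`, and `arr a i` is the value
of cell `i` of array `a`. -/
structure State where
  var : ℕ → ℕ
  arr : ℕ → ℕ → ℕ

/-- Replaces the value of variable `x` by `m`. -/
def State.setVar (s : State) (x m : ℕ) : State where
  var := Function.update s.var x m
  arr := s.arr

/-- Replaces the value of cell `i` of array `a` by `m`. -/
def State.setArr (s : State) (a i m : ℕ) : State where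
  var := s.var
  arr := Function.update s.arr a (Function.update (s.arr a) i m)

inductive Expr where
  | lit (m : ℕ) : Expr
  | var (x : ℕ) : Expr
  | get (a : ℕ) (i : Expr) : Expr
  | plus (e f : Expr) : Expr
  | minus (e f : Expr) : Expr

namespace Expr

def eval (s : State) : Expr → ℕ
  | lit m => m
  | var x => s.var x
  | get a i => s.arr a (i.eval s)
  | plus e f => e.eval s + f.eval s
  | minus e f => e.eval s - f.eval s

/-- The number of elementary operations needed to evaluate an expression. -/
def cost : Expr → ℕ
  | lit _ => 1
  | var _ => 1
  | get _ i => i.cost + 1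
  | plus e f => e.cost + f.cost + 1
  | minus e f => e.cost + f.cost + 1

end Expr

/-- Programs. In `cond e p q` and `loop e p` the test is whether `e` is nonzero. -/
inductive Program where
  | skip : Program
  | assign (x : ℕ) (e : Expr) : Program
  | store (a : ℕ) (i e : Expr) : Program
  | seq (p q : Program) : Program
  | cond (e : Expr) (p q : Program) : Program
  | loop (e : Expr) (p : Program) : Program

/-- `Exec p s t s'`: the program `p`, started with memory contents `s`, halts after exactly `t`
elementary steps, with memory contents `s'`. -/
inductive Exec : Program → State → ℕ → State → Prop where
  | skip (s : State) : Exec .skip s 1 s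
  | assign (x : ℕ) (e : Expr) (s : State) :
      Exec (.assign x e) s (e.cost + 1) (s.setVar x (e.eval s))
  | store (a : ℕ) (i e : Expr) (s : State) :
      Exec (.store a i e) s (i.cost + e.cost + 1) (s.setArr a (i.eval s) (e.eval s))
  | seq {p q : Program} {s s' s'' : State} {t t' : ℕ} :
      Exec p s t s' → Exec q s' t' s'' → Exec (.seq p q) s (t + t') s''
  | cond_true {e : Expr} {p q : Program} {s s' : State} {t : ℕ} :
      e.eval s ≠ 0 → Exec p s t s' → Exec (.cond e p q) s (e.cost + 1 + t) s'
  | cond_false {e : Expr} {p q : Program} {s s' : State} {t : ℕ} :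
      e.eval s = 0 → Exec q s t s' → Exec (.cond e p q) s (e.cost + 1 + t) s'
  | loop_stop {e : Expr} {p : Program} {s : State} :
      e.eval s = 0 → Exec (.loop e p) s (e.cost + 1) s
  | loop_step {e : Expr} {p : Program} {s s' s'' : State} {t t' : ℕ} :
      e.eval s ≠ 0 → Exec p s t s' → Exec (.loop e p) s' t' s'' →
      Exec (.loop e p) s (e.cost + 1 + t + t') s''

/-- The memory contents at the start, on input `k`, a digraph `D` with vertices `0, …, n - 1`, and
a set `T` of vertices: `n` and `k` in the variables `0` and `1`, the adjacency matrix of `D` (with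
multiplicities, row by row) in array `0`, the indicator of `T` in array `1`, zero elsewhere. -/
def inputState (k : ℕ) {n : ℕ} (D : MultiDigraph (Fin n)) (T : Finset (Fin n)) : State where
  var x := if x = 0 then n else if x = 1 then k else 0
  arr a i :=
    if a = 0 then
      if h : i < n * n then D.mult (Fin.divNat ⟨i, h⟩) (Fin.modNat ⟨i, h⟩) else 0
    else if a = 1 then
      if ∃ v ∈ T, (v : ℕ) = i then 1 else 0
    else 0

/-- The memory `s` contains, as output, the indicator of the set `T` in array `2` (the implicit
presentation of the `T`-bramble), the number of vertices of the path `P` in variable `2`, its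
vertices in order in array `3`, and the indicator of the set `A` in array `4`. -/
def HasOutput {n : ℕ} (s : State) (T : Finset (Fin n)) (P : List (Fin n)) (A : Finset (Fin n)) :
    Prop :=
  (∀ v : Fin n, s.arr 2 v = if v ∈ T then 1 else 0) ∧
    s.var 2 = P.length ∧ (∀ i : Fin P.length, s.arr 3 i = (P.get i : ℕ)) ∧
    ∀ v : Fin n, s.arr 4 v = if v ∈ A then 1 else 0

end Ram

/-- The function `g(k) = (k + 1) (⌊k / 2⌋ + 1) - 1`. -/
def brambleOrder (k : ℕ) : ℕ := (k + 1) * (k / 2 + 1) - 1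

/-! Write g = `brambleOrder k` = k(⌊k/2⌋+1) + ⌊k/2⌋. As |T| = 2g - 1, the members of the T-bramble
are the induced strongly connected subdigraphs containing a majority of T. Two majorities meet, so
this is a bramble, and any g vertices of T hit it. Linkedness says that any set of fewer than g
vertices misses some member.

Hitting path. Grow a path P greedily, keeping the invariant that its last vertex has an edge into
D∖V(P) from which the strong component holding a majority of T can be reached. The majority
components before and after a vertex is appended share a vertex of T, so the invariant survives
(`IsSearchPath.append`). When no majority component is left, V(P) is a hitting set
(`isHittingSet_of_forall_not_isBig`).

Well-linked set. Call Q rich if no set of at most k/2 vertices separates it, in either direction,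
from a majority of T. Cut P into consecutive minimal rich segments. A segment without its last
vertex is not rich, so a segment is disposed of at the price of ⌊k/2⌋+1 vertices: a separator and
the last vertex. A set that disposes of the whole hitting path has at least g vertices
(`le_card_of_separates`), hence there are k segments (`IsCutting.eq`). Let A be the set of their
last vertices. If X, Y ⊆ A violated well-linkedness, Menger's theorem would give a separator S with
|S| < |X| ≤ k/2. Some bramble member B avoids S. By richness some vertex of X reaches B and B
reaches some vertex of Y, all outside S, a contradiction (`IsCutting.isWellLinked`).

Algorithm. Strong components come from a transitive closure. Richness is tested against all of the
at most 2^|T| majorities of T, with |T| = O(k²); each test needs the minimum size of a separator. By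
the Hall form of Menger's theorem this is |X| minus the deficiency of a bipartite matching, and the
matching is computed by an auction with unit price increments (`IsAuction.exists_separates`,
`IsAuction.card_le`).

Programs are written in a language of counting loops whose limits are fixed in advance. They have a
total semantics `run`, a frame rule and a polynomial cost bound in the largest limit, here
2^|T|(n+2)². -/

namespace MultiDigraph

/-! ### Walks avoiding a vertex set -/

/-- There is a walk from `u` to `v` all of whose vertices are outside `S`. -/
def ReachAvoid {V : Type*} (D : MultiDigraph V) (S : Finset V) (u v : V) : Prop :=
  u ∉ S ∧ Relation.ReflTransGen (fun x y => D.Adj x y ∧ y ∉ S) u v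

/-- Every walk from `X` to `Y` meets `S`. -/
def Separates {V : Type*} (D : MultiDigraph V) (S X Y : Finset V) : Prop :=
  ∀ x ∈ X, ∀ y ∈ Y, ¬ D.ReachAvoid S x y

section Reach

variable {V : Type*} {D : MultiDigraph V} {S S' : Finset V} {u v w : V}

theorem ReachAvoid.refl (h : u ∉ S) : D.ReachAvoid S u u := ⟨h, .refl⟩

theorem ReachAvoid.right_notMem (h : D.ReachAvoid S u v) : v ∉ S := by
  rcases Relation.ReflTransGen.cases_tail h.2 with rfl | ⟨c, _, hc⟩
  · exact h.1
  · exact hc.2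

theorem ReachAvoid.trans (h : D.ReachAvoid S u v) (h' : D.ReachAvoid S v w) :
    D.ReachAvoid S u w := ⟨h.1, h.2.trans h'.2⟩

theorem ReachAvoid.tail (h : D.ReachAvoid S u v) (h' : D.Adj v w) (hw : w ∉ S) :
    D.ReachAvoid S u w := ⟨h.1, h.2.tail ⟨h', hw⟩⟩

theorem ReachAvoid.head (hu : u ∉ S) (h : D.Adj u v) (h' : D.ReachAvoid S v w) :
    D.ReachAvoid S u w := ⟨hu, .head ⟨h, h'.1⟩ h'.2⟩

theorem ReachAvoid.mono (hS : S ⊆ S') (h : D.ReachAvoid S' u v) : D.ReachAvoid S u v :=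
  ⟨fun hu => h.1 (hS hu),
    Relation.ReflTransGen.mono (fun _ _ hxy => ⟨hxy.1, fun hy => hxy.2 (hS hy)⟩) _ _ h.2⟩

/-- The walk may be taken to leave its first vertex `u` for good. -/
theorem ReachAvoid.exists_insert [DecidableEq V] (h : D.ReachAvoid S u v) (huv : u ≠ v) :
    ∃ w, D.Adj u w ∧ D.ReachAvoid (insert u S) w v := by
  -- Induction from the end of the walk: either the part seen so far avoids `u`, or the part after
  -- the last visit to `u` has been found.
  have key : ∀ c, D.ReachAvoid S c v → (c ≠ u ∧ D.ReachAvoid (insert u S) c v) ∨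
      ∃ w, D.Adj u w ∧ D.ReachAvoid (insert u S) w v := by
    rintro c ⟨hc, hcv⟩
    induction hcv using Relation.ReflTransGen.head_induction_on with
    | refl => exact .inl ⟨huv.symm, .refl (by simp [huv.symm, hc])⟩
    | @head a b hab _ ih =>
      rcases ih hab.2 with ⟨_, h2⟩ | h
      · by_cases ha : a = u
        · subst ha
          exact .inr ⟨b, hab.1, h2⟩
        · exact .inl ⟨ha, .head (by simp [ha, hc]) hab.1 h2⟩
      · exact .inr h
  rcases key u h with ⟨h, _⟩ | h
  · exact absurd rfl h
  · exact h

theorem ReachAvoid.of_stronglyConnected [DecidableEq V] {B : D.Subgraph}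
    (hB : B.StronglyConnected) (hd : Disjoint B.verts S) (hu : u ∈ B.verts) (hv : v ∈ B.verts) :
    D.ReachAvoid S u v :=
  ⟨Finset.disjoint_left.1 hd hu, Relation.ReflTransGen.mono (fun x y hxy =>
    ⟨lt_of_lt_of_le hxy (B.mult_le x y), Finset.disjoint_left.1 hd (B.head_mem x y hxy)⟩) _ _
    (hB.2 u hu v hv)⟩

end Reach

/-! ### Menger's theorem through Hall's theorem -/

section Matching

variable {V : Type*} [DecidableEq V]

/-- A vertex set `L` outside `Y` whose out-neighbours and members outside `X` lie in a set `W`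
outside `X` yields a separator from `X` to `Y`. -/
theorem exists_separates_of_closed (D : MultiDigraph V) {X Y L W : Finset V}
    (hL : Disjoint L Y)
    (hN : ∀ v ∈ L, ∀ w, w ∉ X → (v = w ∨ D.Adj v w) → w ∈ W) :
    ∃ S, D.Separates S X Y ∧ S.card + L.card ≤ X.card + W.card := by
  -- A walk from `X` that avoids this set starts in `L` and can never leave it, so it misses `Y`.
  -- For the count, the identity links give `L \ X ⊆ W ∩ L`.
  refine ⟨(W \ L) ∪ (X \ L), ?_, ?_⟩
  · rintro x hx y hy ⟨h1, h2⟩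
    have hy' : y ∈ L := by
      clear hy
      induction h2 with
      | refl => simp [hx] at h1; exact h1.2
      | @tail a b _ hab ih =>
        have := hab.2
        by_contra hb
        simp only [Finset.mem_union, Finset.mem_sdiff, hb, not_false_eq_true, and_true,
          not_or] at this
        exact this.1 (hN a ih b this.2 (.inr hab.1))
    exact Finset.disjoint_left.1 hL hy' hy
  · have h1 : (W \ L).card + (W ∩ L).card = W.card := Finset.card_sdiff_add_card_inter W L
    have h2 : (X \ L).card + (X ∩ L).card = X.card := Finset.card_sdiff_add_card_inter X L
    have h3 : (L \ X).card + (L ∩ X).card = L.card := Finset.card_sdiff_add_card_inter L X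
    have h4 : (L \ X).card ≤ (W ∩ L).card := by
      apply Finset.card_le_card
      intro v hv
      rw [Finset.mem_sdiff] at hv
      exact Finset.mem_inter.2 ⟨hN v hv.1 v hv.2 (.inl rfl), hv.1⟩
    have h5 := Finset.card_union_le (W \ L) (X \ L)
    rw [Finset.inter_comm] at h3
    omega

/-- Every separator from `X` to `Y` has at least `|X| - |U|` vertices if there is a matching of
the vertices outside `Y` and `U`, along edges and identities, into the vertices outside `X`. -/
theorem card_le_of_separates [Fintype V] (D : MultiDigraph V) {X Y S U : Finset V}
    (f : V → V) (hinj : ∀ u v, u ∉ Y → u ∉ U → v ∉ Y → v ∉ U → f u = f v → u = v)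
    (hf : ∀ v, v ∉ Y → v ∉ U → f v ∉ X ∧ (v = f v ∨ D.Adj v (f v)))
    (hS : D.Separates S X Y) : X.card ≤ S.card + U.card := by
  classical
  set R : Finset V := Finset.univ.filter fun v => ∃ x ∈ X, D.ReachAvoid S x v with hR
  have hRY : ∀ v ∈ R, v ∉ Y := by
    intro v hv hvY
    obtain ⟨x, hx, h⟩ := (Finset.mem_filter.1 hv).2
    exact hS x hx v hvY h
  -- The matching cannot leave `R ∪ S` and avoids `X`, while `X ⊆ R ∪ S`; comparing sizes gives the
  -- bound.
  have h1 : (R \ U).card ≤ ((R ∪ S) \ X).card := by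
    apply Finset.card_le_card_of_injOn f
    · intro v hv
      rw [Finset.mem_coe, Finset.mem_sdiff] at hv
      obtain ⟨h1, h2⟩ := hf v (hRY v hv.1) hv.2
      rw [Finset.mem_coe, Finset.mem_sdiff, Finset.mem_union]
      refine ⟨?_, h1⟩
      rcases h2 with h2 | h2
      · exact .inl (h2 ▸ hv.1)
      · by_cases h3 : f v ∈ S
        · exact .inr h3
        · obtain ⟨x, hx, h⟩ := (Finset.mem_filter.1 hv.1).2
          exact .inl (Finset.mem_filter.2 ⟨Finset.mem_univ _, x, hx, h.tail h2 h3⟩)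
    · intro u hu v hv huv
      rw [Finset.mem_coe, Finset.mem_sdiff] at hu hv
      exact hinj u v (hRY u hu.1) hu.2 (hRY v hv.1) hv.2 huv
  have h2 : X ⊆ R ∪ S := by
    intro x hx
    by_cases h : x ∈ S
    · exact Finset.mem_union_right _ h
    · exact Finset.mem_union_left _ (Finset.mem_filter.2 ⟨Finset.mem_univ _, x, hx, .refl h⟩)
  have h3 := Finset.card_sdiff_add_card_eq_card h2
  have h4 := Finset.card_union_le R S
  have h5 : R.card ≤ (R \ U).card + U.card := by
    have := Finset.card_sdiff_add_card_inter R U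
    have := Finset.card_le_card (Finset.inter_subset_right (s₁ := R) (s₂ := U))
    omega
  omega

/-- Menger's theorem for a pair of vertex sets of the same size. -/
theorem exists_disjoint_paths [Fintype V] (D : MultiDigraph V) {X Y : Finset V}
    (h : ∀ S, D.Separates S X Y → X.card ≤ S.card) :
    ∃ P : Fin X.card → List V, (∀ i, D.IsPathFromTo X Y (P i)) ∧
      ∀ i j, i ≠ j → (P i).Disjoint (P j) := by
  classical
  -- A set violating Hall's condition would be a closed set `L` with fewer neighbours than elements,
  -- hence a separator smaller than `X`. Identity links let vertices off the paths be matched to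
  -- themselves.
  have hall : ∀ s : Finset {v // v ∉ Y}, s.card ≤ (s.biUnion fun v =>
      Finset.univ.filter fun w => w ∉ X ∧ ((v : V) = w ∨ D.Adj v w)).card := by
    intro s
    obtain ⟨S, hS, hc⟩ := exists_separates_of_closed D (X := X) (Y := Y)
      (L := s.map (Function.Embedding.subtype _))
      (W := s.biUnion fun v => Finset.univ.filter fun w => w ∉ X ∧ ((v : V) = w ∨ D.Adj v w))
      (by
        rw [Finset.disjoint_left]
        intro v hv
        obtain ⟨a, _, rfl⟩ := Finset.mem_map.1 hv
        exact a.2)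
      (by
        intro v hv w hw hvw
        obtain ⟨a, ha, rfl⟩ := Finset.mem_map.1 hv
        simp only [Finset.mem_biUnion, Finset.mem_filter]
        exact ⟨a, ha, Finset.mem_univ _, hw, hvw⟩)
    have := h S hS
    rw [Finset.card_map] at hc
    omega
  obtain ⟨f, hinj, hf⟩ := (Finset.all_card_le_biUnion_card_iff_exists_injective _).1 hall
  let g : V → V := fun v => if hv : v ∈ Y then v else f ⟨v, hv⟩
  have hgX : ∀ v, v ∉ Y → g v ∉ X := by
    intro v hv
    have := hf ⟨v, hv⟩
    simp only [Finset.mem_filter] at this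
    simp only [g, hv, dif_neg, not_false_eq_true]
    exact this.2.1
  have hgA : ∀ v, v ∉ Y → v = g v ∨ D.Adj v (g v) := by
    intro v hv
    have := hf ⟨v, hv⟩
    simp only [Finset.mem_filter] at this
    simp only [g, hv, dif_neg, not_false_eq_true]
    exact this.2.2
  have hgI : ∀ u v, u ∉ Y → v ∉ Y → g u = g v → u = v := by
    intro u v hu hv huv
    simp only [g, hu, hv, dif_neg, not_false_eq_true] at huv
    exact congrArg Subtype.val (hinj huv)
  -- the orbits of `g` before they reach `Y` are disjoint
  have key : ∀ i j x x', x ∈ X → x' ∈ X → (∀ a < i, g^[a] x ∉ Y) → (∀ a < j, g^[a] x' ∉ Y) →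
      g^[i] x = g^[j] x' → i = j ∧ x = x' := by
    intro i
    induction i with
    | zero =>
      intro j x x' hx hx' _ h2 he
      cases j with
      | zero => exact ⟨rfl, he⟩
      | succ j =>
        rw [Function.iterate_succ_apply'] at he
        exact absurd (he ▸ hx : g (g^[j] x') ∈ X) (hgX _ (h2 j (by omega)))
    | succ i ih =>
      intro j x x' hx hx' h1 h2 he
      cases j with
      | zero =>
        rw [Function.iterate_succ_apply'] at he
        exact absurd (he ▸ hx' : g (g^[i] x) ∈ X) (hgX _ (h1 i (by omega)))
      | succ j =>
        rw [Function.iterate_succ_apply', Function.iterate_succ_apply'] at he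
        have := ih j x x' hx hx' (fun a ha => h1 a (by omega)) (fun a ha => h2 a (by omega))
          (hgI _ _ (h1 i (by omega)) (h2 j (by omega)) he)
        exact ⟨by omega, this.2⟩
  -- An orbit that never reached `Y` would be injective, by `key` with `x' = x`, in a finite type.
  have hex : ∀ x ∈ X, ∃ i, g^[i] x ∈ Y := by
    intro x hx
    by_contra hno
    push Not at hno
    have : Function.Injective fun i : ℕ => g^[i] x := fun i j hij =>
      (key i j x x hx hx (fun a _ => hno a) (fun a _ => hno a) hij).1
    exact not_injective_infinite_finite _ this
  choose! N hN hmin using fun x (hx : x ∈ X) =>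
    (⟨Nat.find (hex x hx), Nat.find_spec (hex x hx), fun a ha => Nat.find_min (hex x hx) ha⟩ :
      ∃ i, g^[i] x ∈ Y ∧ ∀ a < i, g^[a] x ∉ Y)
  let e : Fin X.card ≃ X := X.equivFin.symm
  refine ⟨fun i => (List.range (N (e i) + 1)).map fun a => g^[a] (e i), fun i => ?_, ?_⟩
  · have hx := (e i).2
    have hk : ∀ a b, a < N (e i) + 1 → b < N (e i) + 1 → g^[a] (e i : V) = g^[b] (e i) → a = b :=
      fun a b ha hb hab => (key a b _ _ hx hx (fun c hc => hmin _ hx c (by omega))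
        (fun c hc => hmin _ hx c (by omega)) hab).1
    refine ⟨⟨by simp, ?_, ?_⟩, ⟨e i, hx, ?_⟩, ⟨g^[N (e i)] (e i), hN _ hx, ?_⟩⟩
    · apply List.Nodup.map_on _ List.nodup_range
      intro a ha b hb hab
      exact hk a b (List.mem_range.1 ha) (List.mem_range.1 hb) hab
    · rw [List.isChain_iff_getElem]
      intro a ha
      simp only [List.length_map, List.length_range] at ha
      simp only [List.getElem_map, List.getElem_range]
      -- On an orbit the identity link cannot occur, since it would repeat a vertex; so each step is
      -- an edge.
      have h1 := hgA (g^[a] (e i)) (hmin _ hx a (by omega))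
      rw [Function.iterate_succ_apply']
      rcases h1 with h1 | h1
      · rw [← Function.iterate_succ_apply' g a] at h1
        have := hk a (a + 1) (by omega) (by omega) h1
        omega
      · exact h1
    · simp
    · simp only [List.range_succ, List.map_append, List.map_cons, List.map_nil,
        List.getLast?_append, List.getLast?_singleton, Option.some_or]
  · intro i j hij a hi hj
    simp only [List.mem_map, List.mem_range] at hi hj
    obtain ⟨b, hb, rfl⟩ := hi
    obtain ⟨c, hc, hbc⟩ := hj
    have := (key c b _ _ (e j).2 (e i).2 (fun a ha => hmin _ (e j).2 a (by omega))
      (fun a ha => hmin _ (e i).2 a (by omega)) hbc).2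
    exact hij (e.injective (Subtype.ext this.symm))

end Matching

end MultiDigraph

namespace MultiDigraph

set_option linter.unusedSectionVars false

/-! ### The T-bramble and its order -/

section Haven

variable {V : Type*} [DecidableEq V] {D : MultiDigraph V} {T : Finset V} {g : ℕ}

theorem induce_isInduced (D : MultiDigraph V) (S : Finset V) : (D.induce S).IsInduced := by
  intro u hu v hv
  exact if_pos ⟨hu, hv⟩

/-- A small set misses some element of the `T`-bramble. -/
theorem IsLinked.exists_disjoint_mem_tBramble (hT : T.card + 1 = 2 * g)
    (hL : D.IsLinked T (g - 1) (g - 1)) {H : Finset V} (hH : H.card < g) :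
    ∃ B ∈ D.tBramble T g, Disjoint B.verts H := by
  have h : ¬ D.IsBalancedSeparator T (g - 1) H := fun h => by
    have := hL H h
    omega
  simp only [IsBalancedSeparator, not_forall, not_le] at h
  obtain ⟨S, hS, hc⟩ := h
  exact ⟨D.induce S, ⟨induce_isInduced D S, hS.prop.2, by
    change g ≤ (S ∩ T).card
    omega⟩, hS.prop.1⟩

theorem inter_nonempty_of_card_lt {A B : Finset V} (hA : A ⊆ T) (hB : B ⊆ T)
    (h : T.card < A.card + B.card) : (A ∩ B).Nonempty := by
  rw [Finset.nonempty_iff_ne_empty]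
  intro he
  have h1 := Finset.card_union_add_card_inter A B
  have h2 := Finset.card_le_card (Finset.union_subset hA hB)
  rw [he, Finset.card_empty] at h1
  omega

theorem isBramble_tBramble (hT : T.card < 2 * g) : D.IsBramble (D.tBramble T g) := by
  refine ⟨fun B hB => hB.2.1, fun B hB B' hB' => .inl ?_⟩
  have := inter_nonempty_of_card_lt (T := T) (A := B.verts ∩ T) (B := B'.verts ∩ T)
    Finset.inter_subset_right Finset.inter_subset_right (by
      have := hB.2.2
      have := hB'.2.2
      omega)
  obtain ⟨x, hx⟩ := this
  simp only [Finset.mem_inter] at hx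
  exact ⟨x, Finset.mem_inter.2 ⟨hx.1.1, hx.2.1⟩⟩

/-- Any `g` vertices of `T` leave only `g - 1` of them outside, so they meet every majority; the
lower bound is linkedness. -/
theorem hasOrder_tBramble (hT : T.card + 1 = 2 * g) (hL : D.IsLinked T (g - 1) (g - 1)) :
    HasOrder (D.tBramble T g) g := by
  constructor
  · obtain ⟨C, hC, hc⟩ := Finset.exists_subset_card_eq (s := T) (n := g) (by omega)
    refine ⟨C, fun B hB => ?_, hc⟩
    have := inter_nonempty_of_card_lt (T := T) (A := C) (B := B.verts ∩ T) hC
      Finset.inter_subset_right (by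
        have := hB.2.2
        omega)
    obtain ⟨x, hx⟩ := this
    simp only [Finset.mem_inter] at hx
    exact ⟨x, Finset.mem_inter.2 ⟨hx.1, hx.2.1⟩⟩
  · rintro j ⟨C, hC, rfl⟩
    by_contra hlt
    obtain ⟨B, hB, hd⟩ := hL.exists_disjoint_mem_tBramble hT (not_le.1 hlt)
    obtain ⟨x, hx⟩ := hC B hB
    rw [Finset.mem_inter] at hx
    exact Finset.disjoint_left.1 hd hx.2 hx.1

end Haven

/-! ### A path that hits the T-bramble -/

section HittingPath

variable {V : Type*} [DecidableEq V] {D : MultiDigraph V} {T : Finset V}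

open Classical in
/-- The vertices of `T` in the strong component of `v` in `D ∖ H`. -/
noncomputable def compIn (D : MultiDigraph V) (T H : Finset V) (v : V) : Finset V :=
  T.filter fun t => D.ReachAvoid H v t ∧ D.ReachAvoid H t v

/-- The strong component of `v` in `D ∖ H` contains more than half of `T`. -/
def IsBig (D : MultiDigraph V) (T H : Finset V) (v : V) : Prop :=
  T.card < 2 * (D.compIn T H v).card

theorem mem_compIn {H : Finset V} {v t : V} :
    t ∈ D.compIn T H v ↔ t ∈ T ∧ D.ReachAvoid H v t ∧ D.ReachAvoid H t v := by
  simp [compIn]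

/-- The two majorities share a vertex of `T`, and walks avoiding `H'` avoid `H`. With `H = H'` this
says that the big component is unique. -/
theorem IsBig.reachAvoid {H H' : Finset V} {v v' : V} (h : D.IsBig T H v) (h' : D.IsBig T H' v')
    (hH : H ⊆ H') : D.ReachAvoid H v v' := by
  have := inter_nonempty_of_card_lt (T := T) (A := D.compIn T H v) (B := D.compIn T H' v')
    (fun _ hx => (mem_compIn.1 hx).1) (fun _ hx => (mem_compIn.1 hx).1) (by
      unfold IsBig at h h'
      omega)
  obtain ⟨t, ht⟩ := this
  rw [Finset.mem_inter, mem_compIn, mem_compIn] at ht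
  exact ht.1.2.1.trans (ht.2.2.2.mono hH)

theorem IsBig.notMem {H : Finset V} {v : V} (h : D.IsBig T H v) : v ∉ H :=
  (h.reachAvoid h subset_rfl).1

/-- `P` is a path (or empty), and from its end one can reach every big component of `D ∖ V(P)`. -/
def IsSearchPath (D : MultiDigraph V) (T : Finset V) (P : List V) : Prop :=
  P.Nodup ∧ P.IsChain D.Adj ∧ ∀ x, P.getLast? = some x → ∀ v, D.IsBig T P.toFinset v →
    ∃ y, D.Adj x y ∧ D.ReachAvoid P.toFinset y v

/-- `y` may be appended to the search path `P`. -/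
def IsNext (D : MultiDigraph V) (T : Finset V) (P : List V) (y : V) : Prop :=
  (∃ v, D.IsBig T P.toFinset v ∧ D.ReachAvoid P.toFinset y v) ∧
    ∀ x, P.getLast? = some x → D.Adj x y

theorem isSearchPath_nil : D.IsSearchPath T [] := by
  simp [IsSearchPath]

theorem IsSearchPath.exists_isNext {P : List V} (h : D.IsSearchPath T P) {v : V}
    (hv : D.IsBig T P.toFinset v) : ∃ y, D.IsNext T P y := by
  rcases hP : P.getLast? with _ | x
  · exact ⟨v, ⟨v, hv, .refl hv.notMem⟩, by simp [hP]⟩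
  · obtain ⟨y, hy, hyv⟩ := h.2.2 x hP v hv
    exact ⟨y, ⟨v, hv, hyv⟩, by simpa [hP] using hy⟩

/-- The big component after `y` is deleted shares a vertex of `T` with the one before, so `y`
reaches it; cutting that walk at its last visit to `y` restores the invariant. Any admissible `y`
works, so the search never backtracks. -/
theorem IsSearchPath.append {P : List V} (h : D.IsSearchPath T P) {y : V}
    (hy : D.IsNext T P y) : D.IsSearchPath T (P ++ [y]) := by
  obtain ⟨⟨v, hv, hyv⟩, hadj⟩ := hy
  have hyP : y ∉ P := by simpa using hyv.1
  refine ⟨?_, ?_, ?_⟩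
  · rw [List.nodup_append]
    refine ⟨h.1, by simp, ?_⟩
    intro a ha b hb hab
    rw [List.mem_singleton] at hb
    exact hyP (hb ▸ hab ▸ ha)
  · rw [List.isChain_append]
    refine ⟨h.2.1, by simp, ?_⟩
    intro x hx z hz
    simp only [List.head?_cons, Option.mem_def, Option.some.injEq] at hz
    exact hz ▸ hadj x hx
  · intro x hx v' hv'
    simp only [List.getLast?_append, List.getLast?_singleton, Option.some_or,
      Option.some.injEq] at hx
    subst hx
    have he : (P ++ [y]).toFinset = insert y P.toFinset := by
      ext a
      simp
    rw [he] at hv' ⊢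
    exact (hyv.trans (hv.reachAvoid hv' (Finset.subset_insert _ _))).exists_insert
      fun hyv' => hv'.notMem (by simp [hyv'])

/-- A bramble member disjoint from `H` would lie inside one strong component, which would then be
big. -/
theorem isHittingSet_of_forall_not_isBig {g : ℕ} (hT : T.card < 2 * g) {H : Finset V}
    (h : ∀ v, ¬ D.IsBig T H v) : IsHittingSet (D.tBramble T g) H := by
  intro B hB
  by_contra hne
  have hd : Disjoint B.verts H := by
    rw [Finset.disjoint_iff_inter_eq_empty, Finset.inter_comm]
    exact Finset.not_nonempty_iff_eq_empty.1 hne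
  obtain ⟨v, hv⟩ := hB.2.1.1
  apply h v
  have hsub : B.verts ∩ T ⊆ D.compIn T H v := by
    intro t ht
    rw [Finset.mem_inter] at ht
    exact mem_compIn.2 ⟨ht.2, .of_stronglyConnected hB.2.1 hd hv ht.1,
      .of_stronglyConnected hB.2.1 hd ht.1 hv⟩
  have := Finset.card_le_card hsub
  have := hB.2.2
  unfold IsBig
  omega

end HittingPath

/-! ### Rich segments and the well-linked set of their ends -/

section Segments

variable {V : Type*} [DecidableEq V] {D : MultiDigraph V} {T : Finset V} {k : ℕ} {P : List V}

/-- No set of at most `k / 2` vertices separates `Q` from more than half of `T`, in either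
direction. -/
def IsRich (D : MultiDigraph V) (T : Finset V) (k : ℕ) (Q : Finset V) : Prop :=
  ∀ T' ⊆ T, T.card < 2 * T'.card → ∀ S, (D.Separates S Q T' ∨ D.Separates S T' Q) →
    k < 2 * S.card

/-- The vertices of `P` at the positions `a, …, b - 1`. -/
def segment (P : List V) (a b : ℕ) : Finset V := ((P.drop a).take (b - a)).toFinset

theorem mem_segment {a b : ℕ} {v : V} :
    v ∈ segment P a b ↔ ∃ i, a ≤ i ∧ i < b ∧ P[i]? = some v := by
  simp only [segment, List.mem_toFinset, List.mem_iff_getElem?, List.getElem?_take,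
    List.getElem?_drop]
  constructor
  · rintro ⟨i, hi⟩
    split_ifs at hi with h
    exact ⟨a + i, by omega, by omega, hi⟩
  · rintro ⟨i, h1, h2, h3⟩
    refine ⟨i - a, ?_⟩
    rw [if_pos (by omega), show a + (i - a) = i by omega, h3]

theorem getElem?_inj_of_nodup (hP : P.Nodup) {i j : ℕ} {v : V} (hi : P[i]? = some v)
    (hj : P[j]? = some v) : i = j := by
  obtain ⟨h, h'⟩ := List.getElem?_eq_some_iff.1 hi
  exact (List.getElem?_inj h hP).1 (hi.trans hj.symm)

theorem disjoint_segment (hP : P.Nodup) {a b c d : ℕ} (h : b ≤ c) :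
    Disjoint (segment P a b) (segment P c d) := by
  rw [Finset.disjoint_left]
  intro v hv hv'
  obtain ⟨i, _, h2, h3⟩ := mem_segment.1 hv
  obtain ⟨j, h4, _, h5⟩ := mem_segment.1 hv'
  have := getElem?_inj_of_nodup hP h3 h5
  omega

theorem card_segment_le (P : List V) (a b : ℕ) : (segment P a b).card ≤ b - a :=
  (List.toFinset_card_le _).trans (by simp)

theorem reachAvoid_of_segment (hP : P.IsChain D.Adj) {S : Finset V} {i j : ℕ} (hij : i ≤ j)
    {u v : V} (hu : P[i]? = some u) (hv : P[j]? = some v)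
    (hd : ∀ m w, i ≤ m → m ≤ j → P[m]? = some w → w ∉ S) : D.ReachAvoid S u v := by
  induction j, hij using Nat.le_induction generalizing v with
  | base =>
    obtain rfl : u = v := by simpa [hu] using hv
    exact .refl (hd i u le_rfl le_rfl hu)
  | succ j hij ih =>
    obtain ⟨hj, hjv⟩ := List.getElem?_eq_some_iff.1 hv
    have h1 := ih (v := P[j]) (List.getElem?_eq_getElem _)
      (fun m w h1 h2 h3 => hd m w h1 (by omega) h3)
    have h2 := (List.isChain_iff_getElem.1 hP) j (by omega)
    exact h1.tail (hjv ▸ h2) (hd (j + 1) v (by omega) le_rfl hv)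

theorem exists_disjoint_of_card_lt {ι : Type*} {I : Finset ι} {S : Finset V} {O : ι → Finset V}
    (h : S.card < I.card) (hd : ∀ i ∈ I, ∀ j ∈ I, i ≠ j → Disjoint (O i) (O j)) :
    ∃ i ∈ I, Disjoint (O i) S := by
  by_contra! hno
  have hex : ∀ i ∈ I, ∃ x, x ∈ O i ∧ x ∈ S := fun i hi => by
    have := hno i hi
    rw [Finset.not_disjoint_iff] at this
    exact this
  have hne : I.Nonempty := Finset.card_pos.1 (by omega)
  have : Nonempty V := ⟨(hex _ hne.choose_spec).choose⟩
  choose! f hf hfS using hex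
  have := Finset.card_le_card_of_injOn f (fun i hi => hfS i hi) (s := I) (t := S) (by
    intro i hi j hj hij
    by_contra hne
    exact Finset.disjoint_left.1 (hd i hi j hj hne) (hf i hi) (hij ▸ hf j hj))
  omega

/-- If a hitting set is covered by a set `E` and sets `W i` that can be separated from more than
half of `T` by subsets of `E`, then `E` is large. -/
theorem le_card_of_separates {g : ℕ} (hT : T.card + 1 = 2 * g)
    (hL : D.IsLinked T (g - 1) (g - 1)) {H E : Finset V}
    (hH : IsHittingSet (D.tBramble T g) H)
    (h : ∀ p ∈ H, p ∉ E → ∃ T' ⊆ T, T.card < 2 * T'.card ∧ ∃ S ⊆ E, ∃ W : Finset V, p ∈ W ∧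
      (D.Separates S W T' ∨ D.Separates S T' W)) : g ≤ E.card := by
  by_contra hlt
  -- If `E` were small, a member `B` avoiding it would meet `H` in some `p` and the majority `T'` in
  -- some `t`; inside `B` there are walks both ways between them, so neither direction is separated.
  obtain ⟨B, hB, hd⟩ := hL.exists_disjoint_mem_tBramble hT (not_le.1 hlt)
  obtain ⟨p, hp⟩ := hH B hB
  rw [Finset.mem_inter] at hp
  obtain ⟨T', hT', hc, S, hSE, W, hpW, hsep⟩ := h p hp.1 (Finset.disjoint_left.1 hd hp.2)
  obtain ⟨t, ht⟩ := inter_nonempty_of_card_lt (T := T) (A := T') (B := B.verts ∩ T) hT'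
    Finset.inter_subset_right (by
      have := hB.2.2
      omega)
  simp only [Finset.mem_inter] at ht
  rcases hsep with hsep | hsep
  · exact hsep p hpW t ht.1 ((ReachAvoid.of_stronglyConnected hB.2.1 hd hp.2 ht.2.1).mono hSE)
  · exact hsep t ht.1 p hpW ((ReachAvoid.of_stronglyConnected hB.2.1 hd ht.2.1 hp.2).mono hSE)

/-- The positions `c 1 < … < c j` cut the first `m` vertices of `P` into minimal rich segments;
the remainder is not rich if `j < k`. -/
structure IsCutting (D : MultiDigraph V) (T : Finset V) (k : ℕ) (P : List V) (m : ℕ) (c : ℕ → ℕ)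
    (j : ℕ) : Prop where
  zero : c 0 = 0
  lt : ∀ i < j, c i < c (i + 1)
  rich : ∀ i < j, D.IsRich T k (segment P (c i) (c (i + 1)))
  not_rich : ∀ i < j, ¬ D.IsRich T k (segment P (c i) (c (i + 1) - 1))
  le : c j ≤ m
  rest : j < k → ¬ D.IsRich T k (segment P (c j) m)

variable {c : ℕ → ℕ} {j m : ℕ}

/-- The empty set separates the empty segment from everything. This makes `rest` true immediately
after a cut. -/
theorem not_isRich_empty (hT : 0 < T.card) : ¬ D.IsRich T k ∅ := by
  intro h
  have := h T subset_rfl (by omega) ∅ (.inl (by simp [Separates]))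
  simp at this

theorem isCutting_zero (hT : 0 < T.card) : D.IsCutting T k P 0 (fun _ => 0) 0 where
  zero := rfl
  lt := by simp
  rich := by simp
  not_rich := by simp
  le := le_rfl
  rest := by
    intro _
    simpa [segment] using not_isRich_empty hT

theorem IsCutting.succ_of_not (h : D.IsCutting T k P m c j)
    (hr : j < k → ¬ D.IsRich T k (segment P (c j) (m + 1))) : D.IsCutting T k P (m + 1) c j :=
  { h with le := h.le.trans (by omega), rest := hr }

/-- The new segment is minimal because `rest` held one vertex earlier. -/
theorem IsCutting.succ_of_isRich (hT : 0 < T.card) (h : D.IsCutting T k P m c j) (hj : j < k)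
    (hr : D.IsRich T k (segment P (c j) (m + 1))) :
    D.IsCutting T k P (m + 1) (Function.update c (j + 1) (m + 1)) (j + 1) := by
  have h1 : ∀ i ≤ j, Function.update c (j + 1) (m + 1) i = c i := fun i hi =>
    Function.update_of_ne (by omega) _ _
  have h2 : Function.update c (j + 1) (m + 1) (j + 1) = m + 1 := Function.update_self _ _ _
  refine ⟨(h1 0 (by omega)).trans h.zero, ?_, ?_, ?_, h2.le, ?_⟩
  · intro i hi
    rcases Nat.lt_succ_iff_lt_or_eq.1 hi with hi | rfl
    · rw [h1 i (by omega), h1 (i + 1) (by omega)]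
      exact h.lt i hi
    · rw [h1 i le_rfl, h2]
      have := h.le
      omega
  · intro i hi
    rcases Nat.lt_succ_iff_lt_or_eq.1 hi with hi | rfl
    · rw [h1 i (by omega), h1 (i + 1) (by omega)]
      exact h.rich i hi
    · rw [h1 i le_rfl, h2]
      exact hr
  · intro i hi
    rcases Nat.lt_succ_iff_lt_or_eq.1 hi with hi | rfl
    · rw [h1 i (by omega), h1 (i + 1) (by omega)]
      exact h.not_rich i hi
    · rw [h1 i le_rfl, h2]
      exact h.rest hj
  · intro _
    rw [h2]
    simpa [segment] using not_isRich_empty hT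

theorem IsCutting.mono (h : D.IsCutting T k P m c j) {a b : ℕ} (hab : a ≤ b) (hb : b ≤ j) :
    c a ≤ c b := by
  induction b, hab using Nat.le_induction with
  | base => exact le_rfl
  | succ b _ ih => exact (ih (by omega)).trans (h.lt b (by omega)).le

theorem IsCutting.exists_mem (h : D.IsCutting T k P m c j) {t : ℕ} (ht : t < c j) :
    ∃ i < j, c i ≤ t ∧ t < c (i + 1) := by
  classical
  have hex : ∃ i, t < c i := ⟨j, ht⟩
  have h0 : Nat.find hex ≠ 0 := by
    intro h0
    have := Nat.find_spec hex
    rw [h0, h.zero] at this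
    omega
  obtain ⟨i, hi⟩ := Nat.exists_eq_succ_of_ne_zero h0
  have h1 := Nat.find_spec hex
  have h2 := Nat.find_min' hex ht
  have h3 := Nat.find_min hex (m := i) (by omega)
  rw [hi] at h1 h2
  exact ⟨i, by omega, by omega, h1⟩

/-- A set separating the remainder of the path from more than half of `T` is large. -/
theorem IsCutting.le_card (hT : T.card + 1 = 2 * brambleOrder k)
    (hL : D.IsLinked T (brambleOrder k - 1) (brambleOrder k - 1))
    (hP : IsHittingSet (D.tBramble T (brambleOrder k)) P.toFinset)
    (h : D.IsCutting T k P P.length c j) {S T' : Finset V} (hT' : T' ⊆ T)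
    (hc : T.card < 2 * T'.card)
    (hS : D.Separates S (segment P (c j) P.length) T' ∨
      D.Separates S T' (segment P (c j) P.length)) :
    brambleOrder k ≤ S.card + j * (k / 2 + 1) := by
  have key : ∀ i < j, ∃ R Y : Finset V, Y ⊆ T ∧ T.card < 2 * Y.card ∧
      (D.Separates R (segment P (c i) (c (i + 1) - 1)) Y ∨
        D.Separates R Y (segment P (c i) (c (i + 1) - 1))) ∧ R.card ≤ k / 2 := by
    intro i hi
    have := h.not_rich i hi
    simp only [IsRich, not_forall, not_lt] at this
    obtain ⟨Y, hY, hYc, R, hR, hRk⟩ := this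
    exact ⟨R, Y, hY, hYc, hR, by omega⟩
  choose! R Y hY hYc hR hRk using key
  -- The price of segment `i`: a separator of the shortened segment, and its last vertex.
  set F : ℕ → Finset V := fun i => R i ∪ segment P (c (i + 1) - 1) (c (i + 1)) with hF
  have hg := le_card_of_separates hT hL hP (E := S ∪ (Finset.range j).biUnion F) ?_
  · have h1 := Finset.card_union_le S ((Finset.range j).biUnion F)
    have h2 : ((Finset.range j).biUnion F).card ≤ j * (k / 2 + 1) := by
      refine (Finset.card_biUnion_le_card_mul _ _ (k / 2 + 1) fun i hi => ?_).trans (by simp)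
      have hi := Finset.mem_range.1 hi
      refine (Finset.card_union_le _ _).trans (Nat.add_le_add (hRk i hi) ?_)
      refine (card_segment_le _ _ _).trans (by omega)
    omega
  · intro p hp hpE
    rw [List.mem_toFinset, List.mem_iff_getElem?] at hp
    obtain ⟨t, ht⟩ := hp
    rw [Finset.mem_union, Finset.mem_biUnion, not_or] at hpE
    by_cases htc : t < c j
    · obtain ⟨i, hi, h1, h2⟩ := h.exists_mem htc
      refine ⟨Y i, hY i hi, hYc i hi, R i, ?_, _, mem_segment.2 ⟨t, h1, ?_, ht⟩, hR i hi⟩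
      · intro x hx
        exact Finset.mem_union_right _ (Finset.mem_biUnion.2
          ⟨i, Finset.mem_range.2 hi, Finset.mem_union_left _ hx⟩)
      · by_contra hge
        exact hpE.2 ⟨i, Finset.mem_range.2 hi, Finset.mem_union_right _
          (mem_segment.2 ⟨t, by omega, h2, ht⟩)⟩
    · exact ⟨T', hT', hc, S, Finset.subset_union_left, _, mem_segment.2
        ⟨t, by omega, (List.getElem?_eq_some_iff.1 ht).1, ht⟩, hS⟩

/-- The form needed for counting: `k` segments at price `k / 2 + 1` each, and `k / 2` left for the
remainder. -/
theorem brambleOrder_eq (k : ℕ) : brambleOrder k = k * (k / 2 + 1) + k / 2 := by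
  unfold brambleOrder
  rw [Nat.succ_mul]
  omega

/-- If `j < k`, the remainder is separated by at most `k / 2` vertices, and the total price is at
most (j+1)(⌊k/2⌋+1) - 1, which is less than g. -/
theorem IsCutting.eq (hT : T.card + 1 = 2 * brambleOrder k)
    (hL : D.IsLinked T (brambleOrder k - 1) (brambleOrder k - 1))
    (hP : IsHittingSet (D.tBramble T (brambleOrder k)) P.toFinset)
    (h : D.IsCutting T k P P.length c j) (hj : j ≤ k) : j = k := by
  by_contra hne
  have hlt : j < k := by omega
  have := h.rest hlt
  simp only [IsRich, not_forall, not_lt] at this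
  obtain ⟨Y, hY, hYc, R, hR, hRk⟩ := this
  have h1 := h.le_card hT hL hP hY hYc hR
  rw [brambleOrder_eq] at h1
  have h2 : (j + 1) * (k / 2 + 1) ≤ k * (k / 2 + 1) := Nat.mul_le_mul_right _ hlt
  rw [Nat.succ_mul] at h2
  omega

/-- The ends of the first `k` segments form a well-linked set. -/
theorem IsCutting.isWellLinked [Fintype V] (hT : T.card + 1 = 2 * brambleOrder k)
    (hL : D.IsLinked T (brambleOrder k - 1) (brambleOrder k - 1))
    (hP : IsHittingSet (D.tBramble T (brambleOrder k)) P.toFinset)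
    (hnd : P.Nodup) (hch : P.IsChain D.Adj)
    (h : D.IsCutting T k P P.length c k) {A : Finset V}
    (hA : ∀ v, v ∈ A ↔ ∃ i < k, P[c (i + 1) - 1]? = some v) :
    D.IsWellLinked A ∧ A.card = k := by
  have hpos : ∀ i < k, ∃ v, P[c (i + 1) - 1]? = some v := by
    intro i hi
    have h1 := h.lt i hi
    have h2 := h.mono (show i + 1 ≤ k by omega) le_rfl
    have h3 := h.le
    exact ⟨_, List.getElem?_eq_getElem (by omega)⟩
  have hinj : ∀ i < k, ∀ i' < k, c (i + 1) - 1 = c (i' + 1) - 1 → i = i' := by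
    intro i hi i' hi' he
    have h1 := h.lt i hi
    have h2 := h.lt i' hi'
    rcases lt_trichotomy i i' with hlt | rfl | hlt
    · have := h.mono (show i + 1 ≤ i' by omega) hi'.le
      omega
    · rfl
    · have := h.mono (show i' + 1 ≤ i by omega) hi.le
      omega
  rcases Nat.eq_zero_or_pos k with rfl | hk0
  · have : A = ∅ := by
      ext v
      simp [hA]
    subst this
    refine ⟨?_, rfl⟩
    intro X Y hX hY _ _
    obtain rfl := Finset.subset_empty.1 hX
    exact ⟨fun i => i.elim0, fun i => i.elim0, fun i => i.elim0⟩
  have : Nonempty V := ⟨(hpos 0 hk0).choose⟩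
  choose! a ha using hpos
  have hainj : ∀ i < k, ∀ i' < k, a i = a i' → i = i' := fun i hi i' hi' he =>
    hinj i hi i' hi' (getElem?_inj_of_nodup hnd (ha i hi) (he ▸ ha i' hi'))
  have hAa : A = (Finset.range k).image a := by
    ext v
    rw [hA, Finset.mem_image]
    constructor
    · rintro ⟨i, hi, hv⟩
      exact ⟨i, Finset.mem_range.2 hi, by simpa [ha i hi] using hv⟩
    · rintro ⟨i, hi, rfl⟩
      exact ⟨i, Finset.mem_range.1 hi, ha i (Finset.mem_range.1 hi)⟩
  have hcard : A.card = k := by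
    rw [hAa, Finset.card_image_of_injOn, Finset.card_range]
    intro i hi i' hi' he
    exact hainj i (by simpa using hi) i' (by simpa using hi') he
  refine ⟨?_, hcard⟩
  intro X Y hX hY hXY hcXY
  apply exists_disjoint_paths
  intro S hS
  by_contra hlt
  push Not at hlt
  -- `X` and `Y` are disjoint and of equal size inside the `k`-set `A`.
  have hXk : 2 * X.card ≤ k := by
    have h1 := Finset.card_union_of_disjoint hXY
    have h2 := Finset.card_le_card (Finset.union_subset hX hY)
    omega
  have hidx : ∀ Z ⊆ A, ((Finset.range k).filter fun i => a i ∈ Z).card = Z.card := by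
    intro Z hZ
    rw [← Finset.card_image_of_injOn (f := a) (s := (Finset.range k).filter fun i => a i ∈ Z)]
    · congr 1
      ext v
      simp only [Finset.mem_image, Finset.mem_filter, Finset.mem_range]
      constructor
      · rintro ⟨i, hi, rfl⟩
        exact hi.2
      · intro hv
        have := hZ hv
        rw [hAa, Finset.mem_image] at this
        obtain ⟨i, hi, rfl⟩ := this
        exact ⟨i, ⟨Finset.mem_range.1 hi, hv⟩, rfl⟩
    · intro i hi i' hi' he
      simp only [Finset.coe_filter, Finset.mem_range, Set.mem_ofPred_eq] at hi hi'
      exact hainj i hi.1 i' hi'.1 he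
  -- `B` avoids `S` and serves as a hub: `X` will reach it, and it will reach `Y`.
  obtain ⟨B, hB, hBS⟩ := hL.exists_disjoint_mem_tBramble hT (H := S) (by
    rw [brambleOrder_eq]
    have : k * 1 ≤ k * (k / 2 + 1) := Nat.mul_le_mul_left _ (by omega)
    omega)
  have hTB : T.card < 2 * (B.verts ∩ T).card := by
    have := hB.2.2
    omega
  -- from `X` to `B`
  have hXB : ∃ x ∈ X, ∃ b ∈ B.verts, D.ReachAvoid S x b := by
    -- The block of `a i` runs from `a i` up to, but excluding, the next segment end, or to the end
    -- of the path for the last one. The blocks starting in `X` are disjoint and outnumber `S`, so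
    -- one avoids `S`.
    obtain ⟨i, hi, hd⟩ := exists_disjoint_of_card_lt
      (I := (Finset.range k).filter fun i => a i ∈ X) (S := S)
      (O := fun i => segment P (c (i + 1) - 1) (if i + 1 = k then P.length else c (i + 2) - 1))
      (by rw [hidx X hX]; exact hlt) (by
        have : ∀ i i', i < i' → i' < k → (if i + 1 = k then P.length else c (i + 2) - 1) ≤
            c (i' + 1) - 1 := by
          intro i i' hii' hi'
          rw [if_neg (by omega)]
          have := h.mono (show i + 2 ≤ i' + 1 by omega) (by omega)
          omega
        intro i hi i' hi' hne
        simp only [Finset.mem_filter, Finset.mem_range] at hi hi'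
        rcases Nat.lt_or_gt_of_ne hne with hlt | hlt
        · exact disjoint_segment hnd (this i i' hlt hi'.1)
        · exact (disjoint_segment hnd (this i' i hlt hi.1)).symm)
    simp only [Finset.mem_filter, Finset.mem_range] at hi
    obtain ⟨hik, hiX⟩ := hi
    have hci := h.lt i hik
    -- a vertex `p` of the block reaches `B`
    have hp : ∃ q, c (i + 1) - 1 ≤ q ∧ q < (if i + 1 = k then P.length else c (i + 2) - 1) ∧
        ∃ p, P[q]? = some p ∧ ∃ b ∈ B.verts, D.ReachAvoid S p b := by
      split_ifs with hik'
      -- The remainder after the last cut need not be rich, but separating it takes at least g -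
      -- k(⌊k/2⌋+1) = ⌊k/2⌋ vertices, and |S| < |X| ≤ k/2.
      · have hsep : ¬ D.Separates S (segment P (c k) P.length) (B.verts ∩ T) := by
          intro hsep
          have := h.le_card hT hL hP Finset.inter_subset_right hTB (.inl hsep)
          rw [brambleOrder_eq] at this
          omega
        simp only [Separates, not_forall, not_not] at hsep
        obtain ⟨p, hp, b, hb, hr⟩ := hsep
        obtain ⟨q, h1, h2, h3⟩ := mem_segment.1 hp
        rw [hik']
        exact ⟨q, by omega, h2, p, h3, b, (Finset.mem_inter.1 hb).1, hr⟩
      -- The next segment is rich, and `S` with one more vertex still has at most |X| ≤ k/2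
      -- elements. Inserting the end `a (i + 1)`, which lies outside the block, forces `p` into the
      -- block.
      · have hsep : ¬ D.Separates (insert (a (i + 1)) S)
            (segment P (c (i + 1)) (c (i + 2))) (B.verts ∩ T) := by
          intro hsep
          have h1 := h.rich (i + 1) (by omega) _ Finset.inter_subset_right hTB _ (.inl hsep)
          have h2 := Finset.card_insert_le (a (i + 1)) S
          omega
        simp only [Separates, not_forall, not_not] at hsep
        obtain ⟨p, hp, b, hb, hr⟩ := hsep
        obtain ⟨q, h1, h2, h3⟩ := mem_segment.1 hp
        have h4 : q ≠ c (i + 2) - 1 := by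
          rintro rfl
          have h5 : P[c (i + 2) - 1]? = some (a (i + 1)) := ha (i + 1) (by omega)
          obtain rfl : a (i + 1) = p := by simpa [h5] using h3
          exact hr.1 (Finset.mem_insert_self _ _)
        exact ⟨q, by omega, by omega, p, h3, b, (Finset.mem_inter.1 hb).1,
          hr.mono (Finset.subset_insert _ _)⟩
    obtain ⟨q, h1, h2, p, h3, b, hb, hr⟩ := hp
    refine ⟨a i, hiX, b, hb, .trans (reachAvoid_of_segment hch h1 (ha i hik) h3 ?_) hr⟩
    intro m w hm1 hm2 hw
    exact Finset.disjoint_left.1 hd (mem_segment.2 ⟨m, hm1, by omega, hw⟩)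
  -- from `B` to `Y`
  have hBY : ∃ y ∈ Y, ∃ b ∈ B.verts, D.ReachAvoid S b y := by
    obtain ⟨i, hi, hd⟩ := exists_disjoint_of_card_lt
      (I := (Finset.range k).filter fun i => a i ∈ Y) (S := S)
      (O := fun i => segment P (c i) (c (i + 1)))
      (by rw [hidx Y hY, ← hcXY]; exact hlt) (by
        intro i hi i' hi' hne
        simp only [Finset.mem_filter, Finset.mem_range] at hi hi'
        rcases Nat.lt_or_gt_of_ne hne with hlt | hlt
        · exact disjoint_segment hnd (h.mono (by omega) (by omega))
        · exact (disjoint_segment hnd (h.mono (by omega) (by omega))).symm)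
    simp only [Finset.mem_filter, Finset.mem_range] at hi
    obtain ⟨hik, hiY⟩ := hi
    -- Here the whole segment ending at `a i` avoids `S`, so no extra vertex is needed: enter it at
    -- any `p` and follow the path to its end.
    have hsep : ¬ D.Separates S (B.verts ∩ T) (segment P (c i) (c (i + 1))) := by
      intro hsep
      have h1 := h.rich i hik _ Finset.inter_subset_right hTB _ (.inr hsep)
      omega
    simp only [Separates, not_forall, not_not] at hsep
    obtain ⟨b, hb, p, hp, hr⟩ := hsep
    obtain ⟨q, h1, h2, h3⟩ := mem_segment.1 hp
    refine ⟨a i, hiY, b, (Finset.mem_inter.1 hb).1,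
      hr.trans (reachAvoid_of_segment hch (by omega) h3 (ha i hik) ?_)⟩
    intro m w hm1 hm2 hw
    exact Finset.disjoint_left.1 hd (mem_segment.2 ⟨m, by omega, by omega, hw⟩)
  obtain ⟨x, hx, b, hb, hxb⟩ := hXB
  obtain ⟨y, hy, b', hb', hby⟩ := hBY
  exact hS x hx y hy
    (hxb.trans ((ReachAvoid.of_stronglyConnected hB.2.1 hBS hb hb').trans hby))

end Segments

end MultiDigraph

namespace MultiDigraph

/-! ### Bipartite matching by an auction -/

section Auction

variable {n : ℕ} {D : MultiDigraph (Fin n)} {X Y : Finset (Fin n)} {mate price md : ℕ → ℕ}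

/-- `v` may be matched to `w`. -/
def Link (D : MultiDigraph (Fin n)) (X : Finset (Fin n)) (v w : Fin n) : Prop :=
  w ∉ X ∧ (v = w ∨ D.Adj v w)

/-- The state of an auction in which the vertices `v` outside `Y` bid for the vertices `w` outside
`X`: `mate w` is `v + 1` if `w` is sold to `v` and `0` if it is unsold, `md v` tells whether `v`
has bought a vertex. -/
structure IsAuction (D : MultiDigraph (Fin n)) (X Y : Finset (Fin n)) (mate price md : ℕ → ℕ) :
    Prop where
  mate_spec : ∀ w v : Fin n, mate w = v + 1 → v ∉ Y ∧ D.Link X v w ∧ md v ≠ 0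
  mate_le : ∀ w : Fin n, mate w ≤ n
  exists_mate : ∀ v : Fin n, md v ≠ 0 → ∃ w : Fin n, mate w = v + 1
  inj : ∀ w w' : Fin n, mate w = mate w' → mate w ≠ 0 → w = w'
  price_eq_zero : ∀ w : Fin n, mate w = 0 → price w = 0
  price_le_succ : ∀ w v : Fin n, mate w = v + 1 → ∀ w', D.Link X v w' → price w ≤ price w' + 1
  price_le : ∀ w : Fin n, price w ≤ n + 1

/-- `v` has not bought anything and can afford `w`. -/
def CanBid (D : MultiDigraph (Fin n)) (X Y : Finset (Fin n)) (price md : ℕ → ℕ) (v w : Fin n) :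
    Prop :=
  v ∉ Y ∧ md v = 0 ∧ D.Link X v w ∧ price w ≤ n

theorem isAuction_zero : IsAuction D X Y 0 0 0 where
  mate_spec := by simp
  mate_le := by simp
  exists_mate := by simp
  inj := by simp
  price_eq_zero := by simp
  price_le_succ := by simp
  price_le := by simp

theorem IsAuction.congr (h : IsAuction D X Y mate price md) {mate' price' md' : ℕ → ℕ}
    (h1 : ∀ v : Fin n, mate' v = mate v) (h2 : ∀ v : Fin n, price' v = price v)
    (h3 : ∀ v : Fin n, md' v = md v) : IsAuction D X Y mate' price' md' where
  mate_spec := by simpa only [h1, h3] using h.mate_spec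
  mate_le := by simpa only [h1] using h.mate_le
  exists_mate := by simpa only [h1, h3] using h.exists_mate
  inj := by simpa only [h1] using h.inj
  price_eq_zero := by simpa only [h1, h2] using h.price_eq_zero
  price_le_succ := by simpa only [h1, h2] using h.price_le_succ
  price_le := by simpa only [h2] using h.price_le

/-- Since `w` is a cheapest choice of `v`, raising its price by one keeps `v` within one of its best
alternative. Other prices never fall, so the other owners stay content, and a sold vertex never
becomes unsold again. -/
theorem IsAuction.bid (h : IsAuction D X Y mate price md) {v w : Fin n}
    (hb : CanBid D X Y price md v w) (hmin : ∀ w', D.Link X v w' → price w ≤ price w')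
    {md' : ℕ → ℕ} (hmd : ∀ u : Fin n, md' u = if u = v then 1 else
      if mate w = u + 1 then 0 else md u) :
    IsAuction D X Y (Function.update mate w (v + 1)) (Function.update price w (price w + 1))
      md' := by
  obtain ⟨hvY, hv0, hvw, hpn⟩ := hb
  -- The bidder `v` owns nothing before the bid, so ownership stays injective.
  have hne : ∀ w' : Fin n, mate w' ≠ v + 1 := fun w' hw' => (h.mate_spec w' v hw').2.2 hv0
  have hup : ∀ (f : ℕ → ℕ) (a : ℕ) (u : Fin n), Function.update f (w : ℕ) a u =
      if u = w then a else f u := by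
    intro f a u
    simp only [Function.update_apply, Fin.val_inj]
  have hpr : ∀ u : Fin n, price u ≤ if u = w then price w + 1 else price u := by
    intro u
    split_ifs with hu
    · subst hu
      omega
    · exact le_rfl
  constructor
  · intro w' v' hw'
    rw [hup] at hw'
    split_ifs at hw' with hww
    · have : v' = v := Fin.ext (by omega)
      subst this
      subst hww
      exact ⟨hvY, hvw, by simp [hmd]⟩
    · obtain ⟨h1, h2, h3⟩ := h.mate_spec w' v' hw'
      refine ⟨h1, h2, ?_⟩
      rw [hmd, if_neg (by rintro rfl; exact h3 hv0), if_neg ?_]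
      · exact h3
      · intro he
        exact hww (h.inj w' w (by omega) (by omega))
  · intro w'
    rw [hup]
    split_ifs
    · omega
    · exact h.mate_le w'
  · intro v' hv'
    rw [hmd] at hv'
    split_ifs at hv' with h1 h2
    · exact ⟨w, by rw [hup, if_pos rfl, h1]⟩
    · exact absurd rfl hv'
    · obtain ⟨w', hw'⟩ := h.exists_mate v' hv'
      refine ⟨w', ?_⟩
      rw [hup, if_neg, hw']
      rintro rfl
      exact h2 hw'
  · intro w1 w2
    rw [hup, hup]
    split_ifs with h1 h2 h2
    · intro _ _
      rw [h1, h2]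
    · intro he
      exact absurd he.symm (hne w2)
    · intro he
      exact absurd he (hne w1)
    · exact h.inj w1 w2
  · intro w'
    rw [hup, hup]
    split_ifs with h1
    · intro he
      omega
    · exact h.price_eq_zero w'
  · intro w1 v1 hw1 w2 hl
    rw [hup] at hw1
    rw [hup, hup]
    split_ifs at hw1 with h1
    · have hv1 : v1 = v := Fin.ext (by omega)
      subst hv1
      have h3 := hmin w2 hl
      have h4 := hpr w2
      rw [if_pos h1]
      omega
    · rw [if_neg h1]
      have h3 := h.price_le_succ w1 v1 hw1 w2 hl
      have h4 := hpr w2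
      omega
  · intro w'
    rw [hup]
    split_ifs
    · omega
    · exact h.price_le w'

/-- The sum of the prices is the potential that bounds the number of bids. -/
theorem IsAuction.sum_price_le (h : IsAuction D X Y mate price md) :
    ∑ w : Fin n, price w ≤ n * (n + 1) := by
  have := Finset.sum_le_card_nsmul Finset.univ (fun w : Fin n => price w) (n + 1)
    fun w _ => h.price_le w
  simpa using this

theorem sum_update_succ (w : Fin n) :
    ∑ u : Fin n, Function.update price w (price w + 1) u = ∑ u : Fin n, price u + 1 := by
  rw [← Finset.add_sum_erase _ _ (Finset.mem_univ w), ← Finset.add_sum_erase (a := w) _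
    (fun u : Fin n => price u) (Finset.mem_univ w), Function.update_self]
  have : ∑ u ∈ Finset.univ.erase w, Function.update price w (price w + 1) (u : ℕ) =
      ∑ u ∈ Finset.univ.erase w, price u := by
    apply Finset.sum_congr rfl
    intro u hu
    rw [Function.update_of_ne]
    exact fun he => (Finset.mem_erase.1 hu).1 (Fin.ext he)
  rw [this]
  omega

/-- The vertices that have not bought anything. -/
def unsold (Y : Finset (Fin n)) (md : ℕ → ℕ) : Finset (Fin n) :=
  Finset.univ.filter fun v => v ∉ Y ∧ md v = 0

/-- The current ownership is a matching of all bidders except the unsatisfied ones, so weak duality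
applies at any time during the auction. -/
theorem IsAuction.card_le (h : IsAuction D X Y mate price md) {S : Finset (Fin n)}
    (hS : D.Separates S X Y) : X.card ≤ S.card + (unsold Y md).card := by
  have hex : ∀ v : Fin n, ∃ w : Fin n, v ∉ Y → v ∉ unsold Y md → mate w = v + 1 := by
    intro v
    by_cases h1 : v ∉ Y ∧ v ∉ unsold Y md
    · obtain ⟨w, hw⟩ := h.exists_mate v (by simpa [unsold, h1.1] using h1.2)
      exact ⟨w, fun _ _ => hw⟩
    · exact ⟨v, fun h2 h3 => absurd ⟨h2, h3⟩ h1⟩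
  choose f hf using hex
  refine card_le_of_separates D f ?_ ?_ hS
  · intro u v hu hu' hv hv' huv
    have h1 := hf u hu hu'
    have h2 := hf v hv hv'
    rw [huv] at h1
    exact Fin.ext (by omega)
  · intro v hv hv'
    exact (h.mate_spec _ v (hf v hv hv')).2.1

/-- At termination the matching is maximum. There are `n` goods and `n + 1` price levels, so some
level is empty; the unsatisfied bidders and the owners of the goods above the gap form a closed set
whose neighbours are exactly accounted for by these goods. -/
theorem IsAuction.exists_separates (h : IsAuction D X Y mate price md)
    (hterm : ∀ v w, ¬ CanBid D X Y price md v w) :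
    ∃ S, D.Separates S X Y ∧ S.card + (unsold Y md).card ≤ X.card := by
  classical
  -- a price level between `1` and `n + 1` at which nothing is sold
  obtain ⟨l, hl1, hl2⟩ : ∃ l ∈ Finset.Icc 1 (n + 1), ∀ w : Fin n, price w ≠ l := by
    by_contra! hno
    have := Finset.card_le_card (s := Finset.Icc 1 (n + 1))
      (t := Finset.univ.image fun w : Fin n => price w) (by
        intro l hl
        obtain ⟨w, hw⟩ := hno l hl
        exact Finset.mem_image.2 ⟨w, Finset.mem_univ _, hw⟩)
    have h2 := Finset.card_image_le (s := Finset.univ) (f := fun w : Fin n => price w)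
    simp only [Nat.card_Icc, Finset.card_univ, Fintype.card_fin] at this h2
    omega
  rw [Finset.mem_Icc] at hl1
  set W : Finset (Fin n) := Finset.univ.filter fun w => l < price w with hW
  have hmW : ∀ w, ∃ v : Fin n, w ∈ W → mate w = v + 1 := by
    intro w
    by_cases hw : w ∈ W
    · have h1 := (Finset.mem_filter.1 hw).2
      have h2 : mate w ≠ 0 := fun h0 => by
        have := h.price_eq_zero w h0
        omega
      have h3 := h.mate_le w
      exact ⟨⟨mate w - 1, by omega⟩, fun _ => by simp; omega⟩
    · exact ⟨w, fun h1 => absurd h1 hw⟩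
  choose m hm using hmW
  have hdisj : Disjoint (unsold Y md) (W.image m) := by
    rw [Finset.disjoint_left]
    intro v hv hv'
    obtain ⟨w, hw, rfl⟩ := Finset.mem_image.1 hv'
    exact (h.mate_spec w _ (hm w hw)).2.2 (Finset.mem_filter.1 hv).2.2
  have hLY : Disjoint (unsold Y md ∪ W.image m) Y := by
    rw [Finset.disjoint_left]
    intro v hv
    rcases Finset.mem_union.1 hv with hv | hv
    · exact (Finset.mem_filter.1 hv).2.1
    · obtain ⟨w, hw, rfl⟩ := Finset.mem_image.1 hv
      exact (h.mate_spec w _ (hm w hw)).1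
  -- An unsatisfied bidder finds only prices at least `n + 1 ≥ l`. An owner above the gap pays at
  -- least `l + 1`, so its alternatives cost at least `l`. No price equals `l`, hence all these
  -- prices exceed `l`.
  have hLW : ∀ v ∈ unsold Y md ∪ W.image m, ∀ w, w ∉ X → (v = w ∨ D.Adj v w) → w ∈ W := by
    intro v hv w hwX hvw
    have hne := hl2 w
    rw [hW, Finset.mem_filter]
    refine ⟨Finset.mem_univ _, ?_⟩
    rcases Finset.mem_union.1 hv with hv | hv
    · have h1 := (Finset.mem_filter.1 hv).2
      have h2 := hterm v w
      simp only [CanBid, Link, not_and, not_le] at h2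
      have := h2 h1.1 h1.2 ⟨hwX, hvw⟩
      omega
    · obtain ⟨w', hw', rfl⟩ := Finset.mem_image.1 hv
      have h1 := h.price_le_succ w' _ (hm w' hw') w ⟨hwX, hvw⟩
      have h2 := (Finset.mem_filter.1 hw').2
      omega
  obtain ⟨S, hS, hc⟩ := exists_separates_of_closed D hLY hLW
  refine ⟨S, hS, ?_⟩
  rw [Finset.card_union_of_disjoint hdisj, Finset.card_image_of_injOn] at hc
  · omega
  · intro w hw w' hw' he
    have h1 := hm w hw
    have h2 := hm w' hw'
    rw [he] at h1
    exact h.inj w w' (by omega) (by omega)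

end Auction

end MultiDigraph

/-! ### A language of counting loops: semantics, frame rule, cost -/

namespace Ram

/-- Programs whose loops run a counter `x` from `0` to a limit, the value of a variable `y`. -/
inductive ForProgram where
  | skip : ForProgram
  | assign (x : ℕ) (e : Expr) : ForProgram
  | store (a : ℕ) (i e : Expr) : ForProgram
  | seq (p q : ForProgram) : ForProgram
  | cond (e : Expr) (p q : ForProgram) : ForProgram
  | upto (x y : ℕ) (p : ForProgram) : ForProgram

namespace ForProgram

def compile : ForProgram → Program
  | skip => .skip
  | assign x e => .assign x e
  | store a i e => .store a i e
  | seq p q => .seq p.compile q.compile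
  | cond e p q => .cond e p.compile q.compile
  | upto x y p => .seq (.assign x (.lit 0)) (.loop (.minus (.var y) (.var x))
      (.seq p.compile (.assign x (.plus (.var x) (.lit 1)))))

/-- The memory after the execution of a program. -/
def run : ForProgram → State → State
  | skip, s => s
  | assign x e, s => s.setVar x (e.eval s)
  | store a i e, s => s.setArr a (i.eval s) (e.eval s)
  | seq p q, s => q.run (p.run s)
  | cond e p q, s => if e.eval s = 0 then q.run s else p.run s
  | upto x y p, s =>
      (fun u => (p.run u).setVar x ((p.run u).var x + 1))^[s.var y] (s.setVar x 0)

/-- The variables that a program may change. -/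
def vars : ForProgram → List ℕ
  | skip => []
  | assign x _ => [x]
  | store _ _ _ => []
  | seq p q => p.vars ++ q.vars
  | cond _ p q => p.vars ++ q.vars
  | upto x _ p => x :: p.vars

/-- The arrays that a program may change. -/
def arrs : ForProgram → List ℕ
  | skip => []
  | assign _ _ => []
  | store a _ _ => [a]
  | seq p q => p.arrs ++ q.arrs
  | cond _ p q => p.arrs ++ q.arrs
  | upto _ _ p => p.arrs

/-- The limits of all loops belong to `L`, no variable in `L` is changed, and no loop changes its
own counter. -/
def WF (L : List ℕ) : ForProgram → Prop
  | skip => True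
  | assign x _ => x ∉ L
  | store _ _ _ => True
  | seq p q => p.WF L ∧ q.WF L
  | cond _ p q => p.WF L ∧ q.WF L
  | upto x y p => x ∉ L ∧ y ∈ L ∧ x ∉ p.vars ∧ p.WF L

/-- Lets `decide` check the concrete programs. -/
instance decidableWF (L : List ℕ) : (p : ForProgram) → Decidable (p.WF L)
  | skip => inferInstanceAs (Decidable True)
  | assign x _ => inferInstanceAs (Decidable (x ∉ L))
  | store _ _ _ => inferInstanceAs (Decidable True)
  | seq p q => @instDecidableAnd _ _ (decidableWF L p) (decidableWF L q)
  | cond _ p q => @instDecidableAnd _ _ (decidableWF L p) (decidableWF L q)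
  | upto x y p =>
      have := decidableWF L p
      inferInstanceAs (Decidable (x ∉ L ∧ y ∈ L ∧ x ∉ p.vars ∧ p.WF L))

/-- An upper bound for the running time if no loop limit exceeds `B`. -/
def cost (B : ℕ) : ForProgram → ℕ
  | skip => 1
  | assign _ e => e.cost + 1
  | store _ i e => i.cost + e.cost + 1
  | seq p q => p.cost B + q.cost B
  | cond e p q => e.cost + 1 + (p.cost B + q.cost B)
  -- 6 pays for resetting the counter and the final test, 8 for one test and one increment.
  | upto _ _ p => 6 + B * (8 + p.cost B)

end ForProgram

@[simp] theorem State.setVar_var (s : State) (x m y : ℕ) :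
    (s.setVar x m).var y = if y = x then m else s.var y := Function.update_apply _ _ _ _

@[simp] theorem State.setVar_arr (s : State) (x m : ℕ) : (s.setVar x m).arr = s.arr := rfl

@[simp] theorem State.setArr_var (s : State) (a i m : ℕ) : (s.setArr a i m).var = s.var := rfl

theorem State.setArr_arr (s : State) (a i m b : ℕ) :
    (s.setArr a i m).arr b = if b = a then Function.update (s.arr a) i m else s.arr b :=
  Function.update_apply _ _ _ _

@[simp] theorem State.setArr_arr_apply (s : State) (a i m b j : ℕ) :
    (s.setArr a i m).arr b j = if b = a then if j = i then m else s.arr a j else s.arr b j := by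
  rw [State.setArr_arr]
  split_ifs with h1 h2
  · simp [h2]
  · simp [h2]
  · rfl

/-- The memory `u` agrees with `s` outside the variables `vs` and the arrays `as`. -/
structure Agree (vs as : List ℕ) (s u : State) : Prop where
  var : ∀ z, z ∉ vs → u.var z = s.var z
  arr : ∀ a, a ∉ as → u.arr a = s.arr a

namespace ForProgram

/-- The frame rule. Through it, facts about untouched memory are carried across program pieces, with
mostly decidable side conditions. -/
theorem run_agree (p : ForProgram) (s : State) : Agree p.vars p.arrs s (p.run s) := by
  induction p generalizing s with
  | skip => exact ⟨fun _ _ => rfl, fun _ _ => rfl⟩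
  | assign x e => exact ⟨fun z hz => Function.update_of_ne (by simpa [vars] using hz) _ _,
      fun _ _ => rfl⟩
  | store a i e => exact ⟨fun _ _ => rfl,
      fun b hb => Function.update_of_ne (by simpa [arrs] using hb) _ _⟩
  | seq p q hp hq =>
    refine ⟨fun z hz => ?_, fun a ha => ?_⟩
    · simp only [vars, List.mem_append, not_or] at hz
      exact ((hq _).var z hz.2).trans ((hp s).var z hz.1)
    · simp only [arrs, List.mem_append, not_or] at ha
      exact ((hq _).arr a ha.2).trans ((hp s).arr a ha.1)
  | cond e p q hp hq =>
    simp only [run]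
    refine ⟨fun z hz => ?_, fun a ha => ?_⟩
    · simp only [vars, List.mem_append, not_or] at hz
      split_ifs
      · exact (hq s).var z hz.2
      · exact (hp s).var z hz.1
    · simp only [arrs, List.mem_append, not_or] at ha
      split_ifs
      · exact (hq s).arr a ha.2
      · exact (hp s).arr a ha.1
  | upto x y p hp =>
    simp only [run]
    generalize s.var y = m
    induction m with
    | zero => exact ⟨fun z hz => Function.update_of_ne (by simp [vars] at hz; exact hz.1) _ _,
        fun _ _ => rfl⟩
    | succ m ih =>
      rw [Function.iterate_succ_apply']
      refine ⟨fun z hz => ?_, fun a ha => ((hp _).arr a ha).trans (ih.arr a ha)⟩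
      have hz' := hz
      simp only [vars, List.mem_cons, not_or] at hz'
      rw [State.setVar_var, if_neg hz'.1]
      exact ((hp _).var z hz'.2).trans (ih.var z hz)

theorem WF.notMem {L : List ℕ} {p : ForProgram} (h : p.WF L) {y : ℕ} (hy : y ∈ L) :
    y ∉ p.vars := by
  induction p with
  | skip => simp [vars]
  | assign x e =>
    simp only [vars, List.mem_singleton]
    rintro rfl
    exact h hy
  | store a i e => simp [vars]
  | seq p q hp hq => simp [vars, hp h.1, hq h.2]
  | cond e p q hp hq => simp [vars, hp h.1, hq h.2]
  | upto x z p hp =>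
    simp only [vars, List.mem_cons, hp h.2.2.2, or_false]
    rintro rfl
    exact h.1 hy

/-- By `WF` a loop body changes neither its counter nor any limit, so the machine loop makes exactly
the number of iterations that `run` prescribes. -/
theorem exec (p : ForProgram) {L : List ℕ} (h : p.WF L) (B : ℕ) (s : State)
    (hB : ∀ y ∈ L, s.var y ≤ B) : ∃ t ≤ p.cost B, Exec p.compile s t (p.run s) := by
  induction p generalizing s with
  | skip => exact ⟨1, le_rfl, .skip s⟩
  | assign x e => exact ⟨_, le_rfl, .assign x e s⟩
  | store a i e => exact ⟨_, le_rfl, .store a i e s⟩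
  | seq p q hp hq =>
    obtain ⟨t, ht, h1⟩ := hp h.1 s hB
    obtain ⟨t', ht', h2⟩ := hq h.2 (p.run s) fun y hy => by
      rw [(run_agree p s).var y (h.1.notMem hy)]
      exact hB y hy
    exact ⟨t + t', Nat.add_le_add ht ht', .seq h1 h2⟩
  | cond e p q hp hq =>
    simp only [run, cost]
    split_ifs with he
    · obtain ⟨t, ht, h1⟩ := hq h.2 s hB
      exact ⟨_, by omega, .cond_false he h1⟩
    · obtain ⟨t, ht, h1⟩ := hp h.1 s hB
      exact ⟨_, by omega, .cond_true he h1⟩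
  | upto x y p hp =>
    obtain ⟨hxL, hyL, hxp, hpL⟩ := h
    have hxy : y ≠ x := fun h => hxL (h ▸ hyL)
    set F : State → State := fun u => (p.run u).setVar x ((p.run u).var x + 1) with hF
    -- Induction on the number `d` of iterations still to be done.
    have key : ∀ d u, (∀ z ∈ L, u.var z ≤ B) → u.var y = u.var x + d →
        ∃ t ≤ 4 + d * (8 + p.cost B), Exec (.loop (.minus (.var y) (.var x))
          (.seq p.compile (.assign x (.plus (.var x) (.lit 1))))) u t (F^[d] u) := by
      intro d
      induction d with
      | zero =>
        intro u _ hu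
        exact ⟨4, by omega, Exec.loop_stop (by simp [Expr.eval, hu])⟩
      | succ d ih =>
        intro u huB hu
        obtain ⟨t, ht, h1⟩ := hp hpL u huB
        have hv : ∀ z ∈ L, (F u).var z = u.var z := by
          intro z hz
          have hzx : z ≠ x := fun h => hxL (h ▸ hz)
          rw [hF, State.setVar_var, if_neg hzx, (run_agree p u).var z (hpL.notMem hz)]
        have hx : (F u).var x = u.var x + 1 := by
          rw [hF, State.setVar_var, if_pos rfl, (run_agree p u).var x hxp]
        obtain ⟨t', ht', h2⟩ := ih (F u) (fun z hz => (hv z hz).symm ▸ huB z hz)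
          (by rw [hv y hyL, hx, hu]; omega)
        refine ⟨_, ?_, .loop_step (s' := F u) ?_ (.seq h1 (.assign x _ _)) h2⟩
        · simp only [Expr.cost]
          have : (d + 1) * (8 + p.cost B) = d * (8 + p.cost B) + (8 + p.cost B) := by ring
          omega
        · simp only [Expr.eval, hu]
          omega
    obtain ⟨t, ht, h1⟩ := key (s.var y) (s.setVar x 0) (fun z hz => by
      have hzx : z ≠ x := fun h => hxL (h ▸ hz)
      rw [State.setVar_var, if_neg hzx]
      exact hB z hz) (by simp [hxy])
    refine ⟨_, ?_, .seq (.assign x (.lit 0) s) h1⟩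
    simp only [Expr.cost, cost]
    have := Nat.mul_le_mul_right (8 + p.cost B) (hB y hyL)
    omega

/-- Each loop raises the degree by one; sequencing crudely adds degrees, which is harmless because
the program is fixed. -/
theorem exists_cost_le (p : ForProgram) : ∃ c d, ∀ B, p.cost B ≤ c * (B + 1) ^ d := by
  have const : ∀ m : ℕ, ∀ d B : ℕ, m ≤ m * (B + 1) ^ d := fun m d B =>
    Nat.le_mul_of_pos_right _ (by positivity)
  have lift : ∀ {m c d B : ℕ} (d' : ℕ), m ≤ c * (B + 1) ^ d → m ≤ c * (B + 1) ^ (d + d') :=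
    fun d' h => h.trans (Nat.mul_le_mul_left _ (Nat.pow_le_pow_right (by omega) (by omega)))
  induction p with
  | skip => exact ⟨1, 0, fun B => const 1 0 B⟩
  | assign x e => exact ⟨_, 0, fun B => const (e.cost + 1) 0 B⟩
  | store a i e => exact ⟨_, 0, fun B => const (i.cost + e.cost + 1) 0 B⟩
  | seq p q hp hq =>
    obtain ⟨c, d, h⟩ := hp
    obtain ⟨c', d', h'⟩ := hq
    refine ⟨c + c', d + d', fun B => ?_⟩
    have h1 := lift d' (h B)
    have h2 := lift d (h' B)
    rw [add_comm d' d] at h2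
    rw [cost, add_mul]
    omega
  | cond e p q hp hq =>
    obtain ⟨c, d, h⟩ := hp
    obtain ⟨c', d', h'⟩ := hq
    refine ⟨(e.cost + 1) + c + c', d + d', fun B => ?_⟩
    have h1 := lift d' (h B)
    have h2 := lift d (h' B)
    have h3 := const (e.cost + 1) (d + d') B
    rw [add_comm d' d] at h2
    rw [cost, add_mul, add_mul]
    omega
  | upto x y p hp =>
    obtain ⟨c, d, h⟩ := hp
    refine ⟨14 + c, d + 1, fun B => ?_⟩
    have h1 : B * (8 + p.cost B) ≤ (8 + c) * (B + 1) ^ (d + 1) := by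
      have : 8 + p.cost B ≤ (8 + c) * (B + 1) ^ d := by
        have h1 := h B
        have h2 := const 8 d B
        rw [add_mul]
        omega
      calc B * (8 + p.cost B) ≤ (B + 1) * ((8 + c) * (B + 1) ^ d) :=
            Nat.mul_le_mul (by omega) this
        _ = _ := by ring
    have h2 := const 6 (d + 1) B
    rw [cost, show 14 + c = 6 + (8 + c) by omega, add_mul]
    omega

/-- Invariants of loops. -/
theorem run_upto {x y : ℕ} {p : ForProgram} {s : State} {m : ℕ} (hm : s.var y = m)
    (hx : x ∉ p.vars) (I : ℕ → State → Prop) (h0 : I 0 (s.setVar x 0))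
    (hs : ∀ i u, i < m → I i u → u.var x = i → Agree (x :: p.vars) p.arrs s u →
      I (i + 1) ((p.run u).setVar x (i + 1))) :
    I m ((upto x y p).run s) := by
  subst hm
  simp only [run]
  have key : ∀ m ≤ s.var y, ∀ u,
      u = (fun u => (p.run u).setVar x ((p.run u).var x + 1))^[m] (s.setVar x 0) →
      I m u ∧ u.var x = m ∧ Agree (x :: p.vars) p.arrs s u := by
    intro m
    induction m with
    | zero =>
      rintro _ u rfl
      refine ⟨h0, by simp, ⟨fun z hz => ?_, fun _ _ => rfl⟩⟩
      simp only [List.mem_cons, not_or] at hz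
      simp [hz.1]
    | succ m ih =>
      rintro hm u rfl
      rw [Function.iterate_succ_apply']
      obtain ⟨h1, h2, h3⟩ := ih (by omega) _ rfl
      generalize (fun u => (p.run u).setVar x ((p.run u).var x + 1))^[m] (s.setVar x 0) = u at *
      have h4 : (p.run u).var x = m := by rw [(run_agree p u).var x hx, h2]
      simp only [h4]
      refine ⟨hs m u (by omega) h1 h2 h3, by simp, ⟨fun z hz => ?_, fun a ha => ?_⟩⟩
      · have hz' := hz
        simp only [List.mem_cons, not_or] at hz'
        rw [State.setVar_var, if_neg hz'.1, (run_agree p u).var z hz'.2, h3.var z hz]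
      · rw [State.setVar_arr, (run_agree p u).arr a ha, h3.arr a ha]
  exact (key _ le_rfl _ rfl).1

end ForProgram

end Ram

/-! ### The program -/

namespace Ram

namespace Expr

/-- `1` if the values of `e` and `f` are equal, `0` otherwise. -/
def eq (e f : Expr) : Expr := .minus (.lit 1) (.plus (.minus e f) (.minus f e))

/-- Nonzero if and only if the value of `e` is zero. -/
def not (e : Expr) : Expr := .minus (.lit 1) e

def succ (e : Expr) : Expr := .plus e (.lit 1)

def pred (e : Expr) : Expr := .minus e (.lit 1)

/-- The index of the entry `(u, v)` in an array that holds an `n × n` matrix; cell `u` of array `5`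
holds `n * u`. -/
def entry (u v : Expr) : Expr := .plus (.get 5 u) v

section

variable (s : State) (e f : Expr) (m x a : ℕ)

@[simp] theorem eval_lit : (lit m).eval s = m := rfl

@[simp] theorem eval_var : (var x).eval s = s.var x := rfl

@[simp] theorem eval_get : (get a e).eval s = s.arr a (e.eval s) := rfl

@[simp] theorem eval_plus : (plus e f).eval s = e.eval s + f.eval s := rfl

@[simp] theorem eval_minus : (minus e f).eval s = e.eval s - f.eval s := rfl

@[simp] theorem eval_succ : (succ e).eval s = e.eval s + 1 := rfl

@[simp] theorem eval_pred : (pred e).eval s = e.eval s - 1 := rfl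

@[simp] theorem eval_entry : (entry e f).eval s = s.arr 5 (e.eval s) + f.eval s := rfl

@[simp] theorem eval_not : (not e).eval s = if e.eval s = 0 then 1 else 0 := by
  change 1 - e.eval s = _
  split_ifs <;> omega

@[simp] theorem eval_eq : (eq e f).eval s = if e.eval s = f.eval s then 1 else 0 := by
  change 1 - (e.eval s - f.eval s + (f.eval s - e.eval s)) = _
  split_ifs <;> omega

end

end Expr

/-- `p` is executed if `e` is nonzero. -/
def when (e : Expr) (p : ForProgram) : ForProgram := .cond e p .skip

/-- The programs of a list, one after the other. -/
def block : List ForProgram → ForProgram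
  | [] => .skip
  | p :: l => .seq p (block l)

namespace ForProgram

section

variable (s : State) (e f : Expr) (x a : ℕ) (p q : ForProgram) (l : List ForProgram)

@[simp] theorem run_assign : (assign x e).run s = s.setVar x (e.eval s) := rfl

@[simp] theorem run_store : (store a e f).run s = s.setArr a (e.eval s) (f.eval s) := rfl

@[simp] theorem run_seq : (seq p q).run s = q.run (p.run s) := rfl

@[simp] theorem run_cond :
    (cond e p q).run s = if e.eval s = 0 then q.run s else p.run s := rfl

@[simp] theorem run_when : (when e p).run s = if e.eval s = 0 then s else p.run s := rfl

@[simp] theorem run_block_nil : (block []).run s = s := rfl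

@[simp] theorem run_block_cons : (block (p :: l)).run s = (block l).run (p.run s) := rfl

end

end ForProgram

def initCell : ForProgram := block [
  .store 5 (.var 7) (.var 6),
  .assign 6 (.plus (.var 6) (.var 0)),
  .store 2 (.var 7) (.get 1 (.var 7)),
  .assign 3 (.plus (.var 3) (.get 1 (.var 7)))]

/-- Array `5` becomes the table of the multiples of `n`, array `2` a copy of array `1`, variable
`3` the number of elements of `T`, and variable `8` the number `n + 2`. -/
def initTables : ForProgram :=
  .seq (.upto 7 0 initCell) (.assign 8 (.plus (.var 0) (.lit 2)))

def doubleLimit : ForProgram := .assign 4 (.plus (.var 4) (.var 4))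

def addLimit : ForProgram := .assign 5 (.plus (.var 5) (.var 8))

/-- Variable `4` becomes `2 ^ |T|`, and variable `5` becomes `(n + 2) ^ 2`. -/
def initLimits : ForProgram := block [
  .assign 4 (.lit 1),
  .upto 7 3 doubleLimit,
  .upto 7 8 addLimit]

/-- Without division, half and parity of the counter are updated incrementally in variables `9` and
`10`. -/
def halfCell : ForProgram := block [
  .store 6 (.var 7) (.var 9),
  .store 7 (.var 7) (.var 10),
  .cond (.var 10) (.seq (.assign 9 (.succ (.var 9))) (.assign 10 (.lit 0)))
    (.assign 10 (.lit 1))]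

/-- Arrays `6` and `7` become tables of the halves and the parities of the numbers below
`2 ^ |T|`. -/
def halfTable : ForProgram := .upto 7 4 halfCell

def adjEntry : ForProgram :=
  .seq (.store 9 (.entry (.var 12) (.var 13)) (.lit 0))
    (when (.not (.plus (.get 8 (.var 12)) (.get 8 (.var 13))))
      (when (.plus (.get 0 (.entry (.var 12) (.var 13))) (.eq (.var 12) (.var 13)))
        (.store 9 (.entry (.var 12) (.var 13)) (.lit 1))))

/-- Array `9` becomes the matrix of the adjacencies and identities outside the set in array `8`. -/
def adjTable : ForProgram := .upto 12 0 (.upto 13 0 adjEntry)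

def closeEntry : ForProgram :=
  when (.get 9 (.entry (.var 12) (.var 14)))
    (when (.get 9 (.entry (.var 14) (.var 13)))
      (.store 9 (.entry (.var 12) (.var 13)) (.lit 1)))

/-- Adds the compositions through variable `14` to the relation in array `9`. -/
def closeThrough : ForProgram := .upto 12 0 (.upto 13 0 closeEntry)

/-- The transitive closure of the relation in array `9`. -/
def closeTable : ForProgram := .upto 14 0 closeThrough

def countCell : ForProgram :=
  when (.get 1 (.var 13))
    (when (.get 9 (.entry (.var 12) (.var 13)))
      (when (.get 9 (.entry (.var 13) (.var 12)))
        (.assign 16 (.succ (.var 16)))))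

/-- Variable `16` becomes the number of vertices of `T` in the strong component of variable `12`. -/
def countComp : ForProgram :=
  .seq (.assign 16 (.lit 0)) (.upto 13 0 countCell)

/-- Variable `12` is a vertex of the big component, variable `17` the candidate. For an empty path
the term `.not (.var 2)` waives the adjacency condition. -/
def tryNext : ForProgram :=
  when (.get 9 (.entry (.var 17) (.var 12)))
    (when (.plus (.not (.var 2)) (.get 0 (.entry (.get 3 (.pred (.var 2))) (.var 17))))
      (.assign 15 (.succ (.var 17))))

def findNextFrom : ForProgram :=
  .seq countComp (when (.minus (.plus (.var 16) (.var 16)) (.var 3)) (.upto 17 0 tryNext))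

/-- Variable `15` becomes `y + 1` for a vertex `y` that may be appended to the path in array `3`,
if there is one. -/
def findNext : ForProgram :=
  .seq (.assign 15 (.lit 0)) (.upto 12 0 findNextFrom)

/-- Appends the vertex found by `findNext` to the path. -/
def appendNext : ForProgram :=
  when (.var 15) (block [
    .store 3 (.var 2) (.pred (.var 15)),
    .store 8 (.pred (.var 15)) (.lit 1),
    .assign 2 (.succ (.var 2))])

def extendPath : ForProgram := block [adjTable, closeTable, findNext, appendNext]

/-- Builds the path: its length is in variable `2`, its vertices are in array `3`, and array `8`
holds its vertex set. -/
def buildPath : ForProgram := .upto 11 0 extendPath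

/-- One bit of the code in variable `21` is consumed for each member of `T`. -/
def decodeCell : ForProgram :=
  .cond (.get 1 (.var 23))
    (block [
      .store 11 (.var 23) (.get 7 (.var 21)),
      .assign 22 (.plus (.var 22) (.get 7 (.var 21))),
      .assign 21 (.get 6 (.var 21))])
    (.store 11 (.var 23) (.lit 0))

/-- Array `11` becomes the subset of `T` with the code in variable `20`, and variable `22` its
size. -/
def decode : ForProgram := block [
  .assign 21 (.var 20),
  .assign 22 (.lit 0),
  .upto 23 0 decodeCell]

def resetCell : ForProgram := block [
  .store 13 (.var 24) (.lit 0),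
  .store 14 (.var 24) (.lit 0),
  .store 15 (.var 24) (.lit 0)]

/-- Resets the auction: arrays `13`, `14` and `15` hold the owners, the prices and the
satisfied bidders. -/
def resetAuction : ForProgram := .upto 24 0 resetCell

def compareCell (X : ℕ) : ForProgram :=
  when (.not (.get X (.var 27)))
    (when (.plus (.get 0 (.entry (.var 25) (.var 27))) (.eq (.var 25) (.var 27)))
      (.cond (.var 26)
        (when (.minus (.get 14 (.pred (.var 26))) (.get 14 (.var 27)))
          (.assign 26 (.succ (.var 27))))
        (.assign 26 (.succ (.var 27)))))

/-- Variable `26` becomes `w + 1` for a cheapest vertex `w` that variable `25` may be matched to,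
if there is one. -/
def findCheapest (X : ℕ) : ForProgram :=
  .seq (.assign 26 (.lit 0)) (.upto 27 0 (compareCell X))

/-- Variable `25` buys the vertex found by `findCheapest`. -/
def buy : ForProgram :=
  when (.var 26) (when (.minus (.succ (.var 0)) (.get 14 (.pred (.var 26)))) (block [
    -- The displaced owner must be released before array `13` is overwritten.
    when (.get 13 (.pred (.var 26))) (.store 15 (.pred (.get 13 (.pred (.var 26)))) (.lit 0)),
    .store 13 (.pred (.var 26)) (.succ (.var 25)),
    .store 15 (.var 25) (.lit 1),
    .store 14 (.pred (.var 26)) (.succ (.get 14 (.pred (.var 26))))]))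

def bidCell (X Y : ℕ) : ForProgram :=
  when (.not (.plus (.get Y (.var 25)) (.get 15 (.var 25)))) (.seq (findCheapest X) buy)

/-- One round of the auction. -/
def auctionRound (X Y : ℕ) : ForProgram := .upto 25 0 (bidCell X Y)

/-- Variable `29` counts the unsatisfied bidders and variable `30` the elements of `X`. -/
def evaluateCell (X Y : ℕ) : ForProgram :=
  .seq (when (.not (.plus (.get Y (.var 24)) (.get 15 (.var 24)))) (.assign 29 (.succ (.var 29))))
    (.assign 30 (.plus (.var 30) (.get X (.var 24))))

/-- Sets variable `19` to `0` if the separators are too small at the end of the auction. -/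
def evaluate (X Y : ℕ) : ForProgram := block [
  .assign 29 (.lit 0),
  .assign 30 (.lit 0),
  .upto 24 0 (evaluateCell X Y),
  when (.minus (.succ (.plus (.var 1) (.plus (.var 29) (.var 29)))) (.plus (.var 30) (.var 30)))
    (.assign 19 (.lit 0))]

/-- Sets variable `19` to `0` if some set of at most `k / 2` vertices separates the sets in arrays
`X` and `Y`. -/
def auction (X Y : ℕ) : ForProgram :=
  block [resetAuction, .upto 28 5 (auctionRound X Y), evaluate X Y]

def testCode : ForProgram :=
  .seq decode (when (.minus (.plus (.var 22) (.var 22)) (.var 3))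
    (.seq (auction 12 11) (auction 11 12)))

/-- Variable `19` tells whether the set in array `12` is rich. -/
def testRich : ForProgram := .seq (.assign 19 (.lit 1)) (.upto 20 4 testCode)

def clearCell : ForProgram := .store 12 (.var 24) (.lit 0)

/-- Ends a segment: its last vertex is put into array `4`. -/
def endSegment : ForProgram :=
  when (.var 19) (when (.minus (.var 1) (.var 31)) (block [
    .store 4 (.get 3 (.var 18)) (.lit 1),
    .assign 31 (.succ (.var 31)),
    .upto 24 0 clearCell]))

def cutStep : ForProgram :=
  when (.minus (.var 2) (.var 18)) (block [
    .store 12 (.get 3 (.var 18)) (.lit 1), testRich, endSegment])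

/-- Cuts the path into segments. -/
def cutPath : ForProgram := .upto 18 0 cutStep

def mainPhase : ForProgram := block [halfTable, buildPath, cutPath]

/-- The algorithm. -/
def algorithm : Program :=
  .seq initTables.compile (.seq initLimits.compile mainPhase.compile)

/-- The phases are checked separately because the limits of each later phase are partly computed by
the earlier ones. -/
theorem initTables_wf : initTables.WF [0] := by decide

theorem initLimits_wf : initLimits.WF [3, 8] := by decide

theorem mainPhase_wf : mainPhase.WF [0, 4, 5] := by decide

end Ram

/-! ### Correctness of the reachability table -/

namespace Ram

open MultiDigraph

variable {n : ℕ} {D : MultiDigraph (Fin n)} {T : Finset (Fin n)} {k : ℕ} {s u : State}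

/-- The data that the main phase only reads. -/
structure Ctx (D : MultiDigraph (Fin n)) (T : Finset (Fin n)) (k : ℕ) (s : State) : Prop where
  n_eq : s.var 0 = n
  k_eq : s.var 1 = k
  card_eq : s.var 3 = T.card
  pow_eq : s.var 4 = 2 ^ T.card
  rounds_eq : s.var 5 = (n + 2) * (n + 2)
  mult_eq : ∀ v w : Fin n, s.arr 0 (v * n + w) = D.mult v w
  mem_eq : ∀ v : Fin n, s.arr 1 v = if v ∈ T then 1 else 0
  row_eq : ∀ v : Fin n, s.arr 5 v = v * n

theorem Ctx.agree (h : Ctx D T k s) {vs as : List ℕ} (hu : Agree vs as s u)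
    (hvs : ∀ x ∈ [0, 1, 3, 4, 5], x ∉ vs) (has : ∀ a ∈ [0, 1, 5], a ∉ as) : Ctx D T k u where
  n_eq := (hu.var 0 (hvs 0 (by simp))).trans h.n_eq
  k_eq := (hu.var 1 (hvs 1 (by simp))).trans h.k_eq
  card_eq := (hu.var 3 (hvs 3 (by simp))).trans h.card_eq
  pow_eq := (hu.var 4 (hvs 4 (by simp))).trans h.pow_eq
  rounds_eq := (hu.var 5 (hvs 5 (by simp))).trans h.rounds_eq
  mult_eq v w := by rw [hu.arr 0 (has 0 (by simp))]; exact h.mult_eq v w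
  mem_eq v := by rw [hu.arr 1 (has 1 (by simp))]; exact h.mem_eq v
  row_eq v := by rw [hu.arr 5 (has 5 (by simp))]; exact h.row_eq v

/-- Array `a` holds the indicator of the set `S`. -/
def HasSet (a : ℕ) (S : Finset (Fin n)) (s : State) : Prop :=
  ∀ v : Fin n, s.arr a v = if v ∈ S then 1 else 0

theorem HasSet.agree {a : ℕ} {S : Finset (Fin n)} (h : HasSet a S s) {vs as : List ℕ}
    (hu : Agree vs as s u) (ha : a ∉ as) : HasSet a S u := fun v => by
  rw [hu.arr a ha]
  exact h v

/-- The relation in array `9`. -/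
def Rel (s : State) (v w : Fin n) : Prop := s.arr 9 (v * n + w) ≠ 0

theorem Rel.agree_iff {vs as : List ℕ} (hu : Agree vs as s u) (ha : 9 ∉ as) (v w : Fin n) :
    Rel u v w ↔ Rel s v w := by
  unfold Rel
  rw [hu.arr 9 ha]

theorem index_inj {v w v' w' : Fin n} :
    (v : ℕ) * n + w = v' * n + w' ↔ v = v' ∧ w = w' := by
  constructor
  · intro h
    have hw := w.2
    have hw' := w'.2
    have h1 : (v : ℕ) = v' := by
      have := congrArg (· / n) h
      simpa [Nat.add_div_of_dvd_right, Nat.div_eq_of_lt hw, Nat.div_eq_of_lt hw',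
        Nat.mul_div_cancel _ (by omega : 0 < n)] using this
    refine ⟨Fin.ext h1, Fin.ext ?_⟩
    rw [h1] at h
    omega
  · rintro ⟨rfl, rfl⟩
    rfl

theorem adjTable_spec (h : Ctx D T k s) {Z : Finset (Fin n)} (hZ : HasSet 8 Z s) (v w : Fin n) :
    Rel (adjTable.run s) v w ↔ v ∉ Z ∧ w ∉ Z ∧ (v = w ∨ D.Adj v w) := by
  have := ForProgram.run_upto (p := .upto 13 0 adjEntry) (x := 12) h.n_eq (by decide)
    (fun i u => ∀ v w : Fin n, (v : ℕ) < i →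
      (Rel u v w ↔ v ∉ Z ∧ w ∉ Z ∧ (v = w ∨ D.Adj v w))) (by simp) ?_
  · exact this v w v.2
  intro i u hi hI hx hag
  have hcu := h.agree hag (by decide) (by decide)
  have hZu := hZ.agree hag (by decide)
  have := ForProgram.run_upto (p := adjEntry) (x := 13) (s := u) hcu.n_eq (by decide)
    (fun j u => ∀ v w : Fin n, ((v : ℕ) < i ∨ (v : ℕ) = i ∧ (w : ℕ) < j) →
      (Rel u v w ↔ v ∉ Z ∧ w ∉ Z ∧ (v = w ∨ D.Adj v w))) ?_ ?_
  · intro v w hv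
    exact this v w (by have := w.2; omega)
  · intro v w hv
    exact hI v w (by omega)
  · intro j u' hj hI' hx' hag'
    have hc := hcu.agree hag' (by decide) (by decide)
    have hZ' := hZu.agree hag' (by decide)
    have hx12 : u'.var 12 = i := (hag'.var 12 (by decide)).trans hx
    obtain ⟨a, rfl⟩ : ∃ a : Fin n, (a : ℕ) = i := ⟨⟨i, hi⟩, rfl⟩
    obtain ⟨b, rfl⟩ : ∃ b : Fin n, (b : ℕ) = j := ⟨⟨j, hj⟩, rfl⟩
    intro v w hvw
    have h1 := hZ' a
    have h2 := hZ' b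
    have h3 := hc.row_eq a
    have h4 := hc.mult_eq a b
    have h5 : D.Adj a b ↔ D.mult a b ≠ 0 := Nat.pos_iff_ne_zero
    by_cases hab : v = a ∧ w = b
    · obtain ⟨rfl, rfl⟩ := hab
      by_cases hv : v ∈ Z <;> by_cases hw : w ∈ Z <;> by_cases hvw : v = w <;>
        by_cases hm : D.mult v w = 0 <;> simp_all [Rel, adjEntry, Fin.val_inj]
    · have := hI' v w (by
        rcases hvw with h | h
        · exact .inl h
        · by_cases hvb : (w : ℕ) = b
          · exact absurd ⟨Fin.ext h.1, Fin.ext hvb⟩ hab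
          · exact .inr ⟨h.1, by omega⟩)
      rw [← this]
      have hne : (v : ℕ) * n + w ≠ a * n + b := fun h => hab (index_inj.1 h)
      simp only [Rel, adjEntry, ForProgram.run_seq, ForProgram.run_when]
      split_ifs <;> simp [h3, hx', hx12, hne]

/-- The table is updated in place, but a pass through `m` leaves row `m` and column `m` unchanged,
so it acts as if it read the old table. -/
theorem closeThrough_spec (h : Ctx D T k s) {m : Fin n} (hm : s.var 14 = m) (v w : Fin n) :
    Rel (closeThrough.run s) v w ↔ Rel s v w ∨ Rel s v m ∧ Rel s m w := by
  have := ForProgram.run_upto (p := .upto 13 0 closeEntry) (x := 12) h.n_eq (by decide)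
    (fun i u => ∀ v w : Fin n, Rel u v w ↔ Rel s v w ∨ ((v : ℕ) < i ∧ Rel s v m ∧ Rel s m w))
    (by simp [Rel]) ?_
  · have := this v w
    rw [and_iff_right v.2] at this
    exact this
  intro i u hi hI hx hag
  have hcu := h.agree hag (by decide) (by decide)
  have hmu : u.var 14 = m := (hag.var 14 (by decide)).trans hm
  have := ForProgram.run_upto (p := closeEntry) (x := 13) (s := u) hcu.n_eq (by decide)
    (fun j u => ∀ v w : Fin n, Rel u v w ↔ Rel s v w ∨
      (((v : ℕ) < i ∨ (v : ℕ) = i ∧ (w : ℕ) < j) ∧ Rel s v m ∧ Rel s m w)) ?_ ?_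
  · intro v w
    have h1 : ((v : ℕ) < i ∨ (v : ℕ) = i ∧ (w : ℕ) < n) ↔ (v : ℕ) < i + 1 := by
      have := w.2
      omega
    rw [← h1]
    exact this v w
  · simpa [Rel] using hI
  · intro j u' hj hI' hx' hag'
    have hc := hcu.agree hag' (by decide) (by decide)
    have hx12 : u'.var 12 = i := (hag'.var 12 (by decide)).trans hx
    have hx14 : u'.var 14 = m := (hag'.var 14 (by decide)).trans hmu
    obtain ⟨a, rfl⟩ : ∃ a : Fin n, (a : ℕ) = i := ⟨⟨i, hi⟩, rfl⟩
    obtain ⟨b, rfl⟩ : ∃ b : Fin n, (b : ℕ) = j := ⟨⟨j, hj⟩, rfl⟩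
    have h3 := hc.row_eq a
    have h4 := hc.row_eq m
    have h5 : Rel u' a m ↔ Rel s a m := (hI' a m).trans (or_iff_left_of_imp fun h => h.2.1)
    have h6 : Rel u' m b ↔ Rel s m b := (hI' m b).trans (or_iff_left_of_imp fun h => h.2.2)
    have hrun : ∀ v w : Fin n, Rel (closeEntry.run u') v w ↔
        Rel u' v w ∨ (v = a ∧ w = b) ∧ Rel u' a m ∧ Rel u' m b := by
      intro v w
      simp only [Rel, closeEntry, ForProgram.run_when, Expr.eval_get, Expr.eval_entry,
        Expr.eval_var, hx12, hx14, hx', h3, h4, ForProgram.run_store, Expr.eval_lit]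
      split_ifs with h7 h8
      · simp [h7]
      · simp [h8]
      · rw [State.setArr_arr_apply, if_pos rfl]
        simp only [index_inj, h7, h8, ne_eq, not_false_eq_true, and_self, and_true]
        split_ifs with h9
        · simp [h9]
        · simp [h9]
    intro v w
    change Rel (closeEntry.run u') v w ↔ _
    rw [hrun, hI', h5, h6]
    have h7 : ((v : ℕ) < a ∨ (v : ℕ) = a ∧ (w : ℕ) < b + 1) ↔
        ((v : ℕ) < a ∨ (v : ℕ) = a ∧ (w : ℕ) < b) ∨ (v = a ∧ w = b) := by
      rw [Fin.ext_iff, Fin.ext_iff]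
      omega
    have h8 : (v = a ∧ w = b) ∧ Rel s a m ∧ Rel s m b ↔
        (v = a ∧ w = b) ∧ Rel s v m ∧ Rel s m w := by
      constructor <;> rintro ⟨⟨rfl, rfl⟩, h⟩ <;> exact ⟨⟨rfl, rfl⟩, h⟩
    rw [h7, h8, or_assoc]
    exact or_congr_right or_and_right.symm

/-- Warshall's algorithm. The invariant is that the relation is sound, contains the initial one, and
is transitive through each vertex already processed. Transitivity through all vertices yields every
walk. -/
theorem closeTable_spec (h : Ctx D T k s) {Z : Finset (Fin n)}
    (hR : ∀ v w, Rel s v w ↔ v ∉ Z ∧ w ∉ Z ∧ (v = w ∨ D.Adj v w)) (v w : Fin n) :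
    Rel (closeTable.run s) v w ↔ D.ReachAvoid Z v w := by
  have := ForProgram.run_upto (p := closeThrough) (x := 14) h.n_eq (by decide)
    (fun i u => (∀ v w : Fin n, Rel u v w → D.ReachAvoid Z v w) ∧
      (∀ v w : Fin n, Rel s v w → Rel u v w) ∧
      ∀ m : Fin n, (m : ℕ) < i → ∀ v w : Fin n, Rel u v m → Rel u m w → Rel u v w) ?_ ?_
  · change _ ∧ (∀ v w : Fin n, Rel s v w → Rel (closeTable.run s) v w) ∧ _ at this
    obtain ⟨h1, h2, h3⟩ := this
    refine ⟨h1 v w, fun hr => ?_⟩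
    have hz := hr.1
    obtain ⟨_, hr⟩ := hr
    induction hr with
    | refl => exact h2 _ _ ((hR _ _).2 ⟨hz, hz, .inl rfl⟩)
    | @tail a b hva hab ih =>
      have ha : a ∉ Z := (show D.ReachAvoid Z v a from ⟨hz, hva⟩).right_notMem
      exact h3 a a.2 _ _ ih (h2 _ _ ((hR _ _).2 ⟨ha, hab.2, .inr hab.1⟩))
  · refine ⟨fun v w hvw => ?_, fun v w hvw => hvw, by simp⟩
    obtain ⟨h1, h2, rfl | h3⟩ := (hR v w).1 hvw
    · exact .refl h1
    · exact (ReachAvoid.refl h1).tail h3 h2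
  · rintro i u hi ⟨h1, h2, h3⟩ hx hag
    have hc := h.agree hag (by decide) (by decide)
    have hs := closeThrough_spec hc (m := ⟨i, hi⟩) hx
    refine ⟨fun v w hvw => ?_, fun v w hvw => ?_, fun m hm v w hvm hmw => ?_⟩
    · rcases (hs v w).1 hvw with hvw | ⟨h4, h5⟩
      · exact h1 _ _ hvw
      · exact (h1 _ _ h4).trans (h1 _ _ h5)
    · exact (hs v w).2 (.inl (h2 v w hvw))
    · have h4 := (hs v m).1 hvm
      have h5 := (hs m w).1 hmw
      apply (hs v w).2
      by_cases hmi : (m : ℕ) < i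
      · have h6 := h3 m hmi
        rcases h4 with h4 | ⟨h4, h4'⟩ <;> rcases h5 with h5 | ⟨h5, h5'⟩
        · exact .inl (h6 _ _ h4 h5)
        · exact .inr ⟨h6 _ _ h4 h5, h5'⟩
        · exact .inr ⟨h4, h6 _ _ h4' h5⟩
        · exact .inr ⟨h4, h5'⟩
      · obtain rfl : m = ⟨i, hi⟩ := Fin.ext (by simp; omega)
        tauto

end Ram

/-! ### Correctness of the path construction -/

namespace Ram

open MultiDigraph

variable {n : ℕ} {D : MultiDigraph (Fin n)} {T : Finset (Fin n)} {k : ℕ} {s u : State}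

theorem card_filter_lt_succ (S : Finset (Fin n)) (a : Fin n) :
    (S.filter fun v : Fin n => (v : ℕ) < a + 1).card =
      (S.filter fun v : Fin n => (v : ℕ) < a).card + if a ∈ S then 1 else 0 := by
  split_ifs with ha
  · rw [← Finset.card_insert_of_notMem (a := a) (by simp)]
    congr 1
    ext v
    simp only [Finset.mem_filter, Finset.mem_insert, Fin.ext_iff]
    constructor
    · rintro ⟨h1, h2⟩
      by_cases h : (v : ℕ) = a
      · exact .inl h
      · exact .inr ⟨h1, by omega⟩
    · rintro (h | ⟨h1, h2⟩)
      · exact ⟨(Fin.ext h : v = a) ▸ ha, by omega⟩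
      · exact ⟨h1, by omega⟩
  · rw [Nat.add_zero]
    congr 1
    ext v
    simp only [Finset.mem_filter]
    constructor
    · rintro ⟨h1, h2⟩
      have : (v : ℕ) ≠ a := fun h => ha ((Fin.ext h : v = a) ▸ h1)
      exact ⟨h1, by omega⟩
    · rintro ⟨h1, h2⟩
      exact ⟨h1, by omega⟩

theorem card_filter_lt_self (S : Finset (Fin n)) : (S.filter fun v : Fin n => (v : ℕ) < n).card = S.card := by
  congr 1
  exact Finset.filter_true_of_mem fun v _ => v.2

theorem card_filter_lt_zero (S : Finset (Fin n)) : (S.filter fun v : Fin n => (v : ℕ) < 0).card = 0 := by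
  simp

theorem countComp_spec (h : Ctx D T k s) {Z : Finset (Fin n)}
    (hR : ∀ v w, Rel s v w ↔ D.ReachAvoid Z v w) {v : Fin n} (hv : s.var 12 = v) :
    (countComp.run s).var 16 = (D.compIn T Z v).card := by
  set s1 := s.setVar 16 0 with hs1
  have hag1 : Agree [16] [] s s1 := ForProgram.run_agree (.assign 16 (.lit 0)) s
  have h1 := h.agree hag1 (by decide) (by decide)
  have := ForProgram.run_upto (p := countCell) (x := 13) h1.n_eq (by decide)
    (fun i u => u.var 16 = ((D.compIn T Z v).filter fun t : Fin n => (t : ℕ) < i).card) ?_ ?_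
  · rw [card_filter_lt_self] at this
    exact this
  · rw [card_filter_lt_zero]
    simp [hs1]
  · intro i u hi hI hx hag
    have hc := h1.agree hag (by decide) (by decide)
    have hv' : u.var 12 = v := by
      rw [hag.var 12 (by decide), hag1.var 12 (by decide), hv]
    obtain ⟨a, rfl⟩ : ∃ a : Fin n, (a : ℕ) = i := ⟨⟨i, hi⟩, rfl⟩
    have hR1 : ∀ v w, Rel u v w ↔ D.ReachAvoid Z v w := fun v w => by
      rw [Rel.agree_iff hag (by decide), Rel.agree_iff hag1 (by decide), hR]
    have h2 := hR1 v a
    have h3 := hR1 a v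
    have h4 := hc.mem_eq a
    classical
    rw [card_filter_lt_succ, ← hI]
    simp only [mem_compIn, ← h2, ← h3]
    simp only [countCell, ForProgram.run_when, Expr.eval_get, Expr.eval_var, hx, h4,
      Expr.eval_entry, hv', hc.row_eq, Rel]
    by_cases h5 : a ∈ T <;> by_cases h6 : u.arr 9 (v * n + a) = 0 <;>
      by_cases h7 : u.arr 9 (a * n + v) = 0 <;> simp [h5, h6, h7]

/-- The path `P` is in array `3`, and its length in variable `2`. -/
structure HasPath (P : List (Fin n)) (s : State) : Prop where
  length_eq : s.var 2 = P.length
  get_eq : ∀ i (h : i < P.length), s.arr 3 i = P[i]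

theorem HasPath.agree {P : List (Fin n)} (h : HasPath P s) {vs as : List ℕ}
    (hu : Agree vs as s u) (hv : 2 ∉ vs) (ha : 3 ∉ as) : HasPath P u where
  length_eq := (hu.var 2 hv).trans h.length_eq
  get_eq i hi := by
    rw [hu.arr 3 ha]
    exact h.get_eq i hi

/-- Appending `y` to the search path `P` is possible because of the big vertex `v`. -/
def Witness (D : MultiDigraph (Fin n)) (T : Finset (Fin n)) (P : List (Fin n)) (v y : Fin n) :
    Prop :=
  D.IsBig T P.toFinset v ∧ D.ReachAvoid P.toFinset y v ∧ ∀ x, P.getLast? = some x → D.Adj x y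

theorem Witness.isNext {P : List (Fin n)} {v y : Fin n} (h : Witness D T P v y) :
    D.IsNext T P y := ⟨⟨v, h.1, h.2.1⟩, h.2.2⟩

theorem tryNext_spec (h : Ctx D T k s) {P : List (Fin n)} (hP : HasPath P s)
    (hR : ∀ v w, Rel s v w ↔ D.ReachAvoid P.toFinset v w) {v y : Fin n} (hv : s.var 12 = v)
    (hy : s.var 17 = y) (hb : D.IsBig T P.toFinset v) :
    Witness D T P v y ∧ (tryNext.run s).var 15 = y + 1 ∨
      ¬ Witness D T P v y ∧ (tryNext.run s).var 15 = s.var 15 := by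
  have h1 : s.arr 9 (y * n + v) = 0 ↔ ¬ D.ReachAvoid P.toFinset y v := by
    rw [← hR, Rel, not_not]
  -- On the empty path, truncated subtraction reads an irrelevant cell; the first summand already
  -- makes the test nonzero.
  have h2 : (if s.var 2 = 0 then 1 else 0) + s.arr 0 (s.arr 5 (s.arr 3 (s.var 2 - 1)) + y) = 0 ↔
      ¬ ∀ x, P.getLast? = some x → D.Adj x y := by
    rw [hP.length_eq]
    rcases eq_or_ne P [] with rfl | hne
    · simp
    · have hl : 0 < P.length := List.length_pos_iff.2 hne
      rw [hP.get_eq _ (by omega), h.row_eq, h.mult_eq, if_neg (by omega),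
        List.getLast?_eq_some_getLast hne, List.getLast_eq_getElem]
      simp [MultiDigraph.Adj]
  have hrun : tryNext.run s = if s.arr 9 (y * n + v) = 0 then s else
      if (if s.var 2 = 0 then 1 else 0) + s.arr 0 (s.arr 5 (s.arr 3 (s.var 2 - 1)) + y) = 0
      then s else s.setVar 15 (y + 1) := by
    simp only [tryNext, ForProgram.run_when, Expr.eval_get, Expr.eval_entry, Expr.eval_var, hy, hv,
      h.row_eq, Expr.eval_plus, Expr.eval_not, Expr.eval_pred, ForProgram.run_assign,
      Expr.eval_succ]
    rfl
  rw [hrun]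
  by_cases h3 : D.ReachAvoid P.toFinset y v
  · rw [if_neg (fun h => h1.1 h h3)]
    by_cases h4 : ∀ x, P.getLast? = some x → D.Adj x y
    · rw [if_neg (fun h => h2.1 h h4)]
      exact .inl ⟨⟨hb, h3, h4⟩, by simp⟩
    · rw [if_pos (h2.2 h4)]
      exact .inr ⟨fun hw => h4 hw.2.2, rfl⟩
  · rw [if_pos (h1.2 h3)]
    exact .inr ⟨fun hw => h3 hw.2.1, rfl⟩

theorem findNextFrom_spec (h : Ctx D T k s) {P : List (Fin n)} (hP : HasPath P s)
    (hR : ∀ v w, Rel s v w ↔ D.ReachAvoid P.toFinset v w) {v : Fin n} (hv : s.var 12 = v) :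
    (∃ y : Fin n, Witness D T P v y ∧ (findNextFrom.run s).var 15 = y + 1) ∨
      (∀ y, ¬ Witness D T P v y) ∧ (findNextFrom.run s).var 15 = s.var 15 := by
  have hag := ForProgram.run_agree countComp s
  have hc := h.agree hag (by decide) (by decide)
  have hcount := countComp_spec h hR hv
  have hb : (countComp.run s).var 16 + (countComp.run s).var 16 - (countComp.run s).var 3 = 0 ↔
      ¬ D.IsBig T P.toFinset v := by
    rw [hcount, hc.card_eq, IsBig]
    omega
  have h15 : (countComp.run s).var 15 = s.var 15 := hag.var 15 (by decide)
  have hP1 := hP.agree hag (by decide) (by decide)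
  have hR1 : ∀ v w, Rel (countComp.run s) v w ↔ D.ReachAvoid P.toFinset v w := fun v w => by
    rw [Rel.agree_iff hag (by decide), hR]
  have hv1 : (countComp.run s).var 12 = v := (hag.var 12 (by decide)).trans hv
  classical
  simp only [findNextFrom, ForProgram.run_seq, ForProgram.run_when, Expr.eval_minus,
    Expr.eval_plus, Expr.eval_var, hb]
  generalize countComp.run s = s1 at *
  by_cases hbig : D.IsBig T P.toFinset v
  swap
  · rw [if_pos hbig]
    exact .inr ⟨fun y hy => hbig hy.1, h15⟩
  · rw [if_neg (not_not.2 hbig)]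
    have := ForProgram.run_upto (p := tryNext) (x := 17) hc.n_eq (by decide)
      (fun i u => (∃ y : Fin n, Witness D T P v y ∧ u.var 15 = y + 1) ∨
        (∀ y : Fin n, (y : ℕ) < i → ¬ Witness D T P v y) ∧ u.var 15 = s.var 15)
      (.inr ⟨by simp, by simpa using h15⟩) ?_
    · exact this.imp id fun h => ⟨fun y => h.1 y y.2, h.2⟩
    · intro i u hi hI hx hag2
      have := tryNext_spec (y := ⟨i, hi⟩) (hc.agree hag2 (by decide) (by decide))
        (hP1.agree hag2 (by decide) (by decide))
        (fun v w => by rw [Rel.agree_iff hag2 (by decide), hR1])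
        ((hag2.var 12 (by decide)).trans hv1) hx hbig
      simp only [State.setVar_var, Nat.reduceEqDiff, if_false]
      rcases this with ⟨h1, h2⟩ | ⟨h1, h2⟩
      · exact .inl ⟨_, h1, h2⟩
      · rw [h2]
        refine hI.imp id fun h3 => ⟨fun y hy hw => ?_, h3.2⟩
        by_cases hyi : (y : ℕ) < i
        · exact h3.1 y hyi hw
        · obtain rfl : y = ⟨i, hi⟩ := Fin.ext (by simp; omega)
          exact h1 hw

theorem findNext_spec (h : Ctx D T k s) {P : List (Fin n)} (hP : HasPath P s)
    (hR : ∀ v w, Rel s v w ↔ D.ReachAvoid P.toFinset v w) :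
    (∃ y : Fin n, D.IsNext T P y ∧ (findNext.run s).var 15 = y + 1) ∨
      (∀ y, ¬ D.IsNext T P y) ∧ (findNext.run s).var 15 = 0 := by
  set s1 := s.setVar 15 0 with hs1
  have hag1 : Agree [15] [] s s1 := ForProgram.run_agree (.assign 15 (.lit 0)) s
  have h1 := h.agree hag1 (by decide) (by decide)
  have := ForProgram.run_upto (p := findNextFrom) (x := 12) h1.n_eq (by decide)
    (fun i u => (∃ y : Fin n, D.IsNext T P y ∧ u.var 15 = y + 1) ∨
      (∀ v y : Fin n, (v : ℕ) < i → ¬ Witness D T P v y) ∧ u.var 15 = 0)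
      (.inr ⟨by simp, by simp [hs1]⟩) ?_
  · refine this.imp id fun h => ⟨?_, h.2⟩
    rintro y ⟨⟨v, hv, hvy⟩, hy⟩
    exact h.1 v y v.2 ⟨hv, hvy, hy⟩
  · intro i u hi hI hx hag2
    have := findNextFrom_spec (v := ⟨i, hi⟩) (h1.agree hag2 (by decide) (by decide))
      ((hP.agree hag1 (by decide) (by decide)).agree hag2 (by decide) (by decide))
      (fun v w => by rw [Rel.agree_iff hag2 (by decide), Rel.agree_iff hag1 (by decide), hR]) hx
    simp only [State.setVar_var, Nat.reduceEqDiff, if_false]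
    rcases this with ⟨y, h1, h2⟩ | ⟨h1, h2⟩
    · exact .inl ⟨y, h1.isNext, h2⟩
    · rw [h2]
      refine hI.imp id fun h3 => ⟨fun v y hv hw => ?_, h3.2⟩
      by_cases hvi : (v : ℕ) < i
      · exact h3.1 v y hvi hw
      · obtain rfl : v = ⟨i, hi⟩ := Fin.ext (by simp; omega)
        exact h1 y hw

theorem extendPath_spec (h : Ctx D T k s) {P : List (Fin n)} (hP : HasPath P s)
    (hZ : HasSet 8 P.toFinset s) (hS : D.IsSearchPath T P) :
    ∃ P', HasPath P' (extendPath.run s) ∧ HasSet 8 P'.toFinset (extendPath.run s) ∧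
      D.IsSearchPath T P' ∧ ((∀ v, ¬ D.IsBig T P.toFinset v) ∧ P' = P ∨
        (∃ v, D.IsBig T P.toFinset v) ∧ P'.length = P.length + 1) := by
  have hag : Agree (ForProgram.vars (block [adjTable, closeTable, findNext]))
      (ForProgram.arrs (block [adjTable, closeTable, findNext])) s
      (findNext.run (closeTable.run (adjTable.run s))) :=
    ForProgram.run_agree (block [adjTable, closeTable, findNext]) s
  have hag1 := ForProgram.run_agree adjTable s
  have hag2 := ForProgram.run_agree closeTable (adjTable.run s)
  have hc1 := h.agree hag1 (by decide) (by decide)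
  have hR1 := adjTable_spec h hZ
  have hR2 := closeTable_spec hc1 hR1
  have hf := findNext_spec (hc1.agree hag2 (by decide) (by decide))
    ((hP.agree hag1 (by decide) (by decide)).agree hag2 (by decide) (by decide)) hR2
  have hP3 := hP.agree hag (by decide) (by decide)
  have hZ3 := hZ.agree hag (by decide)
  simp only [extendPath, ForProgram.run_block_cons, ForProgram.run_block_nil]
  generalize findNext.run (closeTable.run (adjTable.run s)) = u at *
  rcases hf with ⟨y, hy, h15⟩ | ⟨hno, h15⟩
  · refine ⟨P ++ [y], ⟨?_, ?_⟩, ?_, hS.append hy, .inr ⟨⟨_, hy.1.choose_spec.1⟩, by simp⟩⟩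
    · simp [appendNext, h15, hP3.length_eq]
    · intro i hi
      simp only [appendNext, ForProgram.run_when, Expr.eval_var, h15, Nat.add_eq_zero_iff,
        one_ne_zero, and_false, if_false, ForProgram.run_block_cons, ForProgram.run_block_nil,
        ForProgram.run_store, ForProgram.run_assign, Expr.eval_pred, State.setVar_arr,
        State.setArr_arr_apply, State.setArr_var, Nat.reduceEqDiff, if_true, hP3.length_eq,
        Nat.add_sub_cancel]
      rw [List.length_append, List.length_singleton] at hi
      split_ifs with hil
      · subst hil
        simp
      · rw [hP3.get_eq i (by omega), List.getElem_append_left (by omega)]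
    · intro v
      have := hZ3 v
      by_cases hvy : v = y
      · simp [appendNext, h15, hvy]
      · have hvy' : (v : ℕ) ≠ y := fun h => hvy (Fin.ext h)
        simp only [List.mem_toFinset] at this
        simp [appendNext, h15, hvy, hvy', this]
  · refine ⟨P, ?_⟩
    rw [appendNext, ForProgram.run_when, Expr.eval_var, if_pos h15]
    exact ⟨hP3, hZ3, hS, .inl ⟨fun v hv => (hS.exists_isNext hv).elim hno, rfl⟩⟩

/-- Each of the `n` rounds appends a vertex unless no big component is left. A path of length `n`
contains all vertices, so then nothing is big either. -/
theorem buildPath_spec (h : Ctx D T k s) (h2 : s.var 2 = 0) (h8 : ∀ v : Fin n, s.arr 8 v = 0) :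
    ∃ P, HasPath P (buildPath.run s) ∧ D.IsSearchPath T P ∧ ∀ v, ¬ D.IsBig T P.toFinset v := by
  have := ForProgram.run_upto (p := extendPath) (x := 11) h.n_eq (by decide)
    (fun i u => ∃ P : List (Fin n), HasPath P u ∧ HasSet 8 P.toFinset u ∧ D.IsSearchPath T P ∧
      (P.length = i ∨ ∀ v, ¬ D.IsBig T P.toFinset v)) ?_ ?_
  · obtain ⟨P, h1, _, h3, h4⟩ := this
    refine ⟨P, h1, h3, ?_⟩
    rcases h4 with h4 | h4
    · intro v hv
      apply hv.notMem
      have : P.toFinset = Finset.univ := by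
        rw [← Finset.card_eq_iff_eq_univ, List.toFinset_card_of_nodup h3.1, h4, Fintype.card_fin]
      rw [this]
      exact Finset.mem_univ v
    · exact h4
  · exact ⟨[], ⟨by simpa using h2, by simp⟩, fun v => by simpa using h8 v, isSearchPath_nil,
      .inl rfl⟩
  · rintro i u hi ⟨P, h1, h3, h4, h5⟩ hx hag
    obtain ⟨P', h6, h7, h8, h9⟩ :=
      extendPath_spec (h.agree hag (by decide) (by decide)) h1 h3 h4
    refine ⟨P', h6.agree (vs := [11]) (as := []) ⟨fun z hz => ?_, fun _ _ => rfl⟩ (by decide)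
      (by decide), h7, h8, ?_⟩
    · rw [State.setVar_var, if_neg (by simpa using hz)]
    · rcases h9 with ⟨h9, rfl⟩ | ⟨⟨v, hv⟩, h9⟩
      · exact .inr h9
      · rcases h5 with h5 | h5
        · exact .inl (by omega)
        · exact absurd hv (h5 v)

end Ram

/-! ### Enumeration of the subsets of T -/

namespace Ram

open MultiDigraph

variable {n : ℕ} {D : MultiDigraph (Fin n)} {T : Finset (Fin n)} {k : ℕ} {s u : State}

/-- Arrays `6` and `7` hold the halves and the parities of the numbers below `2 ^ |T|`. -/
def HasHalves (T : Finset (Fin n)) (s : State) : Prop :=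
  ∀ m < 2 ^ T.card, s.arr 6 m = m / 2 ∧ s.arr 7 m = m % 2

theorem HasHalves.agree (h : HasHalves T s) {vs as : List ℕ} (hu : Agree vs as s u)
    (ha : 6 ∉ as) (ha' : 7 ∉ as) : HasHalves T u := by
  intro m hm
  rw [hu.arr 6 ha, hu.arr 7 ha']
  exact h m hm

theorem halfTable_spec (h : Ctx D T k s) (h9 : s.var 9 = 0) (h10 : s.var 10 = 0) :
    HasHalves T (halfTable.run s) := by
  have := ForProgram.run_upto (p := halfCell) (x := 7) h.pow_eq (by decide)
    (fun i u => u.var 9 = i / 2 ∧ u.var 10 = i % 2 ∧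
      ∀ m < i, u.arr 6 m = m / 2 ∧ u.arr 7 m = m % 2) (by simp [h9, h10]) ?_
  · exact this.2.2
  · rintro i u hi ⟨h1, h2, h3⟩ hx hag
    have harr : (halfCell.run u).arr 6 = Function.update (u.arr 6) i (i / 2) ∧
        (halfCell.run u).arr 7 = Function.update (u.arr 7) i (i % 2) := by
      simp only [halfCell, ForProgram.run_block_cons, ForProgram.run_block_nil,
        ForProgram.run_store, ForProgram.run_cond]
      split_ifs <;> simp [State.setArr_arr, hx, h1, h2]
    have hvar : (halfCell.run u).var 9 = (i + 1) / 2 ∧ (halfCell.run u).var 10 = (i + 1) % 2 := by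
      rcases Nat.mod_two_eq_zero_or_one i with h0 | h0
      · have : (i + 1) / 2 = i / 2 ∧ (i + 1) % 2 = 1 := by omega
        simp [halfCell, h1, h2, h0, this]
      · have : (i + 1) / 2 = i / 2 + 1 ∧ (i + 1) % 2 = 0 := by omega
        simp [halfCell, h1, h2, h0, this]
    refine ⟨by simpa using hvar.1, by simpa using hvar.2, fun m hm => ?_⟩
    rw [State.setVar_arr, harr.1, harr.2]
    by_cases hmi : m = i
    · subst hmi
      simp
    · rw [Function.update_of_ne hmi, Function.update_of_ne hmi]
      exact h3 m (by omega)

/-- The number of elements of `T` below `v`. -/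
def rank (T : Finset (Fin n)) (i : ℕ) : ℕ := (T.filter fun v : Fin n => (v : ℕ) < i).card

/-- The subset of `T` with code `m`. -/
def decodeSet (T : Finset (Fin n)) (m : ℕ) : Finset (Fin n) :=
  T.filter fun v => m / 2 ^ rank T v % 2 = 1

/-- When the scan reaches `v`, variable `21` is the code shifted by the rank of `v` in `T`, so its
parity is the bit of `v`. -/
theorem decode_spec (h : Ctx D T k s) (hh : HasHalves T s) {m : ℕ} (hm : m < 2 ^ T.card)
    (h20 : s.var 20 = m) :
    HasSet 11 (decodeSet T m) (decode.run s) ∧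
      (decode.run s).var 22 = (decodeSet T m).card := by
  set s1 := (s.setVar 21 (s.var 20)).setVar 22 0 with hs1
  have hag1 : Agree [21, 22] [] s s1 :=
    ForProgram.run_agree (.seq (.assign 21 (.var 20)) (.assign 22 (.lit 0))) s
  have h1 := h.agree hag1 (by decide) (by decide)
  have := ForProgram.run_upto (p := decodeCell) (x := 23) h1.n_eq (by decide)
    (fun i u => u.var 21 = m / 2 ^ rank T i ∧
      u.var 22 = ((decodeSet T m).filter fun v : Fin n => (v : ℕ) < i).card ∧
      ∀ v : Fin n, (v : ℕ) < i → u.arr 11 v = if v ∈ decodeSet T m then 1 else 0) ?_ ?_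
  · refine ⟨fun v => this.2.2 v v.2, ?_⟩
    have := this.2.1
    rw [card_filter_lt_self] at this
    exact this
  · simp [hs1, h20, rank]
  · rintro i u hi ⟨h2, h3, h4⟩ hx hag
    have hc := h1.agree hag (by decide) (by decide)
    have hh1 := (hh.agree hag1 (by decide) (by decide)).agree hag (by decide) (by decide)
    obtain ⟨a, rfl⟩ : ∃ a : Fin n, (a : ℕ) = i := ⟨⟨i, hi⟩, rfl⟩
    have h5 := hc.mem_eq a
    have h6 := hh1 (m / 2 ^ rank T a) (lt_of_le_of_lt (Nat.div_le_self _ _) hm)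
    have hr : rank T (a + 1) = rank T a + if a ∈ T then 1 else 0 := card_filter_lt_succ T a
    have hd : a ∈ decodeSet T m ↔ a ∈ T ∧ m / 2 ^ rank T a % 2 = 1 := Finset.mem_filter
    have hne : ∀ v : Fin n, (v : ℕ) < a + 1 → v ≠ a → (v : ℕ) < a ∧ (v : ℕ) ≠ a := by
      intro v hv hva
      have : (v : ℕ) ≠ a := fun h => hva (Fin.ext h)
      omega
    rw [card_filter_lt_succ, hr]
    by_cases hT : a ∈ T
    · have hbit : (if a ∈ decodeSet T m then 1 else 0) = m / 2 ^ rank T a % 2 := by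
        split_ifs with h7
        · exact (hd.1 h7).2.symm
        · exact ((Nat.mod_two_eq_zero_or_one _).resolve_right fun h => h7 (hd.2 ⟨hT, h⟩)).symm
      refine ⟨?_, ?_, fun v hv => ?_⟩
      · simp [decodeCell, hx, h5, hT, h2, h6.1, Nat.div_div_eq_div_mul, pow_succ]
      · simp [decodeCell, hx, h5, hT, h2, h6.2, h3, hbit]
      · by_cases hva : v = a
        · subst hva
          simp [decodeCell, hx, h5, hT, h2, h6.2, hbit]
        · have := hne v hv hva
          simp [decodeCell, hx, h5, hT, this.2, h4 v this.1]
    · have hnd : a ∉ decodeSet T m := fun h => hT (hd.1 h).1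
      refine ⟨?_, ?_, fun v hv => ?_⟩
      · simp [decodeCell, hx, h5, hT, h2]
      · simp [decodeCell, hx, h5, hT, h3, hnd]
      · by_cases hva : v = a
        · subst hva
          simp [decodeCell, hx, h5, hT, hnd]
        · have := hne v hv hva
          simp [decodeCell, hx, h5, hT, this.2, h4 v this.1]

/-- `rank` is injective on `T` with values below `T.card`, so the bits of the code can be prescribed
freely. -/
theorem exists_decodeSet_eq {T' : Finset (Fin n)} (h : T' ⊆ T) :
    ∃ m < 2 ^ T.card, decodeSet T m = T' := by
  classical
  have hlt : ∀ v ∈ T, ∀ w ∈ T, v < w → rank T v < rank T w := by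
    intro v hv w _ hvw
    apply Finset.card_lt_card
    rw [Finset.ssubset_iff_of_subset]
    · exact ⟨v, by simpa using ⟨hv, hvw⟩, by simp⟩
    · intro x hx
      simp only [Finset.mem_filter] at hx ⊢
      exact ⟨hx.1, lt_trans hx.2 hvw⟩
  have hinj : ∀ v ∈ T, ∀ w ∈ T, rank T v = rank T w → v = w := by
    intro v hv w hw he
    rcases lt_trichotomy v w with h | h | h
    · have := hlt v hv w hw h
      omega
    · exact h
    · have := hlt w hw v hv h
      omega
  have hcard : ∀ v ∈ T, rank T v < T.card := by
    intro v hv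
    apply Finset.card_lt_card
    rw [Finset.ssubset_iff_of_subset (Finset.filter_subset _ _)]
    exact ⟨v, hv, by simp⟩
  let f : Fin T.card → Bool := fun j => decide (∃ v ∈ T', rank T v = j)
  refine ⟨Nat.ofBits f, Nat.ofBits_lt_two_pow f, ?_⟩
  ext v
  rw [decodeSet, Finset.mem_filter]
  have key : v ∈ T → (Nat.ofBits f / 2 ^ rank T v % 2 = 1 ↔ v ∈ T') := by
    intro hv
    have h1 := Nat.testBit_ofBits_lt f (rank T v) (hcard v hv)
    rw [Nat.testBit_eq_decide_div_mod_eq] at h1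
    simp only [f, decide_eq_decide] at h1
    rw [h1]
    constructor
    · rintro ⟨w, hw, he⟩
      exact hinj w (h hw) v hv he ▸ hw
    · intro hv'
      exact ⟨v, hv', rfl⟩
  constructor
  · rintro ⟨h1, h2⟩
    exact (key h1).1 h2
  · intro hv
    exact ⟨h hv, (key (h hv)).2 hv⟩

/-! ### Correctness of a single bid -/

section Auction

variable {X Y : Finset (Fin n)} {x y : ℕ}

theorem findCheapest_spec (h : Ctx D T k s) (hX : HasSet x X s) {v : Fin n}
    (hv : s.var 25 = v) :
    ((findCheapest x).run s).var 26 = 0 ∧ (∀ w, ¬ D.Link X v w) ∨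
      ∃ w : Fin n, ((findCheapest x).run s).var 26 = w + 1 ∧ D.Link X v w ∧
        ∀ w', D.Link X v w' → s.arr 14 w ≤ s.arr 14 w' := by
  set s1 := s.setVar 26 0 with hs1
  have hag1 : Agree [26] [] s s1 := ForProgram.run_agree (.assign 26 (.lit 0)) s
  have h1 := h.agree hag1 (by decide) (by decide)
  have := ForProgram.run_upto (p := compareCell x) (x := 27) h1.n_eq
    (show 27 ∉ [26, 26] by decide)
    (fun i u => u.var 26 = 0 ∧ (∀ w : Fin n, (w : ℕ) < i → ¬ D.Link X v w) ∨
      ∃ w : Fin n, u.var 26 = w + 1 ∧ D.Link X v w ∧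
        ∀ w' : Fin n, (w' : ℕ) < i → D.Link X v w' → s.arr 14 w ≤ s.arr 14 w') ?_ ?_
  · refine this.imp (fun h => ⟨h.1, fun w => h.2 w w.2⟩) ?_
    rintro ⟨w, h1, h2, h3⟩
    exact ⟨w, h1, h2, fun w' => h3 w' w'.2⟩
  · exact .inl ⟨by simp [hs1], by simp⟩
  · intro i u hi hI hx hag
    replace hag : Agree [27, 26, 26] [] s1 u := hag
    have hc := h1.agree hag (by decide) (by decide)
    have hXu := (hX.agree hag1 (by simp)).agree hag (by simp)
    have hv' : u.var 25 = v := by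
      rw [hag.var 25 (by decide), hag1.var 25 (by decide), hv]
    have h14 : u.arr 14 = s.arr 14 := by
      rw [hag.arr 14 (by decide), hag1.arr 14 (by decide)]
    obtain ⟨a, rfl⟩ : ∃ a : Fin n, (a : ℕ) = i := ⟨⟨i, hi⟩, rfl⟩
    have hrun : (compareCell x).run u = if (if u.arr x a = 0 then 1 else 0) = 0 then u else
        if D.mult v a + (if (v : ℕ) = a then 1 else 0) = 0 then u else
          if u.var 26 = 0 then u.setVar 26 (a + 1) else
            if s.arr 14 (u.var 26 - 1) - s.arr 14 a = 0 then u else u.setVar 26 (a + 1) := by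
      simp only [compareCell, ForProgram.run_when, ForProgram.run_cond, Expr.eval_get,
        Expr.eval_entry, Expr.eval_var, hx, hv', hc.row_eq, Expr.eval_plus, Expr.eval_not,
        Expr.eval_eq, Expr.eval_minus, Expr.eval_pred, ForProgram.run_assign, Expr.eval_succ,
        hc.mult_eq, h14]
    have hlink : D.Link X v a ↔ ¬ ((if u.arr x a = 0 then 1 else 0) = 0) ∧
        ¬ (D.mult v a + (if (v : ℕ) = a then 1 else 0) = 0) := by
      have h5 : D.Adj v a ↔ D.mult v a ≠ 0 := Nat.pos_iff_ne_zero
      rw [hXu a, MultiDigraph.Link, h5, Fin.ext_iff]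
      by_cases h6 : a ∈ X <;> by_cases h7 : D.mult v a = 0 <;>
        by_cases h8 : (v : ℕ) = a <;> simp [h6, h7, h8]
    have hstep : ∀ w : Fin n, (w : ℕ) < a + 1 → (w : ℕ) < a ∨ w = a := by
      intro w hw
      by_cases hwa : w = a
      · exact .inr hwa
      · have : (w : ℕ) ≠ a := fun h => hwa (Fin.ext h)
        exact .inl (by omega)
    have hskip : ¬ D.Link X v a → (compareCell x).run u = u := by
      intro hl
      rw [hlink, not_and_or, not_not, not_not] at hl
      rw [hrun]
      split_ifs <;> simp_all
    simp only [State.setVar_var, Nat.reduceEqDiff, if_false]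
    by_cases hl : D.Link X v a
    · have hl' := hlink.1 hl
      rw [hrun, if_neg hl'.1, if_neg hl'.2]
      right
      rcases hI with ⟨h2, h3⟩ | ⟨w, h2, h3, h4⟩
      · rw [if_pos h2]
        refine ⟨a, by simp, hl, fun w' hw' hlw' => ?_⟩
        rcases hstep w' hw' with hw' | rfl
        · exact absurd hlw' (h3 w' hw')
        · exact le_rfl
      · rw [if_neg (by omega), h2, Nat.add_sub_cancel]
        split_ifs with h5
        · refine ⟨w, h2, h3, fun w' hw' hlw' => ?_⟩
          rcases hstep w' hw' with hw' | rfl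
          · exact h4 w' hw' hlw'
          · omega
        · refine ⟨a, by simp, hl, fun w' hw' hlw' => ?_⟩
          rcases hstep w' hw' with hw' | rfl
          · have := h4 w' hw' hlw'
            omega
          · exact le_rfl
    · rw [hskip hl]
      refine hI.imp (fun h => ⟨h.1, fun w hw => ?_⟩) ?_
      · rcases hstep w hw with hw | rfl
        · exact h.2 w hw
        · exact hl
      · rintro ⟨w, h2, h3, h4⟩
        refine ⟨w, h2, h3, fun w' hw' hlw' => ?_⟩
        rcases hstep w' hw' with hw' | rfl
        · exact h4 w' hw' hlw'
        · exact absurd hlw' hl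

/-- Arrays `13`, `14` and `15` hold the state of an auction. -/
def HasAuction (D : MultiDigraph (Fin n)) (X Y : Finset (Fin n)) (s : State) : Prop :=
  D.IsAuction X Y (s.arr 13) (s.arr 14) (s.arr 15)

/-- In the auction in the memory, `v` has not bought anything and can afford `w`. -/
def Bid (D : MultiDigraph (Fin n)) (X Y : Finset (Fin n)) (s : State) (v w : Fin n) : Prop :=
  D.CanBid X Y (s.arr 14) (s.arr 15) v w

/-- The sum of the prices. -/
def total (n : ℕ) (s : State) : ℕ := ∑ w : Fin n, s.arr 14 w

/-- The memories `s` and `u` hold the same auction. -/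
def SameAuction (s u : State) : Prop :=
  u.arr 13 = s.arr 13 ∧ u.arr 14 = s.arr 14 ∧ u.arr 15 = s.arr 15

theorem buy_spec (hn : s.var 0 = n) (hA : HasAuction D X Y s) {v : Fin n} (hv : s.var 25 = v)
    (hvY : v ∉ Y) (hv0 : s.arr 15 v = 0)
    (h : s.var 26 = 0 ∧ (∀ w, ¬ D.Link X v w) ∨
      ∃ w : Fin n, s.var 26 = w + 1 ∧ D.Link X v w ∧
        ∀ w', D.Link X v w' → s.arr 14 w ≤ s.arr 14 w') :
    HasAuction D X Y (buy.run s) ∧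
      ((∃ w, Bid D X Y s v w) ∧ total n (buy.run s) = total n s + 1 ∨
        (∀ w, ¬ Bid D X Y s v w) ∧ buy.run s = s) := by
  rcases h with ⟨h1, h2⟩ | ⟨w, h1, h2, h3⟩
  · have hrun : buy.run s = s := by
      rw [buy, ForProgram.run_when, Expr.eval_var, if_pos h1]
    rw [hrun]
    exact ⟨hA, .inr ⟨fun w hw => h2 w hw.2.2.1, rfl⟩⟩
  · by_cases h4 : s.arr 14 w ≤ n
    · have h13 : (buy.run s).arr 13 = Function.update (s.arr 13) w (v + 1) := by
        have : ¬ (n + 1 - s.arr 14 w = 0) := by omega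
        simp only [buy, ForProgram.run_when, Expr.eval_var, h1, Nat.add_eq_zero_iff, one_ne_zero,
          and_false, if_false, Expr.eval_minus, Expr.eval_succ, hn, Expr.eval_get, Expr.eval_pred,
          Nat.add_sub_cancel, this, ForProgram.run_block_cons, ForProgram.run_block_nil,
          ForProgram.run_store]
        split_ifs <;> simp [State.setArr_arr, h1, hv]
      have h14 : (buy.run s).arr 14 = Function.update (s.arr 14) w (s.arr 14 w + 1) := by
        have : ¬ (n + 1 - s.arr 14 w = 0) := by omega
        simp only [buy, ForProgram.run_when, Expr.eval_var, h1, Nat.add_eq_zero_iff, one_ne_zero,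
          and_false, if_false, Expr.eval_minus, Expr.eval_succ, hn, Expr.eval_get, Expr.eval_pred,
          Nat.add_sub_cancel, this, ForProgram.run_block_cons, ForProgram.run_block_nil,
          ForProgram.run_store]
        split_ifs <;> simp [State.setArr_arr, h1]
      have h15 : ∀ u : Fin n, (buy.run s).arr 15 u = if u = v then 1 else
          if s.arr 13 w = u + 1 then 0 else s.arr 15 u := by
        intro u
        have : ¬ (n + 1 - s.arr 14 w = 0) := by omega
        simp only [buy, ForProgram.run_when, Expr.eval_var, h1, Nat.add_eq_zero_iff, one_ne_zero,
          and_false, if_false, Expr.eval_minus, Expr.eval_succ, hn, Expr.eval_get, Expr.eval_pred,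
          Nat.add_sub_cancel, this, ForProgram.run_block_cons, ForProgram.run_block_nil,
          ForProgram.run_store, Fin.ext_iff]
        by_cases h0 : s.arr 13 w = 0
        · have h6 : ¬ (s.arr 13 w = u + 1) := by omega
          simp [h0, hv]
        · have h6 : (u : ℕ) = s.arr 13 w - 1 ↔ s.arr 13 w = u + 1 := by omega
          simp [h0, hv, h1, h6]
      have hbid : Bid D X Y s v w := ⟨hvY, hv0, h2, h4⟩
      refine ⟨?_, .inl ⟨⟨w, hbid⟩, ?_⟩⟩
      · unfold HasAuction
        rw [h13, h14]
        exact IsAuction.bid hA hbid h3 h15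
      · unfold total
        rw [h14]
        exact sum_update_succ w
    · have hrun : buy.run s = s := by
        have : n + 1 - s.arr 14 w = 0 := by omega
        simp [buy, h1, hn, this]
      rw [hrun]
      -- If a cheapest choice is unaffordable, all choices are.
      refine ⟨hA, .inr ⟨fun w' hw' => h4 ((h3 w' hw'.2.2.1).trans hw'.2.2.2), rfl⟩⟩

theorem bidCell_spec (h : Ctx D T k s) (hX : HasSet x X s) (hY : HasSet y Y s)
    (hA : HasAuction D X Y s) {v : Fin n} (hv : s.var 25 = v) :
    HasAuction D X Y ((bidCell x y).run s) ∧
      ((∃ w, Bid D X Y s v w) ∧ total n ((bidCell x y).run s) = total n s + 1 ∨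
        (∀ w, ¬ Bid D X Y s v w) ∧ SameAuction s ((bidCell x y).run s)) := by
  have hag : Agree [26, 27, 26, 26] [] s ((findCheapest x).run s) :=
    ForProgram.run_agree (findCheapest x) s
  have hrun : (bidCell x y).run s = if (if s.arr y v + s.arr 15 v = 0 then 1 else 0) = 0 then s
      else buy.run ((findCheapest x).run s) := by
    simp only [bidCell, ForProgram.run_when, Expr.eval_not, Expr.eval_plus, Expr.eval_get,
      Expr.eval_var, hv, ForProgram.run_seq]
  have hYv := hY v
  by_cases h0 : v ∉ Y ∧ s.arr 15 v = 0
  · rw [hrun, if_neg (by simp [hYv, h0])]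
    have hf := findCheapest_spec h hX hv
    have h13 := hag.arr 13 (by decide)
    have h14 := hag.arr 14 (by decide)
    have h15 := hag.arr 15 (by decide)
    have hv' := hag.var 25 (by decide)
    have hn' := (hag.var 0 (by decide)).trans h.n_eq
    generalize (findCheapest x).run s = u at *
    have := buy_spec (s := u) (D := D) (X := X) (Y := Y) (v := v) hn'
      (by unfold HasAuction; rw [h13, h14, h15]; exact hA) (by rw [hv', hv]) h0.1
      (by rw [h15]; exact h0.2) (by rw [h14]; exact hf)
    have hb : ∀ w, Bid D X Y u v w ↔ Bid D X Y s v w := fun w => by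
      unfold Bid
      rw [h14, h15]
    have ht : total n u = total n s := by
      unfold total
      rw [h14]
    simp only [hb, ht] at this
    refine ⟨this.1, this.2.imp id fun h => ⟨h.1, ?_⟩⟩
    rw [h.2]
    exact ⟨h13, h14, h15⟩
  · have : (bidCell x y).run s = s := by
      rw [hrun, if_pos]
      rw [hYv]
      by_cases h1 : v ∈ Y
      · simp [h1]
      · have : s.arr 15 v ≠ 0 := fun h2 => h0 ⟨h1, h2⟩
        simp [this]
    rw [this]
    exact ⟨hA, .inr ⟨fun w hw => h0 ⟨hw.1, hw.2.1⟩, rfl, rfl, rfl⟩⟩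

end Auction

end Ram

/-! ### Correctness of the auction and of the richness test -/

namespace Ram

open MultiDigraph

variable {n : ℕ} {D : MultiDigraph (Fin n)} {T : Finset (Fin n)} {k : ℕ} {s u : State}

section Auction

variable {X Y : Finset (Fin n)} {x y : ℕ}

/-- The auction stays as in `s` until the first bid, so a bid possible at the start is made unless
an earlier one was; every bid raises the total price. -/
theorem auctionRound_spec (h : Ctx D T k s) (hX : HasSet x X s) (hY : HasSet y Y s)
    (hx : x ∉ [13, 14, 15]) (hy : y ∉ [13, 14, 15]) (hA : HasAuction D X Y s) :
    HasAuction D X Y ((auctionRound x y).run s) ∧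
      ((∃ v w, Bid D X Y s v w) ∧ total n s < total n ((auctionRound x y).run s) ∨
        (∀ v w, ¬ Bid D X Y s v w) ∧ SameAuction s ((auctionRound x y).run s)) := by
  have hvars : (bidCell x y).vars = [26, 27, 26, 26] := rfl
  have harrs : (bidCell x y).arrs = [15, 13, 15, 14] := rfl
  have := ForProgram.run_upto (p := bidCell x y) (x := 25) h.n_eq
    (show 25 ∉ [26, 27, 26, 26] by decide)
    (fun i u => HasAuction D X Y u ∧ ((∃ v w, Bid D X Y s v w) ∧ total n s < total n u ∨
      (∀ v w : Fin n, (v : ℕ) < i → ¬ Bid D X Y s v w) ∧ SameAuction s u))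
    ⟨hA, .inr ⟨by simp, rfl, rfl, rfl⟩⟩ ?_
  · exact ⟨this.1, this.2.imp id fun h => ⟨fun v w => h.1 v w v.2, h.2⟩⟩
  · rintro i u hi ⟨hAu, hI⟩ hxi hag
    rw [hvars, harrs] at hag
    have hx' : x ∉ [15, 13, 15, 14] := by simp_all
    have hy' : y ∉ [15, 13, 15, 14] := by simp_all
    obtain ⟨h1, h2⟩ := bidCell_spec (v := ⟨i, hi⟩) (h.agree hag (by decide) (by decide))
      (hX.agree hag hx') (hY.agree hag hy') hAu hxi
    refine ⟨h1, ?_⟩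
    change _ ∧ total n s < total n ((bidCell x y).run u) ∨
      _ ∧ SameAuction s ((bidCell x y).run u)
    rcases hI with ⟨h3, h4⟩ | ⟨h3, h4, h5, h6⟩
    · left
      refine ⟨h3, ?_⟩
      rcases h2 with ⟨_, h2⟩ | ⟨_, _, h2, _⟩
      · omega
      · unfold total at *
        rwa [h2]
    · have hb : ∀ v w : Fin n, Bid D X Y u v w ↔ Bid D X Y s v w := fun v w => by
        unfold Bid
        rw [h5, h6]
      have ht : total n u = total n s := by
        unfold total
        rw [h5]
      rcases h2 with ⟨⟨w, hw⟩, h2⟩ | ⟨h2, h7, h8, h9⟩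
      · exact .inl ⟨⟨_, w, (hb _ _).1 hw⟩, by omega⟩
      · refine .inr ⟨fun v w hv => ?_, h7.trans h4, h8.trans h5, h9.trans h6⟩
        by_cases hvi : (v : ℕ) < i
        · exact h3 v w hvi
        · obtain rfl : v = ⟨i, hi⟩ := Fin.ext (by simp; omega)
          rw [← hb]
          exact h2 w

/-- While bids are possible each round adds at least one to the total price, which is at most
n(n+1); this is less than the number (n+2)² of rounds. -/
theorem auctionLoop_spec (h : Ctx D T k s) (hX : HasSet x X s) (hY : HasSet y Y s)
    (hx : x ∉ [13, 14, 15]) (hy : y ∉ [13, 14, 15]) (hA : HasAuction D X Y s) :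
    HasAuction D X Y ((ForProgram.upto 28 5 (auctionRound x y)).run s) ∧
      ∀ v w, ¬ Bid D X Y ((ForProgram.upto 28 5 (auctionRound x y)).run s) v w := by
  have hvars : (auctionRound x y).vars = [25, 26, 27, 26, 26] := rfl
  have harrs : (auctionRound x y).arrs = [15, 13, 15, 14] := rfl
  have := ForProgram.run_upto (p := auctionRound x y) (x := 28) h.rounds_eq
    (show 28 ∉ [25, 26, 27, 26, 26] by decide)
    (fun i u => HasAuction D X Y u ∧ (i ≤ total n u ∨ ∀ v w, ¬ Bid D X Y u v w))
    ⟨hA, .inl (Nat.zero_le _)⟩ ?_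
  · refine ⟨this.1, this.2.resolve_left fun hle => ?_⟩
    have h1 : total n _ ≤ n * (n + 1) := IsAuction.sum_price_le this.1
    have h2 : n * (n + 1) < (n + 2) * (n + 2) := by nlinarith
    omega
  · rintro i u hi ⟨hAu, hI⟩ _ hag
    rw [hvars, harrs] at hag
    have hx' : x ∉ [15, 13, 15, 14] := by simp_all
    have hy' : y ∉ [15, 13, 15, 14] := by simp_all
    obtain ⟨h1, h2⟩ := auctionRound_spec (h.agree hag (by decide) (by decide))
      (hX.agree hag hx') (hY.agree hag hy') hx hy hAu
    refine ⟨h1, ?_⟩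
    change i + 1 ≤ total n ((auctionRound x y).run u) ∨
      ∀ v w, ¬ Bid D X Y ((auctionRound x y).run u) v w
    rcases h2 with ⟨⟨v, w, hvw⟩, h2⟩ | ⟨h2, _, h3, h4⟩
    · rcases hI with hI | hI
      · exact .inl (by omega)
      · exact absurd hvw (hI v w)
    · right
      unfold Bid
      rw [h3, h4]
      exact h2

theorem resetAuction_spec (h : Ctx D T k s) : HasAuction D X Y (resetAuction.run s) := by
  have := ForProgram.run_upto (p := resetCell) (x := 24) h.n_eq (by decide)
    (fun i u => ∀ v : Fin n, (v : ℕ) < i → u.arr 13 v = 0 ∧ u.arr 14 v = 0 ∧ u.arr 15 v = 0)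
    (by simp) ?_
  · exact isAuction_zero.congr (fun v => (this v v.2).1) (fun v => (this v v.2).2.1)
      fun v => (this v v.2).2.2
  · intro i u hi hI hx hag v hv
    by_cases hvi : (v : ℕ) = i
    · simp [resetCell, hx, hvi]
    · have := hI v (by omega)
      simp [resetCell, hx, hvi, this]

theorem evaluate_spec (h : Ctx D T k s) (hX : HasSet x X s) (hY : HasSet y Y s) :
    ((evaluate x y).run s).var 19 =
      if k + 2 * (unsold Y (s.arr 15)).card < 2 * X.card then s.var 19 else 0 := by
  set s1 := (s.setVar 29 0).setVar 30 0 with hs1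
  have hag1 : Agree [29, 30] [] s s1 :=
    ForProgram.run_agree (.seq (.assign 29 (.lit 0)) (.assign 30 (.lit 0))) s
  have h1 := h.agree hag1 (by decide) (by decide)
  have hag2 : Agree [24, 29, 30] [] s1 ((ForProgram.upto 24 0 (evaluateCell x y)).run s1) :=
    ForProgram.run_agree (.upto 24 0 (evaluateCell x y)) s1
  have h2 := h1.agree hag2 (by decide) (by decide)
  have := ForProgram.run_upto (p := evaluateCell x y) (x := 24) h1.n_eq
    (show 24 ∉ [29, 30] by decide)
    (fun i u =>
      u.var 29 = ((unsold Y (s.arr 15)).filter fun v : Fin n => (v : ℕ) < i).card ∧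
      u.var 30 = (X.filter fun v : Fin n => (v : ℕ) < i).card)
    (by simp [hs1]) ?_
  · rw [card_filter_lt_self, card_filter_lt_self] at this
    have hrun : (evaluate x y).run s = ForProgram.run (when (.minus (.succ (.plus (.var 1)
        (.plus (.var 29) (.var 29)))) (.plus (.var 30) (.var 30))) (.assign 19 (.lit 0)))
        ((ForProgram.upto 24 0 (evaluateCell x y)).run s1) := rfl
    have h19 := (hag2.var 19 (by decide)).trans (hag1.var 19 (by decide))
    rw [hrun]
    generalize (ForProgram.upto 24 0 (evaluateCell x y)).run s1 = u at *
    simp only [ForProgram.run_when, Expr.eval_minus, Expr.eval_succ, Expr.eval_plus,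
      Expr.eval_var, this.1, this.2, h2.k_eq, ForProgram.run_assign, Expr.eval_lit]
    split_ifs with h3 h4 h4
    · exact h19
    · omega
    · omega
    · simp
  · rintro i u hi ⟨h3, h4⟩ hx hag
    replace hag : Agree [24, 29, 30] [] s1 u := hag
    obtain ⟨a, rfl⟩ : ∃ a : Fin n, (a : ℕ) = i := ⟨⟨i, hi⟩, rfl⟩
    have hXa : u.arr x a = if a ∈ X then 1 else 0 := by
      rw [hag.arr x (by simp), hag1.arr x (by simp)]
      exact hX a
    have hYa : u.arr y a = if a ∈ Y then 1 else 0 := by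
      rw [hag.arr y (by simp), hag1.arr y (by simp)]
      exact hY a
    have h15 : u.arr 15 a = s.arr 15 a := by
      rw [hag.arr 15 (by simp), hag1.arr 15 (by simp)]
    have hm : a ∈ unsold Y (s.arr 15) ↔ a ∉ Y ∧ s.arr 15 a = 0 := by simp [unsold]
    rw [card_filter_lt_succ, card_filter_lt_succ, ← h3, ← h4]
    by_cases h5 : a ∈ Y <;> by_cases h6 : s.arr 15 a = 0 <;>
      simp [evaluateCell, hx, hXa, hYa, h15, hm, h5, h6]

/-- No set of at most `k / 2` vertices separates `Y` from `X`. -/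
def WellConnected (D : MultiDigraph (Fin n)) (k : ℕ) (X Y : Finset (Fin n)) : Prop :=
  ∀ S, D.Separates S X Y → k < 2 * S.card

/-- The minimum separator has exactly |X| minus the number of unsatisfied bidders elements:
`exists_separates` attains this value and `card_le` bounds it from below. -/
theorem auction_spec (h : Ctx D T k s) (hX : HasSet x X s) (hY : HasSet y Y s)
    (hx : x ∉ [13, 14, 15]) (hy : y ∉ [13, 14, 15]) :
    WellConnected D k X Y ∧ ((auction x y).run s).var 19 = s.var 19 ∨
      ¬ WellConnected D k X Y ∧ ((auction x y).run s).var 19 = 0 := by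
  have hag1 : Agree [24] [13, 14, 15] s (resetAuction.run s) :=
    ForProgram.run_agree resetAuction s
  have h1 := h.agree hag1 (by decide) (by decide)
  have hX1 := hX.agree hag1 hx
  have hY1 := hY.agree hag1 hy
  have hA1 : HasAuction D X Y (resetAuction.run s) := resetAuction_spec h
  have h191 : (resetAuction.run s).var 19 = s.var 19 := hag1.var 19 (by decide)
  have hrun : (auction x y).run s = (evaluate x y).run
      ((ForProgram.upto 28 5 (auctionRound x y)).run (resetAuction.run s)) := rfl
  rw [hrun]
  generalize resetAuction.run s = s1 at *
  have hag2 : Agree [28, 25, 26, 27, 26, 26] [15, 13, 15, 14] s1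
      ((ForProgram.upto 28 5 (auctionRound x y)).run s1) :=
    ForProgram.run_agree (.upto 28 5 (auctionRound x y)) s1
  have hx' : x ∉ [15, 13, 15, 14] := by simp_all
  have hy' : y ∉ [15, 13, 15, 14] := by simp_all
  obtain ⟨hA2, hterm⟩ := auctionLoop_spec h1 hX1 hY1 hx hy hA1
  have h2 := evaluate_spec (h1.agree hag2 (by decide) (by decide)) (hX1.agree hag2 hx')
    (hY1.agree hag2 hy')
  rw [hag2.var 19 (by decide), h191] at h2
  rw [h2]
  generalize (ForProgram.upto 28 5 (auctionRound x y)).run s1 = s2 at *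
  obtain ⟨S, hS, hSc⟩ := hA2.exists_separates hterm
  split_ifs with h3
  · refine .inl ⟨fun S' hS' => ?_, rfl⟩
    have := hA2.card_le hS'
    omega
  · refine .inr ⟨fun hw => ?_, rfl⟩
    have := hw S hS
    omega

end Auction

/-- `T'` does not witness that `Q` is not rich. -/
def IsRichFor (D : MultiDigraph (Fin n)) (T : Finset (Fin n)) (k : ℕ) (Q T' : Finset (Fin n)) :
    Prop :=
  T.card < 2 * T'.card → WellConnected D k Q T' ∧ WellConnected D k T' Q

theorem isRich_iff {Q : Finset (Fin n)} :
    D.IsRich T k Q ↔ ∀ m < 2 ^ T.card, IsRichFor D T k Q (decodeSet T m) := by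
  constructor
  · intro h m _ hc
    have hs : decodeSet T m ⊆ T := Finset.filter_subset _ _
    exact ⟨fun S hS => h _ hs hc S (.inl hS), fun S hS => h _ hs hc S (.inr hS)⟩
  · intro h T' hT' hc S hS
    obtain ⟨m, hm, rfl⟩ := exists_decodeSet_eq hT'
    have := h m hm hc
    exact hS.elim (this.1 S) (this.2 S)

theorem testCode_spec (h : Ctx D T k s) (hh : HasHalves T s) {Q : Finset (Fin n)}
    (hQ : HasSet 12 Q s) {m : ℕ} (hm : m < 2 ^ T.card) (h20 : s.var 20 = m) :
    IsRichFor D T k Q (decodeSet T m) ∧ (testCode.run s).var 19 = s.var 19 ∨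
      ¬ IsRichFor D T k Q (decodeSet T m) ∧ (testCode.run s).var 19 = 0 := by
  have hag1 := ForProgram.run_agree decode s
  have h1 := h.agree hag1 (by decide) (by decide)
  have hQ1 := hQ.agree hag1 (by decide)
  have h191 : (decode.run s).var 19 = s.var 19 := hag1.var 19 (by decide)
  obtain ⟨hd, h22⟩ := decode_spec h hh hm h20
  simp only [testCode, ForProgram.run_seq, ForProgram.run_when, Expr.eval_minus, Expr.eval_plus,
    Expr.eval_var, h22, h1.card_eq]
  generalize decode.run s = s1 at *
  split_ifs with hc
  · exact .inl ⟨fun hc' => by omega, h191⟩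
  · have hag2 := ForProgram.run_agree (auction 12 11) s1
    have h2 := auction_spec h1 hQ1 hd (by decide) (by decide)
    have h3 := auction_spec (h1.agree hag2 (by decide) (by decide))
      (hd.agree hag2 (by decide)) (hQ1.agree hag2 (by decide)) (by decide) (by decide)
    have hc' : T.card < 2 * (decodeSet T m).card := by omega
    rcases h3 with ⟨h3, h4⟩ | ⟨h3, h4⟩
    · rw [h4]
      rcases h2 with ⟨h2, h5⟩ | ⟨h2, h5⟩
      · exact .inl ⟨fun _ => ⟨h2, h3⟩, h5.trans h191⟩
      · exact .inr ⟨fun hr => h2 (hr hc').1, h5⟩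
    · exact .inr ⟨fun hr => h3 (hr hc').2, h4⟩

theorem testRich_spec (h : Ctx D T k s) (hh : HasHalves T s) {Q : Finset (Fin n)}
    (hQ : HasSet 12 Q s) :
    D.IsRich T k Q ∧ (testRich.run s).var 19 = 1 ∨
      ¬ D.IsRich T k Q ∧ (testRich.run s).var 19 = 0 := by
  set s1 := s.setVar 19 1 with hs1
  have hag1 : Agree [19] [] s s1 := ForProgram.run_agree (.assign 19 (.lit 1)) s
  have h1 := h.agree hag1 (by decide) (by decide)
  have := ForProgram.run_upto (p := testCode) (x := 20) h1.pow_eq (by decide)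
    (fun i u => (∀ m < i, IsRichFor D T k Q (decodeSet T m)) ∧ u.var 19 = 1 ∨
      ¬ D.IsRich T k Q ∧ u.var 19 = 0) (.inl ⟨by simp, by simp [hs1]⟩) ?_
  · rw [← isRich_iff] at this
    exact this
  · intro i u hi hI hx hag
    have h2 := testCode_spec (h1.agree hag (by decide) (by decide))
      ((hh.agree hag1 (by decide) (by decide)).agree hag (by decide) (by decide))
      ((hQ.agree hag1 (by decide)).agree hag (by decide)) hi hx
    simp only [State.setVar_var, Nat.reduceEqDiff, if_false]
    rcases h2 with ⟨h2, h3⟩ | ⟨h2, h3⟩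
    · rw [h3]
      refine hI.imp (fun h4 => ⟨fun m hm => ?_, h4.2⟩) id
      by_cases hmi : m = i
      · exact hmi ▸ h2
      · exact h4.1 m (by omega)
    · exact .inr ⟨fun hr => h2 (isRich_iff.1 hr i hi), h3⟩

/-! ### Correctness of the cutting -/

/-- The state of the segmentation of `P` after `m` vertices, with cuts at `c 1, …, c j`. -/
structure CutState (D : MultiDigraph (Fin n)) (T : Finset (Fin n)) (k : ℕ) (P : List (Fin n))
    (m : ℕ) (c : ℕ → ℕ) (j : ℕ) (s : State) : Prop where
  le : j ≤ k
  cutting : D.IsCutting T k P m c j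
  count_eq : s.var 31 = j
  rest : HasSet 12 (segment P (c j) m) s
  ends : ∃ A : Finset (Fin n), HasSet 4 A s ∧ ∀ v, v ∈ A ↔ ∃ i < j, P[c (i + 1) - 1]? = some v

theorem segment_succ {P : List (Fin n)} {a m : ℕ} (ha : a ≤ m) (hm : m < P.length) :
    segment P a (m + 1) = insert P[m] (segment P a m) := by
  ext v
  rw [Finset.mem_insert, mem_segment, mem_segment]
  constructor
  · rintro ⟨i, h1, h2, h3⟩
    by_cases him : i = m
    · subst him
      rw [List.getElem?_eq_getElem hm, Option.some.injEq] at h3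
      exact .inl h3.symm
    · exact .inr ⟨i, h1, by omega, h3⟩
  · rintro (rfl | ⟨i, h1, h2, h3⟩)
    · exact ⟨m, ha, by omega, List.getElem?_eq_getElem hm⟩
    · exact ⟨i, h1, by omega, h3⟩

theorem HasSet.insert {a : ℕ} {S : Finset (Fin n)} (h : HasSet a S s) (v : Fin n) :
    HasSet a (insert v S) (s.setArr a v 1) := by
  intro w
  rw [State.setArr_arr_apply, if_pos rfl, h w]
  by_cases hwv : w = v
  · simp [hwv]
  · simp [hwv, Fin.val_inj]

theorem clear_spec (hn : s.var 0 = n) :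
    HasSet 12 (∅ : Finset (Fin n)) ((ForProgram.upto 24 0 clearCell).run s) := by
  have := ForProgram.run_upto (p := clearCell) (x := 24) hn (by decide)
    (fun i u => ∀ v : Fin n, (v : ℕ) < i → u.arr 12 v = 0) (by simp) ?_
  · intro v
    simpa using this v v.2
  · intro i u hi hI hx hag v hv
    by_cases hvi : (v : ℕ) = i
    · simp [clearCell, hx, hvi]
    · simp [clearCell, hx, hvi, hI v (by omega)]

theorem endSegment_spec (h : Ctx D T k s) (hT : 0 < T.card) {P : List (Fin n)} (hP : HasPath P s)
    {m j : ℕ} {c : ℕ → ℕ} (hm : m < P.length) (h18 : s.var 18 = m) (hj : j ≤ k)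
    (hc : D.IsCutting T k P m c j) (h31 : s.var 31 = j)
    (hQ : HasSet 12 (segment P (c j) (m + 1)) s)
    (hA : ∃ A : Finset (Fin n), HasSet 4 A s ∧ ∀ v, v ∈ A ↔ ∃ i < j, P[c (i + 1) - 1]? = some v)
    (h19 : D.IsRich T k (segment P (c j) (m + 1)) ∧ s.var 19 = 1 ∨
      ¬ D.IsRich T k (segment P (c j) (m + 1)) ∧ s.var 19 = 0) :
    ∃ c' j', CutState D T k P (m + 1) c' j' (endSegment.run s) := by
  rcases h19 with ⟨hr, h19⟩ | ⟨hr, h19⟩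
  · by_cases hjk : j < k
    · refine ⟨Function.update c (j + 1) (m + 1), j + 1, hjk, hc.succ_of_isRich hT hjk hr, ?_, ?_,
        ?_⟩
      all_goals
        set s2 := (s.setArr 4 (P[m] : ℕ) 1).setVar 31 (j + 1) with hs2
        have hrun : endSegment.run s = (ForProgram.upto 24 0 clearCell).run s2 := by
          have h1 : ¬ (k - j = 0) := by omega
          simp only [endSegment, ForProgram.run_when, Expr.eval_var, h19, one_ne_zero, if_false,
            Expr.eval_minus, h.k_eq, h31, h1, ForProgram.run_block_cons,
            ForProgram.run_block_nil, ForProgram.run_store, ForProgram.run_assign,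
            Expr.eval_get, h18, Expr.eval_lit, Expr.eval_succ, State.setArr_var, hs2,
            hP.get_eq m hm]
        have hag := ForProgram.run_agree (.upto 24 0 clearCell) s2
        rw [hrun]
      · rw [hag.var 31 (by decide)]
        simp [hs2]
      · rw [Function.update_self]
        have h1 := clear_spec (n := n) (s := s2) (by simpa [hs2] using h.n_eq)
        have h2 : segment P (m + 1) (m + 1) = ∅ := by simp [MultiDigraph.segment]
        rw [h2]
        exact h1
      · obtain ⟨A, hA, hAm⟩ := hA
        refine ⟨insert P[m] A, ?_, fun v => ?_⟩
        · exact (show HasSet 4 (insert P[m] A) s2 from hA.insert _).agree hag (by decide)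
        · rw [Finset.mem_insert, hAm]
          constructor
          · rintro (rfl | ⟨i, hi, hv⟩)
            · refine ⟨j, by omega, ?_⟩
              rw [Function.update_self, Nat.add_sub_cancel]
              exact List.getElem?_eq_getElem hm
            · refine ⟨i, by omega, ?_⟩
              rw [Function.update_of_ne (by omega)]
              exact hv
          · rintro ⟨i, hi, hv⟩
            by_cases hij : i = j
            · subst hij
              rw [Function.update_self, Nat.add_sub_cancel, List.getElem?_eq_getElem hm,
                Option.some.injEq] at hv
              exact .inl hv.symm
            · rw [Function.update_of_ne (by omega)] at hv
              exact .inr ⟨i, by omega, hv⟩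
    · have hrun : endSegment.run s = s := by
        have h1 : k - j = 0 := by omega
        simp [endSegment, h19, h.k_eq, h31, h1]
      rw [hrun]
      -- All `k` cuts have been made; the remainder may be rich from now on.
      exact ⟨c, j, hj, hc.succ_of_not fun h => absurd h hjk, h31, hQ, hA⟩
  · have hrun : endSegment.run s = s := by
      simp [endSegment, h19]
    rw [hrun]
    exact ⟨c, j, hj, hc.succ_of_not fun _ => hr, h31, hQ, hA⟩

theorem cutStep_spec (h : Ctx D T k s) (hh : HasHalves T s) (hT : 0 < T.card) {P : List (Fin n)}
    (hP : HasPath P s) {m j : ℕ} {c : ℕ → ℕ} (hm : m < P.length) (h18 : s.var 18 = m)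
    (hs : CutState D T k P m c j s) : ∃ c' j', CutState D T k P (m + 1) c' j' (cutStep.run s) := by
  set s1 := s.setArr 12 (P[m] : ℕ) 1 with hs1
  have hag1 : Agree [] [12] s s1 := ForProgram.run_agree (.store 12 (.lit P[m]) (.lit 1)) s
  have hrun : cutStep.run s = endSegment.run (testRich.run s1) := by
    have h1 : ¬ (P.length - m = 0) := by omega
    simp only [cutStep, ForProgram.run_when, Expr.eval_minus, Expr.eval_var, hP.length_eq, h18,
      h1, if_false, ForProgram.run_block_cons, ForProgram.run_block_nil, ForProgram.run_store,
      Expr.eval_get, Expr.eval_lit, hP.get_eq m hm, hs1]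
  have hag2 := ForProgram.run_agree testRich s1
  have hc1 := h.agree hag1 (by decide) (by decide)
  have hQ : HasSet 12 (segment P (c j) (m + 1)) s1 := by
    rw [segment_succ hs.cutting.le hm]
    exact hs.rest.insert _
  obtain ⟨A, hA, hAm⟩ := hs.ends
  rw [hrun]
  exact endSegment_spec (hc1.agree hag2 (by decide) (by decide)) hT
    ((hP.agree hag1 (by decide) (by decide)).agree hag2 (by decide) (by decide)) hm
    (((hag2.var 18 (by decide)).trans (hag1.var 18 (by decide))).trans h18) hs.le hs.cutting
    (((hag2.var 31 (by decide)).trans (hag1.var 31 (by decide))).trans hs.count_eq)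
    (hQ.agree hag2 (by decide)) ⟨A, (hA.agree hag1 (by decide)).agree hag2 (by decide), hAm⟩
    (testRich_spec hc1 (hh.agree hag1 (by decide) (by decide)) hQ)

theorem cutPath_spec (h : Ctx D T k s) (hh : HasHalves T s) (hT : 0 < T.card) {P : List (Fin n)}
    (hP : HasPath P s) (hPn : P.Nodup) (h31 : s.var 31 = 0) (h12 : ∀ v : Fin n, s.arr 12 v = 0)
    (h4 : ∀ v : Fin n, s.arr 4 v = 0) :
    ∃ c j, CutState D T k P P.length c j (cutPath.run s) := by
  have hlen : P.length ≤ n := by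
    have := hPn.length_le_card
    simpa using this
  have := ForProgram.run_upto (p := cutStep) (x := 18) h.n_eq (by decide)
    -- The loop makes `n` rounds, and those beyond the end of the path do nothing.
    (fun i u => ∃ c j, CutState D T k P (min i P.length) c j u) ?_ ?_
  · obtain ⟨c, j, hs⟩ := this
    rw [Nat.min_eq_right hlen] at hs
    exact ⟨c, j, hs⟩
  · refine ⟨fun _ => 0, 0, Nat.zero_le _, ?_, by simpa using h31, ?_, ∅, ?_, by simp⟩
    · rw [Nat.zero_min]
      exact isCutting_zero hT
    · have h2 : segment P 0 (min 0 P.length) = ∅ := by simp [MultiDigraph.segment]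
      rw [h2]
      intro v
      simpa using h12 v
    · intro v
      simpa using h4 v
  · rintro i u hi ⟨c, j, hs⟩ hx hag
    have hPu := hP.agree hag (by decide) (by decide)
    have hset : ∀ {m c j} {w : State}, CutState D T k P m c j w →
        CutState D T k P m c j (w.setVar 18 (i + 1)) := fun h =>
      ⟨h.le, h.cutting, by simpa using h.count_eq, h.rest, h.ends⟩
    by_cases hil : i < P.length
    · rw [Nat.min_eq_left hil.le] at hs
      rw [Nat.min_eq_left (by omega)]
      obtain ⟨c', j', hs'⟩ := cutStep_spec (h.agree hag (by decide) (by decide))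
        (hh.agree hag (by decide) (by decide)) hT hPu hil hx hs
      exact ⟨c', j', hset hs'⟩
    · rw [Nat.min_eq_right (by omega)] at hs ⊢
      have hrun : cutStep.run u = u := by
        have h1 : P.length - i = 0 := by omega
        simp [cutStep, hPu.length_eq, hx, h1]
      rw [hrun]
      exact ⟨c, j, hset hs⟩

end Ram

/-! ### Input, assembly and running time -/

namespace Ram

open MultiDigraph

variable {n : ℕ} {D : MultiDigraph (Fin n)} {T : Finset (Fin n)} {k : ℕ} {s u : State}

theorem inputState_mult (v w : Fin n) : (inputState k D T).arr 0 (v * n + w) = D.mult v w := by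
  have hw := w.2
  have h : (v : ℕ) * n + w < n * n :=
    calc (v : ℕ) * n + w < v * n + n := by omega
      _ = (v + 1) * n := by ring
      _ ≤ n * n := Nat.mul_le_mul_right _ v.2
  have h1 : Fin.divNat ⟨v * n + w, h⟩ = v := by
    apply Fin.ext
    change ((v : ℕ) * n + w) / n = v
    rw [Nat.mul_comm, Nat.mul_add_div (by omega), Nat.div_eq_of_lt hw, Nat.add_zero]
  have h2 : Fin.modNat ⟨v * n + w, h⟩ = w := by
    apply Fin.ext
    change ((v : ℕ) * n + w) % n = w
    rw [Nat.mul_comm, Nat.mul_add_mod, Nat.mod_eq_of_lt hw]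
  simp only [inputState, if_true, dif_pos h, h1, h2]

theorem inputState_mem : HasSet 1 T (inputState k D T) := by
  intro v
  have h : (∃ w ∈ T, (w : ℕ) = v) ↔ v ∈ T := by
    constructor
    · rintro ⟨w, hw, h⟩
      exact Fin.ext h ▸ hw
    · intro hv
      exact ⟨v, hv, rfl⟩
  by_cases hv : v ∈ T
  · have := h.2 hv
    simp only [inputState, one_ne_zero, if_false, if_true, if_pos this, if_pos hv]
  · have := fun h' => hv (h.1 h')
    simp only [inputState, one_ne_zero, if_false, if_true, if_neg this, if_neg hv]

theorem initTables_spec (hs : s = inputState k D T) :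
    (initTables.run s).var 3 = T.card ∧ (initTables.run s).var 8 = n + 2 ∧
      (∀ v : Fin n, (initTables.run s).arr 5 v = v * n) ∧ HasSet 2 T (initTables.run s) := by
  have hn : s.var 0 = n := by simp [hs, inputState]
  have hT : HasSet 1 T s := hs ▸ inputState_mem
  have := ForProgram.run_upto (p := initCell) (x := 7) hn (by decide)
    (fun i u => u.var 6 = i * n ∧ u.var 3 = (T.filter fun v : Fin n => (v : ℕ) < i).card ∧
      ∀ v : Fin n, (v : ℕ) < i → u.arr 5 v = v * n ∧ u.arr 2 v = if v ∈ T then 1 else 0)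
    (by simp [hs, inputState]) ?_
  · have hag := ForProgram.run_agree (.upto 7 0 initCell) s
    rw [card_filter_lt_self] at this
    have hrun : initTables.run s = ((ForProgram.upto 7 0 initCell).run s).setVar 8 (n + 2) := by
      simp only [initTables, ForProgram.run_seq, ForProgram.run_assign, Expr.eval_plus,
        Expr.eval_var, Expr.eval_lit, hag.var 0 (by decide), hn]
    rw [hrun]
    exact ⟨by simpa using this.2.1, by simp, fun v => (this.2.2 v v.2).1,
      fun v => (this.2.2 v v.2).2⟩
  · rintro i u hi ⟨h1, h2, h3⟩ hx hag
    obtain ⟨a, rfl⟩ : ∃ a : Fin n, (a : ℕ) = i := ⟨⟨i, hi⟩, rfl⟩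
    have hTu := hT.agree hag (by decide) a
    have hnu : u.var 0 = n := (hag.var 0 (by decide)).trans hn
    rw [card_filter_lt_succ, ← h2]
    refine ⟨?_, ?_, fun v hv => ?_⟩
    · simp [initCell, h1, hnu, Nat.succ_mul]
    · simp [initCell, hx, hTu]
    · by_cases hva : v = a
      · subst hva
        simp [initCell, hx, h1, hTu]
      · have hne : (v : ℕ) ≠ a := fun h => hva (Fin.ext h)
        have := h3 v (by omega)
        simp [initCell, hx, hne, this]

theorem initLimits_spec {a b : ℕ} (h3 : s.var 3 = a) (h8 : s.var 8 = b) (h5 : s.var 5 = 0) :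
    (initLimits.run s).var 4 = 2 ^ a ∧ (initLimits.run s).var 5 = b * b := by
  set s1 := s.setVar 4 1 with hs1
  have hag1 : Agree [4] [] s s1 := ForProgram.run_agree (.assign 4 (.lit 1)) s
  have hag2 := ForProgram.run_agree (.upto 7 3 doubleLimit) s1
  have h1 := ForProgram.run_upto (p := doubleLimit) (x := 7) (s := s1)
    ((hag1.var 3 (by decide)).trans h3) (by decide) (fun i u => u.var 4 = 2 ^ i)
    (by simp [hs1]) (by
      intro i u _ hI _ _
      simp only [doubleLimit, ForProgram.run_assign, Expr.eval_plus, Expr.eval_var, hI,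
        State.setVar_var]
      simp [pow_succ]
      omega)
  have hrun : initLimits.run s = (ForProgram.upto 7 8 addLimit).run
    ((ForProgram.upto 7 3 doubleLimit).run s1) := rfl
  rw [hrun]
  generalize (ForProgram.upto 7 3 doubleLimit).run s1 = s2 at *
  have hag3 := ForProgram.run_agree (.upto 7 8 addLimit) s2
  have h8' : s2.var 8 = b := by
    rw [hag2.var 8 (by decide), hag1.var 8 (by decide), h8]
  have h5' : s2.var 5 = 0 := by
    rw [hag2.var 5 (by decide), hag1.var 5 (by decide), h5]
  refine ⟨(hag3.var 4 (by decide)).trans h1, ?_⟩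
  refine ForProgram.run_upto (p := addLimit) (x := 7) (s := s2) h8' (by decide)
    (fun i u => u.var 5 = i * b) (by simp [h5']) ?_
  intro i u _ hI _ hag
  have : u.var 8 = b := (hag.var 8 (by decide)).trans h8'
  simp [addLimit, hI, this, Nat.succ_mul]

theorem mainPhase_spec (h : Ctx D T k s) (hT : T.card + 1 = 2 * brambleOrder k)
    (hL : D.IsLinked T (brambleOrder k - 1) (brambleOrder k - 1)) (h2 : HasSet 2 T s)
    (hv : ∀ x ∈ [2, 9, 10, 31], s.var x = 0) (ha : ∀ a ∈ [4, 8, 12], s.arr a = fun _ => 0) :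
    ∃ (P : List (Fin n)) (A : Finset (Fin n)), HasOutput (mainPhase.run s) T P A ∧ D.IsPath P ∧
      IsHittingSet (D.tBramble T (brambleOrder k)) P.toFinset ∧ A ⊆ P.toFinset ∧
      D.IsWellLinked A ∧ A.card = k := by
  have hg : 0 < brambleOrder k := by omega
  have hT1 : 0 < T.card := by omega
  have hag := ForProgram.run_agree mainPhase s
  have hag1 := ForProgram.run_agree halfTable s
  have hag2 := ForProgram.run_agree buildPath (halfTable.run s)
  have hag3 := ForProgram.run_agree cutPath (buildPath.run (halfTable.run s))
  have hh1 := halfTable_spec h (hv 9 (by simp)) (hv 10 (by simp))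
  have hc1 := h.agree hag1 (by decide) (by decide)
  obtain ⟨P, hP, hS, hbig⟩ := buildPath_spec hc1
    ((hag1.var 2 (by decide)).trans (hv 2 (by simp)))
    (fun v => by rw [hag1.arr 8 (by decide), ha 8 (by simp)])
  have hhit : IsHittingSet (D.tBramble T (brambleOrder k)) P.toFinset :=
    isHittingSet_of_forall_not_isBig (by omega) hbig
  obtain ⟨c, j, hcut⟩ := cutPath_spec (hc1.agree hag2 (by decide) (by decide))
    (hh1.agree hag2 (by decide) (by decide)) hT1 hP hS.1
    (by rw [hag2.var 31 (by decide), hag1.var 31 (by decide), hv 31 (by simp)])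
    (fun v => by rw [hag2.arr 12 (by decide), hag1.arr 12 (by decide), ha 12 (by simp)])
    (fun v => by rw [hag2.arr 4 (by decide), hag1.arr 4 (by decide), ha 4 (by simp)])
  obtain rfl := hcut.cutting.eq hT hL hhit hcut.le
  obtain ⟨A, hA, hAm⟩ := hcut.ends
  have hP3 := hP.agree hag3 (by decide) (by decide)
  have hw := hcut.cutting.isWellLinked hT hL hhit hS.1 hS.2.1 hAm
  refine ⟨P, A, ⟨h2.agree hag (by decide), hP3.length_eq, fun i => hP3.get_eq i i.2, hA⟩,
    ⟨?_, hS.1, hS.2.1⟩, hhit, ?_, hw.1, hw.2⟩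
  -- The empty set cannot hit a bramble of positive order.
  · rintro rfl
    have := (hasOrder_tBramble hT hL).2 ⟨_, hhit, rfl⟩
    simp at this
    omega
  · intro v hvA
    obtain ⟨i, _, hi⟩ := (hAm v).1 hvA
    exact List.mem_toFinset.2 (List.mem_of_getElem? hi)

/-- Makes |T| quadratic in `k`, and with it the exponent of the number of subsets tested. -/
theorem two_mul_brambleOrder_le (k : ℕ) : 2 * brambleOrder k ≤ k ^ 2 + 3 * k := by
  rw [brambleOrder_eq]
  have h1 : 2 * (k / 2) ≤ k := by omega
  have h2 : k * (2 * (k / 2)) ≤ k * k := Nat.mul_le_mul_left _ h1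
  nlinarith

/-- The running time, in terms of a common bound for all loop limits. -/
theorem time_le {a n k d : ℕ} (hn : 0 < n) (hk : 0 < k) (ha : a + 1 = 2 * brambleOrder k) :
    (((2 ^ a * (n + 2) ^ 2 + 1) ^ d : ℕ) : ℝ) ≤ (16 ^ d * 2 ^ d : ℕ) *
      (2 : ℝ) ^ (((8 * d : ℕ) : ℝ) * (k : ℝ) ^ 2 * Real.log k) * (n : ℝ) ^ (8 * d) := by
  have h1 : 2 ^ a * (n + 2) ^ 2 + 1 ≤ 2 ^ a * (16 * n ^ 2) := by
    have h2 : 1 ≤ 2 ^ a := Nat.one_le_two_pow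
    have h3 : (n + 2) ^ 2 + 1 ≤ 16 * n ^ 2 := by nlinarith
    calc 2 ^ a * (n + 2) ^ 2 + 1 ≤ 2 ^ a * ((n + 2) ^ 2 + 1) := by rw [Nat.mul_add]; omega
      _ ≤ _ := Nat.mul_le_mul_left _ h3
  have h2 : (2 ^ a * (n + 2) ^ 2 + 1) ^ d ≤ 16 ^ d * 2 ^ (a * d) * n ^ (8 * d) :=
    calc (2 ^ a * (n + 2) ^ 2 + 1) ^ d ≤ (2 ^ a * (16 * n ^ 2)) ^ d := Nat.pow_le_pow_left h1 d
      _ = 16 ^ d * 2 ^ (a * d) * n ^ (2 * d) := by rw [mul_pow, mul_pow, pow_mul, pow_mul]; ring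
      _ ≤ _ := Nat.mul_le_mul_left _ (Nat.pow_le_pow_right hn (by omega))
  have h3 : (2 : ℝ) ^ (a * d) ≤
      2 ^ d * (2 : ℝ) ^ (((8 * d : ℕ) : ℝ) * (k : ℝ) ^ 2 * Real.log k) := by
    have hb := two_mul_brambleOrder_le k
    -- For k = 1 the logarithm vanishes, but |T| = 1 and the factor `2 ^ d` pays. For k ≥ 2 one has
    -- log k ≥ 1/2, so |T| ≤ 4k² ≤ 8k² log k.
    rcases Nat.eq_or_lt_of_le hk with rfl | hk2
    · have : a = 1 := by
        have : brambleOrder (Nat.succ 0) = 1 := rfl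
        omega
      simp [this]
    · have hlog : (1 / 2 : ℝ) ≤ Real.log k := by
        have h4 : Real.log 2 ≤ Real.log k :=
          Real.log_le_log (by norm_num) (by exact_mod_cast hk2)
        have := Real.log_two_gt_d9
        linarith
      have ha4 : a ≤ 4 * k ^ 2 := by nlinarith
      have h5 : ((a * d : ℕ) : ℝ) ≤ ((8 * d : ℕ) : ℝ) * (k : ℝ) ^ 2 * Real.log k := by
        have h6 : ((a * d : ℕ) : ℝ) ≤ ((4 * k ^ 2 * d : ℕ) : ℝ) := by
          exact_mod_cast Nat.mul_le_mul_right d ha4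
        have h7 : (0 : ℝ) ≤ ((8 * d : ℕ) : ℝ) * (k : ℝ) ^ 2 := by positivity
        have h8 := mul_le_mul_of_nonneg_left hlog h7
        push_cast at h6 h8 ⊢
        linarith
      have h6 : (2 : ℝ) ^ (a * d) ≤
          (2 : ℝ) ^ (((8 * d : ℕ) : ℝ) * (k : ℝ) ^ 2 * Real.log k) := by
        rw [← Real.rpow_natCast]
        exact Real.rpow_le_rpow_of_exponent_le (by norm_num) h5
      refine h6.trans (le_mul_of_one_le_left (by positivity) (one_le_pow₀ (by norm_num)))
  calc (((2 ^ a * (n + 2) ^ 2 + 1) ^ d : ℕ) : ℝ) ≤ ((16 ^ d * 2 ^ (a * d) * n ^ (8 * d) : ℕ) : ℝ) := by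
        exact_mod_cast h2
    _ = 16 ^ d * 2 ^ (a * d) * (n : ℝ) ^ (8 * d) := by push_cast; ring
    _ ≤ 16 ^ d * (2 ^ d * (2 : ℝ) ^ (((8 * d : ℕ) : ℝ) * (k : ℝ) ^ 2 * Real.log k)) *
        (n : ℝ) ^ (8 * d) := by gcongr
    _ = _ := by push_cast; ring

theorem algorithm_spec (hT : T.card + 1 = 2 * brambleOrder k)
    (hL : D.IsLinked T (brambleOrder k - 1) (brambleOrder k - 1)) {B : ℕ}
    (hB : B = 2 ^ T.card * (n + 2) ^ 2) :
    ∃ t ≤ (ForProgram.seq initTables (.seq initLimits mainPhase)).cost B,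
      ∃ (s : State) (P : List (Fin n)) (A : Finset (Fin n)),
        Exec algorithm (inputState k D T) t s ∧ HasOutput s T P A ∧ D.IsPath P ∧
        IsHittingSet (D.tBramble T (brambleOrder k)) P.toFinset ∧ A ⊆ P.toFinset ∧
        D.IsWellLinked A ∧ A.card = k := by
  obtain ⟨s, hs⟩ : ∃ s, s = inputState k D T := ⟨_, rfl⟩
  have hv : ∀ x, x ≠ 0 → x ≠ 1 → s.var x = 0 := by
    intro x h0 h1
    simp [hs, inputState, h0, h1]
  have ha : ∀ a, a ≠ 0 → a ≠ 1 → s.arr a = fun _ => 0 := by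
    intro a h0 h1
    funext i
    simp [hs, inputState, h0, h1]
  have hn : s.var 0 = n := by simp [hs, inputState]
  have hk : s.var 1 = k := by simp [hs, inputState]
  -- Variable `3`, which holds |T|, is also a loop limit and has to be below `B`.
  have hpow : T.card < 2 ^ T.card := Nat.lt_two_pow_self
  have hB1 : 2 ^ T.card ≤ B := by
    rw [hB]
    exact Nat.le_mul_of_pos_right _ (by positivity)
  have hB2 : (n + 2) * (n + 2) ≤ B := by
    rw [hB, sq]
    exact Nat.le_mul_of_pos_left _ (by positivity)
  have hB3 : n + 2 ≤ B := le_trans (Nat.le_mul_of_pos_left _ (by omega)) hB2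
  have hag1 := ForProgram.run_agree initTables s
  obtain ⟨h3, h8, h5, h2⟩ := initTables_spec hs
  have hag2 := ForProgram.run_agree initLimits (initTables.run s)
  obtain ⟨h4, h5'⟩ := initLimits_spec h3 h8
    ((hag1.var 5 (by decide)).trans (hv 5 (by decide) (by decide)))
  have hctx : Ctx D T k (initLimits.run (initTables.run s)) := by
    constructor
    · rw [hag2.var 0 (by decide), hag1.var 0 (by decide), hn]
    · rw [hag2.var 1 (by decide), hag1.var 1 (by decide), hk]
    · rw [hag2.var 3 (by decide), h3]
    · exact h4
    · exact h5'
    · intro v w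
      rw [hag2.arr 0 (by decide), hag1.arr 0 (by decide), hs]
      exact inputState_mult v w
    · intro v
      rw [hag2.arr 1 (by decide), hag1.arr 1 (by decide), hs]
      exact inputState_mem v
    · intro v
      rw [hag2.arr 5 (by decide)]
      exact h5 v
  obtain ⟨P, A, hout⟩ := mainPhase_spec hctx hT hL (h2.agree hag2 (by decide))
    (by
      intro x hx
      fin_cases hx <;> rw [hag2.var _ (by decide), hag1.var _ (by decide)] <;>
        exact hv _ (by decide) (by decide))
    (by
      intro a hx
      fin_cases hx <;> rw [hag2.arr _ (by decide), hag1.arr _ (by decide)] <;>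
        exact ha _ (by decide) (by decide))
  obtain ⟨t1, ht1, he1⟩ := initTables.exec initTables_wf B s (by
    intro y hy
    obtain rfl := List.mem_singleton.1 hy
    omega)
  obtain ⟨t2, ht2, he2⟩ := initLimits.exec initLimits_wf B (initTables.run s) (by
    intro y hy
    fin_cases hy
    · exact h3 ▸ by omega
    · exact h8 ▸ hB3)
  obtain ⟨t3, ht3, he3⟩ := mainPhase.exec mainPhase_wf B (initLimits.run (initTables.run s)) (by
    intro y hy
    fin_cases hy
    · exact hctx.n_eq ▸ by omega
    · exact h4 ▸ hB1
    · exact h5' ▸ hB2)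
  refine ⟨t1 + (t2 + t3), ?_, mainPhase.run (initLimits.run (initTables.run s)), P, A, ?_, hout⟩
  · simp only [ForProgram.cost]
    omega
  · rw [← hs]
    exact .seq he1 (.seq he2 he3)

end Ram

theorem mainTheorem4 :
    ∃ (prog : Ram.Program) (C c : ℕ),
      ∀ (k n : ℕ) (D : MultiDigraph (Fin n)) (T : Finset (Fin n)),
        (T.card : ℤ) = 2 * (brambleOrder k : ℤ) - 1 →
        D.IsLinked T (brambleOrder k - 1) (brambleOrder k - 1) →
        D.IsBramble (D.tBramble T (brambleOrder k)) ∧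
        MultiDigraph.HasOrder (D.tBramble T (brambleOrder k)) (brambleOrder k) ∧
        ∃ (t : ℕ) (s : Ram.State) (P : List (Fin n)) (A : Finset (Fin n)),
          Ram.Exec prog (Ram.inputState k D T) t s ∧
          (t : ℝ) ≤ C * (2 : ℝ) ^ ((c : ℝ) * (k : ℝ) ^ 2 * Real.log k) * (n : ℝ) ^ c ∧
          Ram.HasOutput s T P A ∧
          D.IsPath P ∧
          MultiDigraph.IsHittingSet (D.tBramble T (brambleOrder k)) P.toFinset ∧
          A ⊆ P.toFinset ∧ D.IsWellLinked A ∧ A.card = k := by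
  obtain ⟨b, d, hbd⟩ := Ram.ForProgram.exists_cost_le
    (.seq Ram.initTables (.seq Ram.initLimits Ram.mainPhase))
  -- `16 ^ d` absorbs the shift in (n+2)² + 1 ≤ 16n², and `2 ^ d` the case k = 1.
  refine ⟨Ram.algorithm, b * (16 ^ d * 2 ^ d), 8 * d, ?_⟩
  intro k n D T hcard hL
  have hT : T.card + 1 = 2 * brambleOrder k := by omega
  -- For k = 0 the cardinality hypothesis over the integers reads |T| = -1.
  have hk : 0 < k := by
    rcases Nat.eq_zero_or_pos k with rfl | hk
    · have : brambleOrder 0 = 0 := rfl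
      omega
    · exact hk
  have hn : 0 < n := by
    have := Finset.card_le_univ T
    rw [Fintype.card_fin] at this
    omega
  refine ⟨MultiDigraph.isBramble_tBramble (by omega), MultiDigraph.hasOrder_tBramble hT hL, ?_⟩
  obtain ⟨t, ht, s, P, A, he, hout⟩ := Ram.algorithm_spec hT hL rfl
  refine ⟨t, s, P, A, he, ?_, hout⟩
  have h1 : (t : ℝ) ≤ b * (((2 ^ T.card * (n + 2) ^ 2 + 1) ^ d : ℕ) : ℝ) := by
    exact_mod_cast ht.trans (hbd _)
  refine (h1.trans (mul_le_mul_of_nonneg_left (Ram.time_le hn hk hT) (Nat.cast_nonneg b))).trans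
    (le_of_eq ?_)
  push_cast
  ring
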